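/- Let $m\ge 2$ and $k\ge 0$ be integers. For a euclidean vector space $(V,g)$ of dimension $m$ let $\mathrm{Kr}\,V$ be the vector space of algebraic curvature tensors on $V$, i.e. of trilinear maps $R:V\times V\times V\to V$, $(X,Y,Z)\mapsto R_{X,Y}Z$, with $R_{X,Y}=-R_{Y,X}$, with every $R_{X,Y}$ skew-symmetric with respect to $g$, and with $R_{X,Y}Z+R_{Y,Z}X+R_{Z,X}Y=0$. Put $$\Psi^V_k(R)\;:=\;\frac{(-\Delta_g)^k}{[\,m+2k-2\,]_{2k}}\bigg|_0\Big(X\longmapsto\exp\Big(\sum_{r>0}\frac1{2r}\,\mathrm{tr}_V\big(R_{\,\cdot\,,X}X\big)^r\Big)\Big),$$ where $-\Delta_g=\sum_\mu\partial^2/\partial x_\mu^2$ in orthonormal coordinates, $[x]_s=x(x-1)\cdots(x-s+1)$ with $[x]_0=1$, and where the series converges for $X$ near $0$. Then: 1. $\Psi^V_k$ is a non-zero homogeneous polynomial of degree $k$ on $\mathrm{Kr}\,V$, and it is natural: $\Psi^W_k(\varphi_*R)=\Psi^V_k(R)$ for every linear isometry $\varphi:V\to W$ of $m$-dimensional euclidean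 vector spaces and every $R\in\mathrm{Kr}\,V$, where $\varphi_*R\in\mathrm{Kr}\,W$ is the tensor $(\varphi_*R)_{X,Y}Z=\varphi(R_{\varphi^{-1}X,\varphi^{-1}Y}\,\varphi^{-1}Z)$. In particular $\Psi^V_k$ is $\mathbf{O}(V,g)$-invariant. 2. Let $(M,g)$ be a non-empty compact smooth Riemannian manifold of dimension $m$ without boundary, with curvature tensor $R_p\in\mathrm{Kr}\,T_pM$, $R_{X,Y}=[\nabla_X,\nabla_Y]-\nabla_{[X,Y]}$, of the Levi-Civita connection $\nabla$, and let $\mathrm{Gr}_2TM=\{(p,\Sigma)\mid p\in M,\ \Sigma\subset T_pM\text{ a 2-plane}\}$ carry the Riemannian metric for which the projection to $M$ is a Riemannian submersion, whose horizontal spaces are given by Levi-Civita parallel transport of 2-planes, and which induces on every fibre $\mathrm{Gr}_2T_pM$ the metric pulled back from the scalar product $\frac12\mathrm{tr}(FF')$ on symmetric endomorphisms of $T_pM$ by $\Sigma\mapsto\mathrm{pr}_\Sigma$ (the orthogonal projection onto $\Sigma$). For $\Sigma=\mathrm{span}\{X,Y\}\subset T_pM$ let $\mathrm{sec}_{R_p}(\Sigma)=g(R_{Y,X}X,Y)/(g(X,X)g(Y,Y)-g(X,Y)^2)$,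 where $R=R_p$. Then the volumes of $M$ and of $\mathrm{Gr}_2TM$ are positive and finite, both integrands below are integrable, and $$\frac1{\mathrm{Vol}\,\mathrm{Gr}_2TM}\int_{\mathrm{Gr}_2TM}\mathrm{sec}_{R_p}^k(\Sigma)\,\mathrm{vol}(p,\Sigma)\;=\;\frac1{\mathrm{Vol}\,M}\int_M\Psi^{T_pM}_k(R_p)\,\mathrm{vol}_g(p).$$ -/

import Mathlib

open scoped Manifold ContDiff Bundle
open Bundle (RiemannianBundle)

namespace SecMoments

noncomputable section

/-! ### Algebraic curvature tensors on a euclidean vector space -/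

section Algebra

variable {V : Type*} [NormedAddCommGroup V] [InnerProductSpace ℝ V]

/-- The vector space `Kr V` of algebraic curvature tensors `R : (X, Y, Z) ↦ R_{X,Y} Z` on `V`:
alternating in the first two arguments, with skew-symmetric endomorphisms `R_{X,Y}`, and
satisfying the first Bianchi identity. -/
def Kr (V : Type*) [NormedAddCommGroup V] [InnerProductSpace ℝ V] :
    Submodule ℝ (V →ₗ[ℝ] V →ₗ[ℝ] V →ₗ[ℝ] V) where
  carrier := {R | (∀ X Y Z, R X Y Z = -R Y X Z) ∧
    (∀ X Y Z W, inner ℝ (R X Y Z) W = -inner ℝ Z (R X Y W)) ∧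
    (∀ X Y Z, R X Y Z + R Y Z X + R Z X Y = 0)}
  zero_mem' := by simp
  add_mem' := by
    rintro R S ⟨h1, h2, h3⟩ ⟨k1, k2, k3⟩
    refine ⟨fun X Y Z => ?_, fun X Y Z W => ?_, fun X Y Z => ?_⟩
    · simp only [LinearMap.add_apply]
      rw [h1, k1]; abel
    · simp only [LinearMap.add_apply, inner_add_left, inner_add_right]
      rw [h2, k2]; ring
    · have := congrArg₂ (· + ·) (h3 X Y Z) (k3 X Y Z)
      simp only [LinearMap.add_apply]
      rw [← add_zero (0 : V), ← this]; abel
  smul_mem' := by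
    rintro c R ⟨h1, h2, h3⟩
    refine ⟨fun X Y Z => ?_, fun X Y Z W => ?_, fun X Y Z => ?_⟩
    · simp only [LinearMap.smul_apply]
      rw [h1, smul_neg]
    · simp only [LinearMap.smul_apply, inner_smul_left, inner_smul_right]
      rw [h2]; simp
    · simp only [LinearMap.smul_apply, ← smul_add]
      rw [h3, smul_zero]

/-- The transport of a trilinear map along a linear isometry `φ`,
`(φ R)_{X,Y} Z = φ (R_{φ⁻¹ X, φ⁻¹ Y} φ⁻¹ Z)`. -/
def transport {W : Type*} [NormedAddCommGroup W] [InnerProductSpace ℝ W] (φ : V ≃ₗᵢ[ℝ] W)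
    (R : V →ₗ[ℝ] V →ₗ[ℝ] V →ₗ[ℝ] V) : W →ₗ[ℝ] W →ₗ[ℝ] W →ₗ[ℝ] W :=
  let e := φ.toLinearEquiv
  e.arrowCongr (e.arrowCongr (e.arrowCongr e)) R

/-- The endomorphism `R_{·,X} X : Y ↦ R_{Y,X} X`. -/
def jacobiOp (R : V →ₗ[ℝ] V →ₗ[ℝ] V →ₗ[ℝ] V) (X : V) : V →ₗ[ℝ] V :=
  (R.flip X).flip X

/-- The function `X ↦ exp (∑_{r > 0} 1/(2r) tr (R_{·,X} X)^r)`.  The series converges for `X` in a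
neighbourhood of the origin; only the germ at the origin is used. -/
def genFun (R : V →ₗ[ℝ] V →ₗ[ℝ] V →ₗ[ℝ] V) (X : V) : ℝ :=
  Real.exp (∑' r : ℕ, 1 / (2 * ((r : ℝ) + 1)) * LinearMap.trace ℝ V (jacobiOp R X ^ (r + 1)))

/-- `Ψ_k^V(R) = (-Δ_g)^k / [m + 2k - 2]_{2k} |₀ genFun R`, where `m = dim V`, and
`-Δ_g = ∑ ∂²/∂x_μ²` is Mathlib's `laplacian` (`Δ_g` being the positive Laplace operator), and
`[x]_s = x (x - 1) ⋯ (x - s + 1)` is the falling factorial. -/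
def Psi [FiniteDimensional ℝ V] (k : ℕ) (R : V →ₗ[ℝ] V →ₗ[ℝ] V →ₗ[ℝ] V) : ℝ :=
  ((fun f : V → ℝ => Laplacian.laplacian f)^[k] (genFun R)) 0 /
    (descPochhammer ℝ (2 * k)).eval ((Module.finrank ℝ V : ℝ) + 2 * k - 2)

/-- `f : W → ℝ` is a homogeneous polynomial of degree `k` on the vector space `W`. -/
def IsHomogeneousPoly {W : Type*} [AddCommMonoid W] [Module ℝ W] (k : ℕ) (f : W → ℝ) : Prop :=
  ∃ (n : ℕ) (l : Fin n → Module.Dual ℝ W) (p : MvPolynomial (Fin n) ℝ),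
    p.IsHomogeneous k ∧ ∀ w, f w = MvPolynomial.eval (fun i => l i w) p

/-- `g(R_{Y,X} X, Y) / (g(X,X) g(Y,Y) - g(X,Y)²)`. -/
def sectional (R : V →ₗ[ℝ] V →ₗ[ℝ] V →ₗ[ℝ] V) (X Y : V) : ℝ :=
  inner ℝ (R Y X X) Y / (inner ℝ X X * inner ℝ Y Y - inner ℝ X Y ^ 2)

end Algebra

/-- The set `Gr₂ V` of `2`-planes in `V`. -/
abbrev Gr2 (V : Type*) [AddCommGroup V] [Module ℝ V] :=
  {S : Submodule ℝ V // Module.finrank ℝ S = 2}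

section Sec

variable {V : Type*} [NormedAddCommGroup V] [InnerProductSpace ℝ V]

/-- The sectional curvature function `sec_R : Gr₂ V → ℝ`, computed in some basis of the plane;
it does not depend on the basis, see `sec_eq`. -/
def sec [FiniteDimensional ℝ V] (R : V →ₗ[ℝ] V →ₗ[ℝ] V →ₗ[ℝ] V) (S : Gr2 V) : ℝ :=
  let b := Module.finBasisOfFinrankEq ℝ S.1 S.2
  sectional R (b 0 : V) (b 1 : V)

theorem sec_eq [FiniteDimensional ℝ V] {R : V →ₗ[ℝ] V →ₗ[ℝ] V →ₗ[ℝ] V} (hR : R ∈ Kr V)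
    (S : Gr2 V) {X Y : V} (hS : S.1 = Submodule.span ℝ {X, Y}) :
    sec R S = sectional R X Y := by
  obtain ⟨h1, h2, -⟩ := hR
  unfold sec
  set b := Module.finBasisOfFinrankEq ℝ S.1 S.2 with hb
  have m0 : (b 0 : V) ∈ Submodule.span ℝ {X, Y} := hS ▸ (b 0).2
  have m1 : (b 1 : V) ∈ Submodule.span ℝ {X, Y} := hS ▸ (b 1).2
  obtain ⟨a, c, h0⟩ := Submodule.mem_span_pair.1 m0
  obtain ⟨d, e, h0'⟩ := Submodule.mem_span_pair.1 m1
  have hdet : a * e - c * d ≠ 0 := by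
    intro hz
    have hli := b.linearIndependent
    have hli' : LinearIndependent ℝ ![(b 0 : V), (b 1 : V)] := by
      have := hli.map' S.1.subtype (Submodule.ker_subtype _)
      have hfun : ![(b 0 : V), (b 1 : V)] = S.1.subtype ∘ b := by
        ext i; fin_cases i <;> rfl
      rw [hfun]
      exact this
    rw [LinearIndependent.pair_iff] at hli'
    have e1 := hli' e (-c) (by
      rw [← h0, ← h0']
      have : e • (a • X + c • Y) + -c • (d • X + e • Y) = (a * e - c * d) • X := by module
      rw [this, hz, zero_smul])
    have e2 := hli' d (-a) (by
      rw [← h0, ← h0']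
      have : d • (a • X + c • Y) + -a • (d • X + e • Y) = -(a * e - c * d) • Y := by module
      rw [this, hz, neg_zero, zero_smul])
    have hc : c = 0 := by linarith [e1.2]
    have ha : a = 0 := by linarith [e2.2]
    rw [ha, hc] at h0
    have : (b 0 : V) = 0 := by rw [← h0]; simp
    exact b.ne_zero 0 (by exact_mod_cast this)
  have s0 : ∀ A Z : V, R A A Z = 0 := fun A Z => by
    have h := h1 A A Z
    have h' : (2 : ℝ) • R A A Z = 0 := by
      rw [two_smul]; nth_rewrite 1 [h]; exact neg_add_cancel _
    exact (smul_eq_zero.1 h').resolve_left two_ne_zero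
  have s1 : ∀ A B Z : V, inner ℝ (R A B Z) Z = (0 : ℝ) := fun A B Z => by
    have := h2 A B Z Z
    rw [real_inner_comm] at this
    have h := real_inner_comm Z (R A B Z)
    linarith
  have s2 : inner ℝ (R Y X Y) X = -(inner ℝ (R Y X X) Y : ℝ) := by
    rw [h2, real_inner_comm]
  show sectional R (b 0 : V) (b 1 : V) = _
  rw [← h0, ← h0']
  have num : inner ℝ (R (d • X + e • Y) (a • X + c • Y) (a • X + c • Y)) (d • X + e • Y)
      = (a * e - c * d) ^ 2 * (inner ℝ (R Y X X) Y : ℝ) := by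
    simp only [map_add, map_smul, LinearMap.add_apply, LinearMap.smul_apply, s0,
      inner_add_left, inner_add_right, inner_smul_left, inner_smul_right, h1 X Y, s1, s2,
      inner_neg_left, smul_neg, smul_zero, inner_zero_left]
    simp
    ring
  have den : (inner ℝ (a • X + c • Y) (a • X + c • Y) * inner ℝ (d • X + e • Y) (d • X + e • Y)
      - inner ℝ (a • X + c • Y) (d • X + e • Y) ^ 2 : ℝ)
      = (a * e - c * d) ^ 2 * (inner ℝ X X * inner ℝ Y Y - inner ℝ X Y ^ 2) := by
    simp only [inner_add_left, inner_add_right, inner_smul_left, inner_smul_right,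
      real_inner_comm X Y]
    simp
    ring
  unfold sectional
  rw [num, den]
  exact mul_div_mul_left _ _ (pow_ne_zero 2 hdet)

end Sec

/-! ### Volume measure of a Riemannian metric given in local parametrizations -/

/-- Let `φ i : U i → X` be local parametrizations of a Riemannian manifold `X` by open subsets `U i`
of a coordinate space `W`, with Gram matrices `G i` of the metric in the coordinates.  The
Riemannian volume measure is the measure `√(det G i) dw` on every coordinate patch, i.e. the
supremum of the measures obtained from the single patches (these measures are the restrictions of
the volume measure to the patches). -/
def riemannianVolume {ι W κ X : Type*} [MeasureTheory.MeasureSpace W] [Fintype κ] [DecidableEq κ]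
    [MeasurableSpace X] (U : ι → Set W) (φ : (i : ι) → U i → X) (G : ι → W → Matrix κ κ ℝ) :
    MeasureTheory.Measure X :=
  ⨆ i, MeasureTheory.Measure.map (φ i)
    (MeasureTheory.Measure.comap Subtype.val
      (MeasureTheory.volume.withDensity fun w => ENNReal.ofReal √(G i w).det))

/-! ### Riemannian geometry in local coordinates -/

/-- The coordinate space `ℝᵐ`. -/
abbrev Coord (m : ℕ) := EuclideanSpace ℝ (Fin m)

/-- `∂f/∂xⁱ` for functions on `ℝᵐ`. -/
def partialD {m : ℕ} (i : Fin m) (f : Coord m → ℝ) (x : Coord m) : ℝ :=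
  fderiv ℝ f x (EuclideanSpace.single i 1)

section Manifold

variable {m : ℕ} {M : Type*} [TopologicalSpace M] [ChartedSpace (Coord m) M]

/-- The differential of the chart `e` at the point `q` of its source. -/
def chartD (e : OpenPartialHomeomorph M (Coord m)) (q : M) :
    TangentSpace (𝓡 m) q →L[ℝ] Coord m :=
  mfderiv (𝓡 m) (𝓡 m) e q

/-- The `i`-th coordinate vector field `∂/∂xⁱ` of the chart `e` at `q`. -/
def coordVec (e : OpenPartialHomeomorph M (Coord m)) (q : M) (i : Fin m) : TangentSpace (𝓡 m) q :=
  (chartD e q).inverse (EuclideanSpace.single i 1)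

/-- The `i`-th coordinate differential `dxⁱ` of the chart `e` at `q`. -/
def coordForm (e : OpenPartialHomeomorph M (Coord m)) (q : M) (i : Fin m) :
    TangentSpace (𝓡 m) q →L[ℝ] ℝ :=
  (EuclideanSpace.proj i).comp (chartD e q)

instance (p : M) : FiniteDimensional ℝ (TangentSpace (𝓡 m) p) :=
  inferInstanceAs (FiniteDimensional ℝ (Coord m))

/-- The Grassmann bundle `Gr₂ TM = {(p, Σ) | p ∈ M, Σ ∈ Gr₂ T_p M}`. -/
def Gr2TM (m : ℕ) (M : Type*) [TopologicalSpace M] [ChartedSpace (Coord m) M] :=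
  Σ p : M, Gr2 (TangentSpace (𝓡 m) p)

/-- The coordinate space of the Grassmann bundle: base coordinates and graph coordinates. -/
abbrev GrCoord (m : ℕ) := Coord m × (Fin (m - 2) × Fin 2 → ℝ)

/-- The two frame vectors `∂_{σ(a)} + ∑_c A_{c a} ∂_{σ(c)}`, `a = 0, 1`, at the point with
coordinates `x`. -/
def graphFrame (e : OpenPartialHomeomorph M (Coord m)) (σ : Fin 2 ⊕ Fin (m - 2) ≃ Fin m)
    (w : GrCoord m) (a : Fin 2) : TangentSpace (𝓡 m) (e.symm w.1) :=
  coordVec e (e.symm w.1) (σ (Sum.inl a)) +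
    ∑ c : Fin (m - 2), w.2 (c, a) • coordVec e (e.symm w.1) (σ (Sum.inr c))

/-- The plane spanned by the two vectors `graphFrame`. -/
def graphPlane (e : OpenPartialHomeomorph M (Coord m)) (σ : Fin 2 ⊕ Fin (m - 2) ≃ Fin m)
    (w : GrCoord m) : Submodule ℝ (TangentSpace (𝓡 m) (e.symm w.1)) :=
  Submodule.span ℝ (Set.range (graphFrame e σ w))

/-- The parameter domain of a chart of the Grassmann bundle over the domain of `e`. -/
def grDomain (e : OpenPartialHomeomorph M (Coord m)) : Set (GrCoord m) := {w | w.1 ∈ e.target}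

theorem linearIndependent_coordVec [IsManifold (𝓡 m) ∞ M]
    {e : OpenPartialHomeomorph M (Coord m)} (he : e ∈ atlas (Coord m) M) {q : M}
    (hq : q ∈ e.source) : LinearIndependent ℝ (coordVec e q) := by
  have hd : e.MDifferentiable (𝓡 m) (𝓡 m) := mdifferentiable_of_mem_atlas he
  have h1 : ((hd.mfderiv hq : TangentSpace (𝓡 m) q →L[ℝ] TangentSpace (𝓡 m) (e q))) =
      mfderiv (𝓡 m) (𝓡 m) e q := rfl
  have h2 : ∀ v : Coord m, (chartD e q).inverse v = (hd.mfderiv hq).symm v := by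
    intro v
    show (mfderiv (𝓡 m) (𝓡 m) e q).inverse v = _
    rw [← h1, ContinuousLinearMap.inverse_equiv]
    rfl
  have h3 : coordVec e q = fun i => ((hd.mfderiv hq).symm.toLinearEquiv.toLinearMap)
      (EuclideanSpace.single i (1 : ℝ) : Coord m) := by
    funext i; exact h2 _
  rw [h3]
  have h4 := (EuclideanSpace.basisFun (Fin m) ℝ).toBasis.linearIndependent
  have h5 := h4.map' ((hd.mfderiv hq).symm.toLinearEquiv.toLinearMap)
    (LinearEquiv.ker _)
  have h6 : (fun i => ((hd.mfderiv hq).symm.toLinearEquiv.toLinearMap)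
      (EuclideanSpace.single i (1 : ℝ) : Coord m)) =
      (hd.mfderiv hq).symm.toLinearEquiv.toLinearMap ∘
        (EuclideanSpace.basisFun (Fin m) ℝ).toBasis := by
    funext i
    simp only [Function.comp, OrthonormalBasis.coe_toBasis, EuclideanSpace.basisFun_apply]
  rw [h6]
  exact h5

theorem finrank_graphPlane [IsManifold (𝓡 m) ∞ M]
    {e : OpenPartialHomeomorph M (Coord m)} (he : e ∈ atlas (Coord m) M)
    (σ : Fin 2 ⊕ Fin (m - 2) ≃ Fin m) {w : GrCoord m} (hw : w ∈ grDomain e) :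
    Module.finrank ℝ (graphPlane e σ w) = 2 := by
  have hli := (linearIndependent_coordVec he (e.map_target hw)).comp σ σ.injective
  have : LinearIndependent ℝ (graphFrame e σ w) := by
    rw [Fintype.linearIndependent_iff] at hli ⊢
    intro g hg a
    have := hli (Sum.elim g fun c => ∑ a, g a * w.2 (c, a)) (by
      rw [Fintype.sum_sum_type, ← hg]
      simp only [Sum.elim_inl, Sum.elim_inr, Function.comp, graphFrame, smul_add,
        Finset.sum_add_distrib, Finset.smul_sum, Finset.sum_smul, smul_smul]
      congr 1
      exact Finset.sum_comm) (Sum.inl a)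
    simpa using this
  rw [graphPlane, finrank_span_eq_card this, Fintype.card_fin]

/-- The local parametrization of the Grassmann bundle by a chart `e` of `M` and graph coordinates
in the fibres.  The permutation `σ` singles out the two coordinate directions over which the
planes are graphs; as `σ` and `e` vary, the parametrizations cover the Grassmann bundle. -/
def grParam [IsManifold (𝓡 m) ∞ M] (i : atlas (Coord m) M × (Fin 2 ⊕ Fin (m - 2) ≃ Fin m))
    (w : grDomain i.1.1) : Gr2TM m M :=
  ⟨i.1.1.symm w.1.1, graphPlane i.1.1 i.2 w.1, finrank_graphPlane i.1.2 i.2 w.2⟩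

/-- The Borel sets of the manifold `Gr₂ TM`: those sets, whose preimages under all local
parametrizations are Borel sets. -/
instance [IsManifold (𝓡 m) ∞ M] : MeasurableSpace (Gr2TM m M) :=
  ⨅ i : atlas (Coord m) M × (Fin 2 ⊕ Fin (m - 2) ≃ Fin m),
    MeasurableSpace.map (grParam i) inferInstance

variable [RiemannianBundle (fun x : M => TangentSpace (𝓡 m) x)]

/-- The metric coefficients `g_{ij} = g(∂_i, ∂_j)` as functions of the coordinates. -/
def metricCoeff (e : OpenPartialHomeomorph M (Coord m)) (x : Coord m) :
    Matrix (Fin m) (Fin m) ℝ :=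
  Matrix.of fun i j => inner ℝ (coordVec e (e.symm x) i) (coordVec e (e.symm x) j)

/-- The Christoffel symbols `Γ^k_{ij} = 1/2 ∑_l g^{kl} (∂_i g_{jl} + ∂_j g_{il} - ∂_l g_{ij})` of
the Levi-Civita connection, `∇_{∂_i} ∂_j = ∑_k Γ^k_{ij} ∂_k`. -/
def christoffel (e : OpenPartialHomeomorph M (Coord m)) (k i j : Fin m) (x : Coord m) : ℝ :=
  1 / 2 * ∑ l, (metricCoeff e x)⁻¹ k l *
    (partialD i (fun y => metricCoeff e y j l) x + partialD j (fun y => metricCoeff e y i l) x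
      - partialD l (fun y => metricCoeff e y i j) x)

/-- The coefficients of the curvature tensor `R_{X,Y} Z = ∇_X ∇_Y Z - ∇_Y ∇_X Z - ∇_{[X,Y]} Z`
of the Levi-Civita connection, `R_{∂_i,∂_j} ∂_k = ∑_l R^l_{ijk} ∂_l`. -/
def curvCoeff (e : OpenPartialHomeomorph M (Coord m)) (l i j k : Fin m) (x : Coord m) : ℝ :=
  partialD i (christoffel e l j k) x - partialD j (christoffel e l i k) x +
    ∑ s, (christoffel e s j k x * christoffel e l i s x -
      christoffel e s i k x * christoffel e l j s x)

/-- The curvature tensor `R_p` of `M` in the point `p`, computed in the preferred chart at `p`. -/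
def curv (m : ℕ) {M : Type*} [TopologicalSpace M] [ChartedSpace (Coord m) M]
    [RiemannianBundle (fun x : M => TangentSpace (𝓡 m) x)] (p : M) : TangentSpace (𝓡 m) p →ₗ[ℝ] TangentSpace (𝓡 m) p →ₗ[ℝ]
    TangentSpace (𝓡 m) p →ₗ[ℝ] TangentSpace (𝓡 m) p :=
  let e := chartAt (Coord m) p
  let dx (i : Fin m) : TangentSpace (𝓡 m) p →ₗ[ℝ] ℝ := (coordForm e p i).toLinearMap
  ∑ i, ∑ j, ∑ k, (dx i).smulRight ((dx j).smulRight ((dx k).smulRight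
    (∑ l, curvCoeff e l i j k (e p) • coordVec e p l)))

/-- The sectional curvature `sec : Gr₂ TM → ℝ`, `(p, Σ) ↦ sec_{R_p}(Σ)`. -/
def secM (P : Gr2TM m M) : ℝ := sec (curv m P.1) P.2

/-- The function `p ↦ Ψ_k^{T_p M}(R_p)` on `M`. -/
def PsiM (m : ℕ) {M : Type*} [TopologicalSpace M] [ChartedSpace (Coord m) M]
    [RiemannianBundle (fun x : M => TangentSpace (𝓡 m) x)] (k : ℕ) (p : M) : ℝ :=
  Psi (V := TangentSpace (𝓡 m) p) k (curv m p)

/-- The volume measure `vol_g` of the Riemannian manifold `M`. -/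
def volM (m : ℕ) (M : Type*) [TopologicalSpace M] [ChartedSpace (Coord m) M] [MeasurableSpace M]
    [RiemannianBundle (fun x : M => TangentSpace (𝓡 m) x)] : MeasureTheory.Measure M :=
  riemannianVolume (fun e : atlas (Coord m) M => e.1.target) (fun e x => e.1.symm x.1)
    (fun e x => metricCoeff e.1 x)

/-- In the coordinates of `grParam`, the matrix of the orthogonal projection `pr_Σ` onto the plane
`Σ` with respect to the coordinate frame `∂_1, …, ∂_m`. -/
def projCoeff (e : OpenPartialHomeomorph M (Coord m)) (σ : Fin 2 ⊕ Fin (m - 2) ≃ Fin m)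
    (w : GrCoord m) : Matrix (Fin m) (Fin m) ℝ :=
  Matrix.of fun k j => coordForm e (e.symm w.1) k
    ((graphPlane e σ w).starProjection (coordVec e (e.symm w.1) j))

/-- The standard basis of the coordinate space of the Grassmann bundle. -/
def grBasis {m : ℕ} : Fin m ⊕ (Fin (m - 2) × Fin 2) → GrCoord m :=
  Sum.elim (fun i => (EuclideanSpace.single i 1, 0)) (fun c => (0, Pi.single c 1))

/-- The covariant derivative of `pr_Σ` in the direction of a coordinate vector of the Grassmann
bundle: `∂_a pr_Σ + [Γ_i, pr_Σ]` for the base coordinate `a = xⁱ`, where `Γ_i` has the entries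
`(Γ_i)^k_j = Γ^k_{ij}`, and `∂_a pr_Σ` for a fibre coordinate `a`.  It vanishes along a curve of
planes exactly if the planes are parallel along the base curve. -/
def covProj (e : OpenPartialHomeomorph M (Coord m)) (σ : Fin 2 ⊕ Fin (m - 2) ≃ Fin m)
    (w : GrCoord m) (a : Fin m ⊕ (Fin (m - 2) × Fin 2)) : Matrix (Fin m) (Fin m) ℝ :=
  let D : Matrix (Fin m) (Fin m) ℝ :=
    Matrix.of fun k j => fderiv ℝ (fun v => projCoeff e σ v k j) w (grBasis a)
  match a with
  | Sum.inl i =>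
    let Γ : Matrix (Fin m) (Fin m) ℝ := Matrix.of fun k j => christoffel e k i j w.1
    D + (Γ * projCoeff e σ w - projCoeff e σ w * Γ)
  | Sum.inr _ => D

/-- The Gram matrix of the natural Riemannian metric on `Gr₂ TM`.  The projection to `M` is a
Riemannian submersion whose horizontal spaces are given by Levi-Civita parallel transport of planes,
and the fibres carry the Fubini-Study metric induced by `Σ ↦ pr_Σ` and the scalar product
`1/2 tr (F F')` on symmetric endomorphisms.  Hence the scalar product of two tangent vectors is the
scalar product of their projections to `M` plus the Fubini-Study scalar product of their vertical
parts, which are the covariant derivatives of `pr_Σ`. -/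
def grGram (e : OpenPartialHomeomorph M (Coord m)) (σ : Fin 2 ⊕ Fin (m - 2) ≃ Fin m)
    (w : GrCoord m) :
    Matrix (Fin m ⊕ (Fin (m - 2) × Fin 2)) (Fin m ⊕ (Fin (m - 2) × Fin 2)) ℝ :=
  Matrix.fromBlocks (metricCoeff e w.1) 0 0 0 +
    Matrix.of fun a b => 1 / 2 * (covProj e σ w a * covProj e σ w b).trace

/-- The volume measure of the natural Riemannian metric on `Gr₂ TM`. -/
def volGr (m : ℕ) (M : Type*) [TopologicalSpace M] [ChartedSpace (Coord m) M]
    [IsManifold (𝓡 m) ∞ M] [RiemannianBundle (fun x : M => TangentSpace (𝓡 m) x)] :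
    MeasureTheory.Measure (Gr2TM m M) :=
  riemannianVolume
    (fun i : atlas (Coord m) M × (Fin 2 ⊕ Fin (m - 2) ≃ Fin m) => grDomain i.1.1)
    (fun i w => grParam i w) (fun i w => grGram i.1.1 i.2 w)

end Manifold

end

end SecMoments

/-!
The theorem holds because both `Ψ_k(R)` and the fibre average of `sec^k` are the same quotient of
Gaussian moments.

For `R` in `Kr V` the Jacobi operators `R_{·,X} X` are symmetric, and for `X` near the origin the
generating function equals `det (1 - R_{·,X} X)^(-1/2)`, which is the Gaussian integral over `Y` of
`exp (½ g(R_{Y,X} X, Y))` (`genFun_eq_gaussian`).  On homogeneous polynomials of degree `2k` the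
operator `(∑ ∂_μ²)^k` is `2^k k!` times the Gaussian expectation (`polyLap_iterate_homogeneous`), so that
applying it to the Taylor expansion of the generating function gives the expectation of
`g(R_{Y,X} X, Y)^k` for independent standard Gaussian vectors `X`, `Y` (`laplacian_iterate_genFun`).
The falling factorial `[m + 2k - 2]_{2k}` is the expectation of the `k`-th power of the Gram
determinant of `X` and `Y` (`integral_gramDet_pow`).  Hence `Ψ_k` is a quotient of Gaussian moments
(`Psi_eq_integral`).  In this form it is visibly a homogeneous polynomial and invariant under
isometries, and it takes the value `1` at the curvature tensor of constant curvature `1`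
(`Psi_constCurv`), so it does not vanish.

The plane spanned by `X` and `Y` is independent of the area of the parallelogram spanned by them
(`lintegral_graphCoord_mul_gramDet_pow_eq_mul`).  Since `g(R_{Y,X} X, Y)` is the sectional curvature
times the Gram determinant, `Ψ_k(R)` is the mean of `sec^k` over the plane spanned by a Gaussian pair
(`lintegral_sectional_pow`).

On a manifold, the plane spanned by a Gaussian pair in `T_p M` is described in the graph coordinates
`A` that come from a coordinate frame.  If `g` is the Gram matrix of the frame and `F` the matrix with
blocks `1` and `A`, then its density is a constant multiple of `det g · det (Fᵀ g F)^(-m/2)`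
(`lintegral_vec_eq_graphCoord`).  On the other hand, the covariant derivative of the orthogonal
projection onto a moving plane is an explicit matrix (`covariant_eq_projDeriv`), and the Gram
determinant of the metric of `Gr₂ TM` turns out to be the square of the product of this very density
with the volume density of `M` (`sqrt_det_grGram`).  Therefore the volume measure of `Gr₂ TM`
disintegrates, up to a constant factor, into the volume measure of `M` and the Gaussian averages over
the fibres (`lintegral_volGr`); that the measures of the charts glue follows from the transformation
law of the volume density (`lintegral_chartVolume_eq`, `iSup_eq_sum_restrict`).

It remains to see that the coordinate expression of the curvature is a tensor in `Kr T_p M`.  The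
Koszul formula determines how the Christoffel symbols transform, hence how the curvature does
(`chartD_curv`); its symmetries are those of a torsion-free metric connection (`curv_mem_Kr`).  By
compactness, `sec^k` is bounded in absolute value by a constant `C` (`exists_bound_sectional_pow`).
This gives integrability, and the disintegration formula for non-negative functions is applied to
`sec^k + C`.
-/

open scoped Manifold ContDiff Bundle
open Bundle (RiemannianBundle)

namespace SecMoments

noncomputable section

open MeasureTheory ProbabilityTheory Asymptotics Filter Topology

/-! ### Gaussian expectations of polynomials -/

/-- The standard Gaussian measure on `ι → ℝ`. -/
abbrev stdGauss (ι : Type*) [Fintype ι] : Measure (ι → ℝ) :=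
  Measure.pi fun _ : ι => gaussianReal 0 1

theorem gaussianPDFReal_std (x : ℝ) :
    gaussianPDFReal 0 1 x = (√(2 * Real.pi))⁻¹ * Real.exp (-(1 / 2) * x ^ 2) := by
  simp only [gaussianPDFReal, NNReal.coe_one, mul_one, sub_zero]
  congr 2; ring

theorem integrable_gaussianReal_iff {f : ℝ → ℝ} :
    Integrable f (gaussianReal 0 1) ↔ Integrable fun x => f x * Real.exp (-(1 / 2) * x ^ 2) := by
  rw [gaussianReal_of_var_ne_zero _ one_ne_zero,
    integrable_withDensity_iff (measurable_gaussianPDF 0 1) (ae_of_all _ fun x => gaussianPDF_lt_top)]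
  simp only [toReal_gaussianPDF, gaussianPDFReal_std]
  have : (fun x => f x * ((√(2 * Real.pi))⁻¹ * Real.exp (-(1 / 2) * x ^ 2))) =
      fun x => (√(2 * Real.pi))⁻¹ * (f x * Real.exp (-(1 / 2) * x ^ 2)) := by
    funext x; ring
  rw [this]
  have h : (√(2 * Real.pi))⁻¹ ≠ 0 := by positivity
  exact integrable_const_mul_iff (isUnit_iff_ne_zero.2 h) _

theorem integral_gaussianReal_std (f : ℝ → ℝ) :
    ∫ x, f x ∂gaussianReal 0 1 =
      (√(2 * Real.pi))⁻¹ * ∫ x, f x * Real.exp (-(1 / 2) * x ^ 2) := by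
  rw [integral_gaussianReal_eq_integral_smul one_ne_zero, ← integral_const_mul]
  congr 1; funext x
  rw [gaussianPDFReal_std, smul_eq_mul]; ring

theorem integrable_pow_mul_exp (n : ℕ) :
    Integrable fun x : ℝ => x ^ n * Real.exp (-(1 / 2) * x ^ 2) := by
  have h := integrable_rpow_mul_exp_neg_mul_sq (b := 1 / 2) (by norm_num) (s := n)
    (by have : (0 : ℝ) ≤ n := by positivity
        linarith)
  simpa using h

theorem integrable_pow_gaussianReal (n : ℕ) :
    Integrable (fun x : ℝ => x ^ n) (gaussianReal 0 1) :=
  integrable_gaussianReal_iff.2 (integrable_pow_mul_exp n)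

theorem integral_pow_succ_gaussianReal (n : ℕ) :
    ∫ x, x ^ (n + 1) ∂gaussianReal 0 1 = n * ∫ x, x ^ (n - 1) ∂gaussianReal 0 1 := by
  rw [integral_gaussianReal_std, integral_gaussianReal_std]
  have key := integral_mul_deriv_eq_deriv_mul_of_integrable (u := fun x : ℝ => x ^ n)
    (v := fun x : ℝ => -Real.exp (-(1 / 2) * x ^ 2)) (u' := fun x => n * x ^ (n - 1))
    (v' := fun x => x * Real.exp (-(1 / 2) * x ^ 2))
    (fun x _ => by simpa using hasDerivAt_pow n x)
    (fun x _ => by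
      have h1 : HasDerivAt (fun x : ℝ => -(1 / 2) * x ^ 2) (-x) x := by
        have := (hasDerivAt_pow 2 x).const_mul (-(1 / 2) : ℝ)
        convert! this using 1; simp
      convert! h1.exp.neg using 1; ring)
    (by
      have := integrable_pow_mul_exp (n + 1)
      convert! this using 1; funext x; simp only [Pi.mul_apply]; ring)
    (by
      have := (integrable_pow_mul_exp (n - 1)).const_mul (-(n : ℝ))
      convert! this using 1; funext x; simp only [Pi.mul_apply]; ring)
    (by
      have := (integrable_pow_mul_exp n).neg
      convert! this using 1; funext x; simp only [Pi.mul_apply, Pi.neg_apply]; ring)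
  have e1 : ∫ x : ℝ, x ^ (n + 1) * Real.exp (-(1 / 2) * x ^ 2) =
      ∫ x : ℝ, x ^ n * (x * Real.exp (-(1 / 2) * x ^ 2)) := by
    congr 1; funext x; ring
  rw [e1, key, ← integral_neg]
  have e2 : ∫ x : ℝ, -(n * x ^ (n - 1) * -Real.exp (-(1 / 2) * x ^ 2)) =
      n * ∫ x : ℝ, x ^ (n - 1) * Real.exp (-(1 / 2) * x ^ 2) := by
    rw [← integral_const_mul]; congr 1; funext x; ring
  rw [e2]; ring

section Poly

variable {ι : Type*} [Fintype ι]

theorem integrable_eval (p : MvPolynomial ι ℝ) :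
    Integrable (fun x => MvPolynomial.eval x p) (stdGauss ι) := by
  classical
  simp only [MvPolynomial.eval_eq']
  refine integrable_finsetSum _ fun s _ => Integrable.const_mul ?_ _
  exact Integrable.fintype_prod (f := fun i (t : ℝ) => t ^ s i) fun i =>
    integrable_pow_gaussianReal _

/-- The Gaussian expectation of a polynomial. -/
def gaussE (p : MvPolynomial ι ℝ) : ℝ := ∫ x, MvPolynomial.eval x p ∂stdGauss ι

theorem gaussE_C (c : ℝ) : gaussE (MvPolynomial.C c : MvPolynomial ι ℝ) = c := by
  simp [gaussE]

theorem gaussE_add (p q : MvPolynomial ι ℝ) : gaussE (p + q) = gaussE p + gaussE q := by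
  simp only [gaussE, map_add]
  exact integral_add (integrable_eval p) (integrable_eval q)

theorem gaussE_smul (c : ℝ) (p : MvPolynomial ι ℝ) : gaussE (c • p) = c * gaussE p := by
  simp only [gaussE, MvPolynomial.smul_eval]
  exact integral_const_mul _ _

theorem gaussE_sum {κ : Type*} (s : Finset κ) (f : κ → MvPolynomial ι ℝ) :
    gaussE (∑ i ∈ s, f i) = ∑ i ∈ s, gaussE (f i) := by
  simp only [gaussE, map_sum]
  exact integral_finsetSum _ fun i _ => integrable_eval _

theorem gaussE_monomial (s : ι →₀ ℕ) (c : ℝ) :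
    gaussE (MvPolynomial.monomial s c) = c * ∏ i, ∫ x, x ^ s i ∂gaussianReal 0 1 := by
  simp only [gaussE, MvPolynomial.eval_monomial]
  rw [integral_const_mul]
  congr 1
  rw [← integral_fintype_prod_eq_prod (fun i (t : ℝ) => t ^ s i)]
  congr 1; funext x
  rw [Finsupp.prod_fintype _ _ (by simp)]

/-- Gaussian integration by parts. -/
theorem gaussE_X_mul (i : ι) (p : MvPolynomial ι ℝ) :
    gaussE (MvPolynomial.X i * p) = gaussE (MvPolynomial.pderiv i p) := by
  classical
  induction p using MvPolynomial.induction_on' with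
  | add p q hp hq => rw [mul_add, gaussE_add, hp, hq, map_add, gaussE_add]
  | monomial s c =>
    rw [MvPolynomial.pderiv_monomial, mul_comm, MvPolynomial.X, MvPolynomial.monomial_mul, mul_one,
      gaussE_monomial, gaussE_monomial, Fintype.prod_eq_mul_prod_compl i,
      Fintype.prod_eq_mul_prod_compl i]
    have h1 : ∀ j ∈ ({i} : Finset ι)ᶜ, (s + Finsupp.single i 1 : ι →₀ ℕ) j = s j := by
      intro j hj
      have : i ≠ j := fun h => by simp [h] at hj
      simp [Finsupp.single_eq_of_ne this.symm]
    have h2 : ∀ j ∈ ({i} : Finset ι)ᶜ, (s - Finsupp.single i 1 : ι →₀ ℕ) j = s j := by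
      intro j hj
      have : i ≠ j := fun h => by simp [h] at hj
      simp [Finsupp.single_eq_of_ne this.symm]
    have h5 : ∀ t : ι →₀ ℕ, (∀ j ∈ ({i} : Finset ι)ᶜ, t j = s j) →
        ∏ j ∈ ({i} : Finset ι)ᶜ, ∫ x, x ^ t j ∂gaussianReal 0 1 =
          ∏ j ∈ ({i} : Finset ι)ᶜ, ∫ x, x ^ s j ∂gaussianReal 0 1 := fun t ht =>
      Finset.prod_congr rfl fun j hj => by rw [ht j hj]
    rw [h5 _ h1, h5 _ h2]
    have h3 : (s + Finsupp.single i 1 : ι →₀ ℕ) i = s i + 1 := by simp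
    have h4 : (s - Finsupp.single i 1 : ι →₀ ℕ) i = s i - 1 := by simp
    rw [h3, h4, integral_pow_succ_gaussianReal]
    ring

/-- The Laplacian `∑ ∂ᵢ²` on polynomials. -/
def polyLap : MvPolynomial ι ℝ →ₗ[ℝ] MvPolynomial ι ℝ :=
  ∑ i, (MvPolynomial.pderiv i).toLinearMap ∘ₗ (MvPolynomial.pderiv i).toLinearMap

theorem polyLap_apply (p : MvPolynomial ι ℝ) :
    polyLap p = ∑ i, MvPolynomial.pderiv i (MvPolynomial.pderiv i p) := by
  simp [polyLap]

theorem isHomogeneous_polyLap {p : MvPolynomial ι ℝ} {n : ℕ} (h : p.IsHomogeneous n) :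
    (polyLap p).IsHomogeneous (n - 2) := by
  rw [polyLap_apply]
  exact MvPolynomial.IsHomogeneous.sum _ _ _ fun i _ => h.pderiv.pderiv

/-- By Euler's identity and integration by parts, `n E[p] = E[∑ ∂ᵢ² p]` for a homogeneous
polynomial of degree `n`. -/
theorem gaussE_polyLap {p : MvPolynomial ι ℝ} {n : ℕ} (h : p.IsHomogeneous n) :
    gaussE (polyLap p) = n * gaussE p := by
  rw [polyLap_apply, gaussE_sum]
  simp_rw [← gaussE_X_mul]
  rw [← gaussE_sum, h.sum_X_mul_pderiv, ← Nat.cast_smul_eq_nsmul ℝ, gaussE_smul]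

/-- On homogeneous polynomials of degree `2k`, the `k`-th power of the Laplace operator is a multiple
of the Gaussian expectation. -/
theorem polyLap_iterate_homogeneous {p : MvPolynomial ι ℝ} {k : ℕ} (h : p.IsHomogeneous (2 * k)) :
    polyLap^[k] p = MvPolynomial.C (2 ^ k * k.factorial * gaussE p) := by
  induction k generalizing p with
  | zero =>
    have : p.totalDegree = 0 := by
      exact (MvPolynomial.totalDegree_zero_iff_isHomogeneous _).2 (by simpa using h)
    rw [MvPolynomial.totalDegree_eq_zero_iff_eq_C] at this
    rw [this, gaussE_C]; simp
  | succ k ih =>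
    rw [Function.iterate_succ_apply, ih (isHomogeneous_polyLap h), gaussE_polyLap h]
    congr 1
    rw [Nat.factorial_succ]; push_cast; ring

theorem polyLap_iterate_eq_zero {p : MvPolynomial ι ℝ} {j k : ℕ} (h : p.IsHomogeneous (2 * j))
    (hjk : j < k) : polyLap^[k] p = 0 := by
  obtain ⟨l, rfl⟩ := Nat.exists_eq_add_of_lt hjk
  have : polyLap (MvPolynomial.C (2 ^ j * j.factorial * gaussE p) : MvPolynomial ι ℝ) = 0 := by
    simp [polyLap_apply]
  rw [show j + l + 1 = (l + 1) + j by ring, Function.iterate_add_apply,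
    polyLap_iterate_homogeneous h, Function.iterate_succ_apply, this]
  exact iterate_map_zero polyLap l

end Poly

/-! ### Iterated Laplacians at the origin -/

section Analytic

variable {E F : Type*} [NormedAddCommGroup E] [NormedSpace ℝ E] [NormedAddCommGroup F]
  [NormedSpace ℝ F] [CompleteSpace F]

/-- An analytic function that vanishes to order `n + 1` has a derivative that vanishes to order
`n`. -/
theorem isBigO_fderiv_of_analyticAt {G : E → F} (hG : AnalyticAt ℝ G 0) (n : ℕ)
    (h : G =O[𝓝 0] fun x => ‖x‖ ^ (n + 1)) : fderiv ℝ G =O[𝓝 0] fun x => ‖x‖ ^ n := by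
  obtain ⟨p, r, hp⟩ := hG
  have hdiag : ∀ j ≤ n, ∀ y, (p j fun _ => y) = 0 := by
    intro j
    induction j using Nat.strong_induction_on with
    | _ j ih =>
      intro hj
      have hps : p.partialSum (j + 1) = fun y => p j fun _ => y := by
        funext z
        refine Finset.sum_eq_single _ (fun b hb hnb => ?_) fun hn => ?_
        · have hb' := lt_of_le_of_ne (Nat.lt_succ_iff.1 (Finset.mem_range.1 hb)) hnb
          exact ih b hb' (hb'.le.trans hj) z
        · exact absurd (Finset.mem_range.2 (Nat.lt_succ_self j)) hn
      have h1 := hp.hasFPowerSeriesAt.isBigO_sub_partialSum_pow (j + 1)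
      have h2 : G =O[𝓝 0] fun x => ‖x‖ ^ (j + 1) :=
        h.trans (IsBigO.of_bound 1 (by
          filter_upwards [Metric.ball_mem_nhds (0 : E) one_pos] with x hx
          simp only [norm_pow, norm_norm, one_mul]
          exact pow_le_pow_of_le_one (norm_nonneg _) (mem_ball_zero_iff.1 hx).le (by omega)))
      have h3 : (fun y => p j fun _ => y) =O[𝓝 0] fun y : E => ‖y‖ ^ (j + 1) := by
        have := h2.sub h1
        rw [hps] at this
        simpa using this
      exact h3.continuousMultilinearMap_apply_eq_zero
  let p' : FormalMultilinearSeries ℝ E F := fun j => if j ≤ n then 0 else p j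
  have hp' : HasFPowerSeriesOnBall G p' 0 r := by
    refine ⟨hp.r_le.trans (FormalMultilinearSeries.radius_le_of_le fun {j} => ?_), hp.r_pos,
      fun {y} hy => ?_⟩
    · simp only [p']
      split_ifs <;> simp
    · convert! hp.hasSum hy using 1
      funext j
      simp only [p']
      split_ifs with hj
      · simp [hdiag j hj]
      · rfl
  have h1 := hp'.fderiv.hasFPowerSeriesAt.isBigO_sub_partialSum_pow n
  have h2 : p'.derivSeries.partialSum n = fun _ => 0 := by
    funext y
    refine Finset.sum_eq_zero fun j hj => ?_
    rw [FormalMultilinearSeries.derivSeries_eq_zero]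
    · rfl
    · simp only [p']
      rw [if_pos]
      exact Finset.mem_range.1 hj
  rw [h2] at h1
  simpa using h1

end Analytic

section Laplace

variable {V : Type*} [NormedAddCommGroup V] [InnerProductSpace ℝ V] [FiniteDimensional ℝ V]
  {ι : Type*} [Fintype ι] (b : OrthonormalBasis ι ℝ V)

set_option linter.unusedSectionVars false

/-- The function on `V` given by a polynomial in the coordinates of an orthonormal basis. -/
def polyFun (p : MvPolynomial ι ℝ) (x : V) : ℝ := MvPolynomial.eval (b.repr x).ofLp p

theorem analyticAt_polyFun (p : MvPolynomial ι ℝ) (x : V) : AnalyticAt ℝ (polyFun b p) x := by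
  unfold polyFun
  induction p using MvPolynomial.induction_on with
  | C a => simpa using analyticAt_const
  | add p q hp hq => simp only [map_add]; exact hp.add hq
  | mul_X p i hp =>
    simp only [map_mul, MvPolynomial.eval_X]
    refine hp.mul ?_
    have : (fun x => (b.repr x).ofLp i) =
        ((EuclideanSpace.proj i : EuclideanSpace ℝ ι →L[ℝ] ℝ).comp
          (b.repr.toContinuousLinearEquiv : V →L[ℝ] EuclideanSpace ℝ ι)) := rfl
    rw [this]
    exact ContinuousLinearMap.analyticAt _ _

theorem fderiv_polyFun (p : MvPolynomial ι ℝ) (x : V) (i : ι) :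
    fderiv ℝ (polyFun b p) x (b i) = polyFun b (MvPolynomial.pderiv i p) x := by
  classical
  induction p using MvPolynomial.induction_on with
  | C a =>
    have : polyFun b (MvPolynomial.C a) = fun _ => a := by funext x; simp [polyFun]
    rw [this]; simp [polyFun]
  | add p q hp hq =>
    have : polyFun b (p + q) = polyFun b p + polyFun b q := by funext x; simp [polyFun]
    rw [this, fderiv_add (analyticAt_polyFun b p x).differentiableAt
      (analyticAt_polyFun b q x).differentiableAt, add_apply, hp, hq]
    simp [polyFun]
  | mul_X p j hp =>
    let l : V →L[ℝ] ℝ := (EuclideanSpace.proj j : EuclideanSpace ℝ ι →L[ℝ] ℝ).comp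
          (b.repr.toContinuousLinearEquiv : V →L[ℝ] EuclideanSpace ℝ ι)
    have : polyFun b (p * MvPolynomial.X j) = polyFun b p * l := by
      funext x; simp [polyFun, l]
    rw [this, fderiv_mul (analyticAt_polyFun b p x).differentiableAt l.differentiableAt]
    simp only [add_apply, smul_apply, smul_eq_mul, hp,
      ContinuousLinearMap.fderiv, Derivation.leibniz, MvPolynomial.pderiv_X]
    have hl : l (b i) = if j = i then 1 else 0 := by
      simp [l]
    have hl' : l x = (b.repr x).ofLp j := rfl
    rw [hl, hl']
    rcases eq_or_ne j i with rfl | hij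
    · simp [polyFun]
    · simp [polyFun, hij]

theorem laplacian_eq_sum {f : V → ℝ} (hf : AnalyticAt ℝ f x) :
    Laplacian.laplacian f x = ∑ i, fderiv ℝ (fun y => fderiv ℝ f y (b i)) x (b i) := by
  rw [InnerProductSpace.laplacian_eq_iteratedFDeriv_orthonormalBasis f b]
  refine Finset.sum_congr rfl fun i _ => ?_
  rw [iteratedFDeriv_two_apply]
  rw [fderiv_clm_apply hf.fderiv.differentiableAt (by fun_prop)]
  simp

theorem laplacian_polyFun (p : MvPolynomial ι ℝ) :
    Laplacian.laplacian (polyFun b p) = polyFun b (polyLap p) := by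
  funext x
  rw [laplacian_eq_sum b (analyticAt_polyFun b p x)]
  simp_rw [fderiv_polyFun]
  simp [polyFun, polyLap_apply]

theorem analyticAt_clm_apply_const {A : V → V →L[ℝ] ℝ} {x : V} (hA : AnalyticAt ℝ A x) (v : V) :
    AnalyticAt ℝ (fun y => A y v) x :=
  ((ContinuousLinearMap.apply ℝ ℝ v).analyticAt _).comp hA

theorem analyticAt_laplacian {G : V → ℝ} (hG : AnalyticAt ℝ G 0) :
    AnalyticAt ℝ (Laplacian.laplacian G) 0 := by
  have h1 : Laplacian.laplacian G =ᶠ[𝓝 0] fun x => ∑ i, fderiv ℝ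
      (fun y => fderiv ℝ G y (stdOrthonormalBasis ℝ V i)) x (stdOrthonormalBasis ℝ V i) := by
    filter_upwards [hG.eventually_analyticAt] with x hx
    exact laplacian_eq_sum _ hx
  refine AnalyticAt.congr ?_ h1.symm
  refine Finset.analyticAt_fun_sum _ fun i _ => ?_
  exact analyticAt_clm_apply_const (analyticAt_clm_apply_const hG.fderiv _).fderiv _

theorem isBigO_laplacian {G : V → ℝ} (hG : AnalyticAt ℝ G 0) {n : ℕ}
    (h : G =O[𝓝 0] fun x => ‖x‖ ^ (n + 2)) :
    Laplacian.laplacian G =O[𝓝 0] fun x => ‖x‖ ^ n := by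
  have h1 : Laplacian.laplacian G =ᶠ[𝓝 0] fun x => ∑ i, fderiv ℝ
      (fun y => fderiv ℝ G y (stdOrthonormalBasis ℝ V i)) x (stdOrthonormalBasis ℝ V i) := by
    filter_upwards [hG.eventually_analyticAt] with x hx
    exact laplacian_eq_sum _ hx
  refine IsBigO.congr' ?_ h1.symm EventuallyEq.rfl
  have happ : ∀ {A : V → V →L[ℝ] ℝ} {j : ℕ} (v : V), A =O[𝓝 0] (fun x => ‖x‖ ^ j) →
      (fun x => A x v) =O[𝓝 0] fun x => ‖x‖ ^ j := by
    intro A j v hA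
    refine IsBigO.trans (IsBigO.of_bound ‖v‖ (Eventually.of_forall fun x => ?_)) hA
    rw [mul_comm]; exact (A x).le_opNorm v
  refine IsBigO.fun_sum fun i _ => happ _ (isBigO_fderiv_of_analyticAt
    (analyticAt_clm_apply_const hG.fderiv _) n (happ _ (isBigO_fderiv_of_analyticAt hG (n + 1) h)))

/-- Iterated Laplacians at the origin only see the Taylor polynomial. -/
theorem laplacian_iterate_of_isBigO (k : ℕ) {f G : V → ℝ} (p : MvPolynomial ι ℝ)
    (hG : AnalyticAt ℝ G 0) (h : G =O[𝓝 0] fun x => ‖x‖ ^ (2 * k + 1))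
    (hf : f =ᶠ[𝓝 0] polyFun b p + G) :
    ((fun f : V → ℝ => Laplacian.laplacian f)^[k] f) 0 = polyFun b (polyLap^[k] p) 0 := by
  induction k generalizing f G p with
  | zero =>
    have : G 0 = 0 := by
      have := IsBigO.eq_zero_of_norm_pow (f := G) (x₀ := (0 : V)) (n := 1) (by simpa using h) (by simp)
      exact this
    simp only [Function.iterate_zero, id]
    rw [hf.self_of_nhds]
    simp [this]
  | succ k ih =>
    rw [Function.iterate_succ_apply, Function.iterate_succ_apply]
    refine ih (polyLap p) (analyticAt_laplacian hG) (isBigO_laplacian hG (by convert! h using 1)) ?_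
    have h2 : Laplacian.laplacian f =ᶠ[𝓝 0] Laplacian.laplacian (polyFun b p + G) := by
      filter_upwards [hf.eventuallyEq_nhds] with x hx
      exact (InnerProductSpace.laplacian_congr_nhds hx).self_of_nhds
    refine h2.trans ?_
    filter_upwards [hG.eventually_analyticAt] with x hx
    rw [(analyticAt_polyFun b p x).contDiffAt.laplacian_add hx.contDiffAt, laplacian_polyFun]
    rfl

end Laplace

/-! ### The generating function as a Gaussian integral -/

section GenFun

set_option linter.unusedSectionVars false

variable {V : Type*} [NormedAddCommGroup V] [InnerProductSpace ℝ V] [FiniteDimensional ℝ V]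
  {ι : Type*} [Fintype ι] (b : OrthonormalBasis ι ℝ V)

/-- The vector with given coordinates in an orthonormal basis. -/
def vec (x : ι → ℝ) : V := ∑ i, x i • b i

theorem vec_repr (X : V) : vec b (b.repr X).ofLp = X := b.sum_repr X

theorem continuous_vec : Continuous (vec b) := by
  unfold vec; fun_prop

theorem inner_vec (i : ι) (x : ι → ℝ) : inner ℝ (b i) (vec b x) = x i := by
  classical
  simp [vec, inner_sum, inner_smul_right, b.inner_eq_ite]

/-- Gaussian integrals over `V` do not depend on the orthonormal basis. -/
theorem integral_vec_eq {κ : Type*} [Fintype κ] (b' : OrthonormalBasis κ ℝ V) {f : V → ℝ}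
    (hf : Continuous f) :
    ∫ y, f (vec b y) ∂stdGauss ι = ∫ y, f (vec b' y) ∂stdGauss κ := by
  let _ : MeasurableSpace V := borel V
  have : BorelSpace V := ⟨rfl⟩
  have h1 := stdGaussian_eq_map_pi_orthonormalBasis b
  have h2 := stdGaussian_eq_map_pi_orthonormalBasis b'
  have h3 : ∫ v, f v ∂stdGaussian V = ∫ y, f (vec b y) ∂stdGauss ι := by
    rw [h1]; exact integral_map (continuous_vec b).aemeasurable hf.aestronglyMeasurable
  have h4 : ∫ v, f v ∂stdGaussian V = ∫ y, f (vec b' y) ∂stdGauss κ := by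
    rw [h2]; exact integral_map (continuous_vec b').aemeasurable hf.aestronglyMeasurable
  rw [← h3, h4]

variable {R : V →ₗ[ℝ] V →ₗ[ℝ] V →ₗ[ℝ] V}

theorem jacobiOp_apply (R : V →ₗ[ℝ] V →ₗ[ℝ] V →ₗ[ℝ] V) (X Y : V) : jacobiOp R X Y = R Y X X := rfl

theorem Kr_pair_symm (hR : R ∈ Kr V) (A B C D : V) :
    inner ℝ (R A B C) D = inner ℝ (R C D A) B := by
  obtain ⟨h1, h2, h3⟩ := hR
  have H1 : ∀ A B C D : V, inner ℝ (R A B C) D = -inner ℝ (R B A C) D := fun A B C D => by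
    rw [h1, inner_neg_left]
  have H2 : ∀ A B C D : V, inner ℝ (R A B C) D = -inner ℝ (R A B D) C := fun A B C D => by
    rw [h2, real_inner_comm]
  have H3 : ∀ A B C D : V,
      inner ℝ (R A B C) D + inner ℝ (R B C A) D + inner ℝ (R C A B) D = 0 := fun A B C D => by
    rw [← inner_add_left, ← inner_add_left, h3, inner_zero_left]
  linarith [H3 A B C D, H3 B C D A, H3 C D A B, H3 D A B C, H1 A B C D, H1 B C A D, H1 C A B D,
    H1 D A B C, H1 A B D C, H1 B C D A, H1 C D B A, H1 D B C A, H1 C D A B, H1 D A C B, H1 A C D B,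
    H1 D A B C, H1 A B D C, H1 B D A C,
    H2 A B C D, H2 B C A D, H2 C A B D, H2 B C D A, H2 C D B A, H2 D B C A, H2 C D A B, H2 D A C B,
    H2 A C D B, H2 D A B C, H2 A B D C, H2 B D A C]

theorem isSymmetric_jacobiOp (hR : R ∈ Kr V) (X : V) : (jacobiOp R X).IsSymmetric := by
  intro Y Z
  rw [jacobiOp_apply, jacobiOp_apply, Kr_pair_symm hR, hR.1, inner_neg_left, hR.2.1, neg_neg]

/-- The biquadratic form `(X, Y) ↦ g(R_{Y,X} X, Y)`. -/
def biquad (R : V →ₗ[ℝ] V →ₗ[ℝ] V →ₗ[ℝ] V) (X Y : V) : ℝ := inner ℝ (R Y X X) Y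

/-- The coefficients of a trilinear map in an orthonormal basis. -/
def coeffs (R : V →ₗ[ℝ] V →ₗ[ℝ] V →ₗ[ℝ] V) (t : ι × ι × ι × ι) : ℝ :=
  inner ℝ (R (b t.1) (b t.2.1) (b t.2.2.1)) (b t.2.2.2)

theorem map_vec {W : Type*} [AddCommGroup W] [Module ℝ W] (f : V →ₗ[ℝ] W) (x : ι → ℝ) :
    f (vec b x) = ∑ i, x i • f (b i) := by
  simp [vec]

theorem map_vec₃ (R : V →ₗ[ℝ] V →ₗ[ℝ] V →ₗ[ℝ] V) (x y z : ι → ℝ) :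
    R (vec b x) (vec b y) (vec b z) =
      ∑ i, ∑ j, ∑ k, (x i * y j * z k) • R (b i) (b j) (b k) := by
  rw [map_vec b R x, LinearMap.sum_apply, LinearMap.sum_apply]
  refine Finset.sum_congr rfl fun i _ => ?_
  rw [LinearMap.smul_apply, LinearMap.smul_apply, map_vec b (R (b i)) y, LinearMap.sum_apply,
    Finset.smul_sum]
  refine Finset.sum_congr rfl fun j _ => ?_
  rw [LinearMap.smul_apply, map_vec b (R (b i) (b j)) z, Finset.smul_sum, Finset.smul_sum]
  exact Finset.sum_congr rfl fun k _ => by rw [smul_smul, smul_smul, mul_assoc]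

theorem biquad_vec (R : V →ₗ[ℝ] V →ₗ[ℝ] V →ₗ[ℝ] V) (x y : ι → ℝ) :
    biquad R (vec b x) (vec b y) =
      ∑ t : ι × ι × ι × ι, coeffs b R t * (x t.2.1 * x t.2.2.1) * (y t.1 * y t.2.2.2) := by
  rw [biquad, map_vec₃]
  simp only [sum_inner, inner_smul_left, Fintype.sum_prod_type, coeffs, conj_trivial]
  have h : ∀ u : V, inner ℝ u (vec b y) = ∑ l, y l * inner ℝ u (b l) := fun u => by
    simp [vec, inner_sum, inner_smul_right]
  simp only [h, Finset.mul_sum]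
  refine Finset.sum_congr rfl fun i _ => Finset.sum_congr rfl fun j _ =>
    Finset.sum_congr rfl fun k _ => Finset.sum_congr rfl fun l _ => by ring

theorem continuous_biquad_right (R : V →ₗ[ℝ] V →ₗ[ℝ] V →ₗ[ℝ] V) (X : V) :
    Continuous (biquad R X) := by
  have : biquad R X = fun Y => inner ℝ (jacobiOp R X Y) Y := rfl
  rw [this]
  exact (LinearMap.continuous_of_finiteDimensional _).inner continuous_id

theorem abs_biquad_le (R : V →ₗ[ℝ] V →ₗ[ℝ] V →ₗ[ℝ] V) :
    ∃ C, 0 ≤ C ∧ ∀ X Y : V, |biquad R X Y| ≤ C * ‖X‖ ^ 2 * ‖Y‖ ^ 2 := by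
  let b := stdOrthonormalBasis ℝ V
  refine ⟨∑ t, |coeffs b R t|, Finset.sum_nonneg fun _ _ => abs_nonneg _, fun X Y => ?_⟩
  have hx : ∀ (X : V) i, |(b.repr X).ofLp i| ≤ ‖X‖ := fun X i => by
    rw [OrthonormalBasis.repr_apply_apply]
    have := abs_real_inner_le_norm (b i) X
    rwa [b.norm_eq_one, one_mul] at this
  have h := biquad_vec b R (b.repr X).ofLp (b.repr Y).ofLp
  rw [vec_repr, vec_repr] at h
  rw [h, Finset.sum_mul, Finset.sum_mul]
  refine (Finset.abs_sum_le_sum_abs _ _).trans (Finset.sum_le_sum fun t _ => ?_)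
  rw [abs_mul, abs_mul, abs_mul, abs_mul, sq, sq]
  gcongr <;> exact hx _ _

theorem integral_exp_gaussianReal {l : ℝ} (hl : l < 1) :
    ∫ y, Real.exp (1 / 2 * (l * y ^ 2)) ∂gaussianReal 0 1 = Real.exp (-(1 / 2) * Real.log (1 - l)) := by
  have hpos : 0 < 1 - l := by linarith
  rw [integral_gaussianReal_std]
  have : ∀ x : ℝ, Real.exp (1 / 2 * (l * x ^ 2)) * Real.exp (-(1 / 2) * x ^ 2) =
      Real.exp (-((1 - l) / 2) * x ^ 2) := fun x => by rw [← Real.exp_add]; congr 1; ring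
  simp_rw [this]
  rw [integral_gaussian]
  have h1 : Real.pi / ((1 - l) / 2) = (2 * Real.pi) / (1 - l) := by field_simp
  rw [h1, Real.sqrt_div (by positivity), mul_div_assoc', inv_mul_cancel₀ (by positivity),
    neg_mul, Real.exp_neg, Real.sqrt_eq_rpow, Real.rpow_def_of_pos hpos, one_div, mul_comm]

theorem trace_pow_eq_sum (J : V →ₗ[ℝ] V) (l : ι → ℝ) (h : ∀ i, J (b i) = l i • b i) (n : ℕ) :
    LinearMap.trace ℝ V (J ^ n) = ∑ i, l i ^ n := by
  rw [LinearMap.trace_eq_sum_inner _ b]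
  refine Finset.sum_congr rfl fun i _ => ?_
  have : (J ^ n) (b i) = l i ^ n • b i := by
    induction n with
    | zero => simp
    | succ n ih => rw [pow_succ, Module.End.mul_apply, h, map_smul, ih, smul_smul, pow_succ, mul_comm]
  rw [this, inner_smul_right, real_inner_self_eq_norm_sq, b.norm_eq_one]; simp

theorem genFun_eq_of_eigen (X : V) (l : ι → ℝ) (h : ∀ i, jacobiOp R X (b i) = l i • b i)
    (hl : ∀ i, |l i| < 1) :
    genFun R X = ∏ i, Real.exp (-(1 / 2) * Real.log (1 - l i)) := by
  rw [genFun, ← Real.exp_sum]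
  congr 1
  have h1 : ∀ i, HasSum (fun r : ℕ => 1 / 2 * (l i ^ (r + 1) / (r + 1)))
      (1 / 2 * -Real.log (1 - l i)) := fun i =>
    (Real.hasSum_pow_div_log_of_abs_lt_one (hl i)).mul_left _
  have h2 := hasSum_sum (s := Finset.univ) fun i _ => h1 i
  have h3 : (fun r : ℕ => 1 / (2 * ((r : ℝ) + 1)) * LinearMap.trace ℝ V (jacobiOp R X ^ (r + 1))) =
      fun r : ℕ => ∑ i, 1 / 2 * (l i ^ (r + 1) / (r + 1)) := by
    funext r
    rw [trace_pow_eq_sum b _ l h, Finset.mul_sum]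
    refine Finset.sum_congr rfl fun i _ => ?_
    field_simp
  rw [h3, h2.tsum_eq]
  refine Finset.sum_congr rfl fun i _ => by ring

theorem biquad_vec_of_eigen (X : V) (l : ι → ℝ) (h : ∀ i, jacobiOp R X (b i) = l i • b i)
    (y : ι → ℝ) : biquad R X (vec b y) = ∑ i, l i * y i ^ 2 := by
  have : biquad R X (vec b y) = inner ℝ (jacobiOp R X (vec b y)) (vec b y) := rfl
  rw [this]
  nth_rewrite 1 [vec]
  simp only [map_sum, map_smul, h, sum_inner, inner_smul_left, inner_vec]
  refine Finset.sum_congr rfl fun i _ => ?_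
  simp; ring

/-- For `X` near the origin, `genFun R X` is the Gaussian integral of `exp (½ g(R_{Y,X} X, Y))`, and
also `det (1 - R_{·,X} X)^(-1/2)`: the Jacobi operator is symmetric, and in an orthonormal basis of
eigenvectors both reduce to products over the eigenvalues, all of which lie in `(-1, 1)`. -/
theorem genFun_eq_gaussian (hR : R ∈ Kr V) (b : OrthonormalBasis ι ℝ V) {X : V} {C : ℝ}
    (hC : ∀ Y : V, |biquad R X Y| ≤ C * ‖Y‖ ^ 2) (hC1 : C < 1) :
    genFun R X = ∫ y, Real.exp (1 / 2 * biquad R X (vec b y)) ∂stdGauss ι ∧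
    genFun R X = Real.exp (-(1 / 2) * Real.log (LinearMap.det (LinearMap.id - jacobiOp R X))) ∧
    0 < LinearMap.det (LinearMap.id - jacobiOp R X) := by
  classical
  have hs := isSymmetric_jacobiOp hR X
  let b' := hs.eigenvectorBasis rfl
  let l := hs.eigenvalues rfl
  have h : ∀ i, jacobiOp R X (b' i) = l i • b' i := fun i => hs.apply_eigenvectorBasis rfl i
  have hl : ∀ i, |l i| < 1 := fun i => by
    have := hC (b' i)
    have e : biquad R X (b' i) = l i := by
      have : biquad R X (b' i) = inner ℝ (jacobiOp R X (b' i)) (b' i) := rfl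
      rw [this, h, inner_smul_left, real_inner_self_eq_norm_sq, b'.norm_eq_one]; simp
    rw [e, b'.norm_eq_one] at this
    linarith
  have hpos : ∀ i, 0 < 1 - l i := fun i => by linarith [(abs_lt.1 (hl i)).2]
  have hg := genFun_eq_of_eigen b' X l h hl
  have hdet : LinearMap.det (LinearMap.id - jacobiOp R X) = ∏ i, (1 - l i) := by
    rw [← LinearMap.det_toMatrix b'.toBasis]
    have : LinearMap.toMatrix b'.toBasis b'.toBasis (LinearMap.id - jacobiOp R X) =
        Matrix.diagonal fun i => 1 - l i := by
      ext i j
      rw [LinearMap.toMatrix_apply]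
      simp only [OrthonormalBasis.coe_toBasis, LinearMap.sub_apply, LinearMap.id_apply, h]
      have : b' j - l j • b' j = (1 - l j) • b' j := by module
      rw [this]
      simp only [map_smul, Finsupp.smul_apply, OrthonormalBasis.coe_toBasis_repr_apply,
        OrthonormalBasis.repr_self, smul_eq_mul, Matrix.diagonal_apply]
      rcases eq_or_ne i j with rfl | hij
      · simp
      · simp [hij]
    rw [this, Matrix.det_diagonal]
  refine ⟨?_, ?_, ?_⟩
  · rw [integral_vec_eq b b' (f := fun Y => Real.exp (1 / 2 * biquad R X Y))
      (Real.continuous_exp.comp (continuous_const.mul (continuous_biquad_right R X))), hg]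
    simp_rw [biquad_vec_of_eigen b' X l h, Finset.mul_sum, Real.exp_sum]
    rw [integral_fintype_prod_eq_prod (fun i (t : ℝ) => Real.exp (1 / 2 * (l i * t ^ 2)))]
    refine Finset.prod_congr rfl fun i _ => ?_
    rw [integral_exp_gaussianReal (by linarith [hpos i])]
  · rw [hg, hdet, Real.log_prod (fun i _ => (hpos i).ne'), Finset.mul_sum, Real.exp_sum]
  · rw [hdet]; exact Finset.prod_pos fun i _ => hpos i

/-- `genFun R` agrees near the origin with `det (1 - R_{·,X} X)^(-1/2)`, whose determinant is a
polynomial in `X` with value `1` at the origin. -/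
theorem analyticAt_genFun (hR : R ∈ Kr V) : AnalyticAt ℝ (genFun R) 0 := by
  classical
  obtain ⟨C, hC0, hC⟩ := abs_biquad_le R
  let b := stdOrthonormalBasis ℝ V
  have hev : ∀ᶠ X in 𝓝 (0 : V), C * ‖X‖ ^ 2 < 1 := by
    have : Continuous fun X : V => C * ‖X‖ ^ 2 := by fun_prop
    exact this.continuousAt.eventually_lt continuousAt_const (by simp)
  have h1 : genFun R =ᶠ[𝓝 0] fun X =>
      Real.exp (-(1 / 2) * Real.log (LinearMap.det (LinearMap.id - jacobiOp R X))) := by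
    filter_upwards [hev] with X hX
    exact (genFun_eq_gaussian hR b (fun Y => hC X Y) hX).2.1
  refine AnalyticAt.congr ?_ h1.symm
  have hdet : AnalyticAt ℝ (fun X => LinearMap.det (LinearMap.id - jacobiOp R X)) 0 := by
    have hc : ∀ i, AnalyticAt ℝ (fun X => (b.repr X).ofLp i) 0 := fun i => by
      have := analyticAt_polyFun b (MvPolynomial.X i) 0
      convert! this using 2 with X
      simp [polyFun]
    have : ∀ X, LinearMap.det (LinearMap.id - jacobiOp R X) =
        ∑ σ : Equiv.Perm (Fin (Module.finrank ℝ V)), (Equiv.Perm.sign σ : ℝ) *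
          ∏ i, ((if σ i = i then 1 else 0) - ∑ j, ∑ k, (b.repr X).ofLp j * (b.repr X).ofLp k *
            (b.repr (R (b i) (b j) (b k))).ofLp (σ i)) := by
      intro X
      rw [← LinearMap.det_toMatrix b.toBasis, Matrix.det_apply']
      refine Finset.sum_congr rfl fun σ _ => ?_
      congr 1
      refine Finset.prod_congr rfl fun i _ => ?_
      rw [LinearMap.toMatrix_apply]
      simp only [OrthonormalBasis.coe_toBasis, LinearMap.sub_apply, LinearMap.id_apply, map_sub,
        OrthonormalBasis.coe_toBasis_repr_apply, Finsupp.sub_apply, OrthonormalBasis.repr_self]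
      congr 1
      · simp [PiLp.single_apply]
      · rw [jacobiOp_apply]
        have e := vec_repr b X
        have e' : vec b (Pi.single i 1) = b i := by simp [vec, Pi.single_apply]
        rw [← e', ← e, map_vec₃]
        simp only [map_sum, map_smul, WithLp.ofLp_sum, WithLp.ofLp_smul, Finset.sum_apply,
          Pi.smul_apply, smul_eq_mul, e]
        rw [Finset.sum_eq_single i (fun a _ ha => by simp [ha]) (by simp)]
        simp [e']
    simp_rw [this]
    refine Finset.analyticAt_fun_sum _ fun σ _ => analyticAt_const.mul ?_
    refine Finset.analyticAt_fun_prod _ fun i _ => analyticAt_const.sub ?_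
    refine Finset.analyticAt_fun_sum _ fun j _ => Finset.analyticAt_fun_sum _ fun k _ => ?_
    exact ((hc j).mul (hc k)).mul analyticAt_const
  have h0 : jacobiOp R 0 = 0 := by ext Y; simp [jacobiOp_apply]
  refine AnalyticAt.rexp (analyticAt_const.mul ((analyticAt_log ?_).comp hdet))
  rw [h0]; simp

end GenFun

/-! ### `Ψ` as a quotient of Gaussian moments -/

section Pairs

set_option linter.unusedSectionVars false

variable {ι : Type*} [Fintype ι]

/-- Pairs of vectors in `ι → ℝ` as matrices with two columns. -/
def pairEquiv (ι : Type*) : (ι → ℝ) × (ι → ℝ) ≃ᵐ (ι × Fin 2 → ℝ) where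
  toFun p q := ![p.1, p.2] q.2 q.1
  invFun Z := (fun i => Z (i, 0), fun i => Z (i, 1))
  left_inv p := by ext <;> simp
  right_inv Z := by
    funext ⟨i, a⟩
    fin_cases a <;> simp
  measurable_toFun := by
    refine measurable_pi_iff.2 fun ⟨i, a⟩ => ?_
    fin_cases a
    · exact (measurable_pi_apply i).comp measurable_fst
    · exact (measurable_pi_apply i).comp measurable_snd
  measurable_invFun := by
    simp only [Equiv.symm_mk, Equiv.coe_fn_mk]; fun_prop

theorem measurePreserving_pairEquiv (ν : Measure ℝ) [SigmaFinite ν] :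
    MeasurePreserving (pairEquiv ι) ((Measure.pi fun _ => ν).prod (Measure.pi fun _ => ν))
      (Measure.pi fun _ => ν) where
  measurable := (pairEquiv ι).measurable
  map_eq := by
    refine (Measure.pi_eq fun s _ => ?_).symm
    have : pairEquiv ι ⁻¹' Set.pi Set.univ s =
        (Set.pi Set.univ fun i => s (i, 0)) ×ˢ (Set.pi Set.univ fun i => s (i, 1)) := by
      ext p
      simp only [Set.mem_preimage, Set.mem_pi, Set.mem_univ, true_implies, Prod.forall,
        Set.mem_prod, pairEquiv, MeasurableEquiv.coe_mk, Equiv.coe_fn_mk, Fin.forall_fin_two]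
      simp [forall_and]
    rw [MeasurableEquiv.map_apply, this, Measure.prod_prod, Measure.pi_pi, Measure.pi_pi,
      Fintype.prod_prod_type, ← Finset.prod_mul_distrib]
    simp

/-- The columns of a matrix with two columns. -/
def col (Z : ι × Fin 2 → ℝ) (a : Fin 2) : ι → ℝ := fun i => Z (i, a)

@[simp] theorem col_pairEquiv_zero (p : (ι → ℝ) × (ι → ℝ)) : col (pairEquiv ι p) 0 = p.1 := rfl

@[simp] theorem col_pairEquiv_one (p : (ι → ℝ) × (ι → ℝ)) : col (pairEquiv ι p) 1 = p.2 := rfl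

/-- The Gram determinant of the two columns. -/
def gramDet (Z : ι × Fin 2 → ℝ) : ℝ :=
  (∑ i, Z (i, 0) ^ 2) * (∑ i, Z (i, 1) ^ 2) - (∑ i, Z (i, 0) * Z (i, 1)) ^ 2

theorem gramDet_nonneg (Z : ι × Fin 2 → ℝ) : 0 ≤ gramDet Z := by
  rw [gramDet, sub_nonneg]
  exact Finset.sum_mul_sq_le_sq_mul_sq _ _ _

end Pairs

section Moments

set_option linter.unusedSectionVars false

variable {V : Type*} [NormedAddCommGroup V] [InnerProductSpace ℝ V] [FiniteDimensional ℝ V]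
  {ι : Type*} [Fintype ι] (b : OrthonormalBasis ι ℝ V)

/-- The contribution of the second Gaussian vector to the coefficients of the moment
polynomial. -/
def momY {j : ℕ} (s : Fin j → ι × ι × ι × ι) : MvPolynomial ι ℝ :=
  ∏ l, (MvPolynomial.X (s l).1 * MvPolynomial.X (s l).2.2.2)

/-- The contribution of the first vector to the moment polynomial. -/
def momX {j : ℕ} (s : Fin j → ι × ι × ι × ι) : MvPolynomial ι ℝ :=
  ∏ l, (MvPolynomial.X (s l).2.1 * MvPolynomial.X (s l).2.2.1)

theorem biquad_vec_pow (R : V →ₗ[ℝ] V →ₗ[ℝ] V →ₗ[ℝ] V) (x y : ι → ℝ) (j : ℕ) :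
    biquad R (vec b x) (vec b y) ^ j = ∑ s : Fin j → ι × ι × ι × ι,
      (∏ l, coeffs b R (s l)) *
        (MvPolynomial.eval x (momX s) * MvPolynomial.eval y (momY s)) := by
  rw [biquad_vec, Finset.sum_pow']
  simp only [Fintype.piFinset_univ, momX, momY, map_prod, map_mul, MvPolynomial.eval_X]
  refine Finset.sum_congr rfl fun s _ => ?_
  rw [Finset.prod_mul_distrib, Finset.prod_mul_distrib, mul_assoc]

/-- The polynomial `X ↦ E_Y[g(R_{Y,X} X, Y)^j]`. -/
def momentPoly (R : V →ₗ[ℝ] V →ₗ[ℝ] V →ₗ[ℝ] V) (j : ℕ) : MvPolynomial ι ℝ :=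
  ∑ s : Fin j → ι × ι × ι × ι, ((∏ l, coeffs b R (s l)) * gaussE (momY s)) • momX s

theorem isHomogeneous_momX {j : ℕ} (s : Fin j → ι × ι × ι × ι) :
    (momX s).IsHomogeneous (2 * j) := by
  have := MvPolynomial.IsHomogeneous.prod Finset.univ
    (fun l => (MvPolynomial.X (s l).2.1 * MvPolynomial.X (s l).2.2.1 : MvPolynomial ι ℝ))
    (fun _ => 2) fun l _ => (MvPolynomial.isHomogeneous_X ℝ _).mul (MvPolynomial.isHomogeneous_X ℝ _)
  rw [Finset.sum_const, Finset.card_univ, Fintype.card_fin, smul_eq_mul, mul_comm] at this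
  exact this

theorem isHomogeneous_momentPoly (R : V →ₗ[ℝ] V →ₗ[ℝ] V →ₗ[ℝ] V) (j : ℕ) :
    (momentPoly b R j).IsHomogeneous (2 * j) := by
  refine MvPolynomial.IsHomogeneous.sum _ _ _ fun s _ => ?_
  rw [MvPolynomial.smul_eq_C_mul]
  have := (MvPolynomial.isHomogeneous_C ι ((∏ l, coeffs b R (s l)) * gaussE (momY s))).mul
    (isHomogeneous_momX s)
  rwa [zero_add] at this

theorem eval_momentPoly (R : V →ₗ[ℝ] V →ₗ[ℝ] V →ₗ[ℝ] V) (j : ℕ) (x : ι → ℝ) :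
    MvPolynomial.eval x (momentPoly b R j) =
      ∫ y, biquad R (vec b x) (vec b y) ^ j ∂stdGauss ι := by
  simp_rw [biquad_vec_pow]
  rw [integral_finsetSum _ fun s _ => ((integrable_eval (momY s)).const_mul _).const_mul _]
  simp only [momentPoly, map_sum, MvPolynomial.smul_eval]
  refine Finset.sum_congr rfl fun s _ => ?_
  rw [integral_const_mul, integral_const_mul, gaussE]; ring

theorem gaussE_momentPoly (R : V →ₗ[ℝ] V →ₗ[ℝ] V →ₗ[ℝ] V) (j : ℕ) :
    gaussE (momentPoly b R j) = ∑ s : Fin j → ι × ι × ι × ι,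
      (gaussE (momY s) * gaussE (momX s)) * ∏ l, coeffs b R (s l) := by
  rw [momentPoly, gaussE_sum]
  exact Finset.sum_congr rfl fun s _ => by rw [gaussE_smul]; ring

theorem integrable_biquad_pow_prod (R : V →ₗ[ℝ] V →ₗ[ℝ] V →ₗ[ℝ] V) (j : ℕ) :
    Integrable (fun p : (ι → ℝ) × (ι → ℝ) => biquad R (vec b p.1) (vec b p.2) ^ j)
      ((stdGauss ι).prod (stdGauss ι)) := by
  simp_rw [biquad_vec_pow]
  exact integrable_finsetSum _ fun s _ =>
    ((integrable_eval (momX s)).mul_prod (integrable_eval (momY s))).const_mul _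

theorem integrable_biquad_pow (R : V →ₗ[ℝ] V →ₗ[ℝ] V →ₗ[ℝ] V) (j : ℕ) :
    Integrable (fun Z => biquad R (vec b (col Z 0)) (vec b (col Z 1)) ^ j)
      (stdGauss (ι × Fin 2)) := by
  rw [← (measurePreserving_pairEquiv (gaussianReal 0 1)).integrable_comp_emb
    (pairEquiv ι).measurableEmbedding]
  exact integrable_biquad_pow_prod b R j

theorem gaussE_momentPoly_eq_integral (R : V →ₗ[ℝ] V →ₗ[ℝ] V →ₗ[ℝ] V) (j : ℕ) :
    gaussE (momentPoly b R j) =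
      ∫ Z, biquad R (vec b (col Z 0)) (vec b (col Z 1)) ^ j ∂stdGauss (ι × Fin 2) := by
  rw [← (measurePreserving_pairEquiv (gaussianReal 0 1)).integral_comp
    (pairEquiv ι).measurableEmbedding]
  simp only [col_pairEquiv_zero, col_pairEquiv_one]
  rw [integral_prod _ (integrable_biquad_pow_prod b R j), gaussE]
  simp_rw [eval_momentPoly]

theorem abs_exp_sub_sum_le (u : ℝ) (n : ℕ) :
    |Real.exp u - ∑ j ∈ Finset.range n, u ^ j / j.factorial| ≤ |u| ^ n * Real.exp |u| := by
  have := Complex.norm_exp_sub_sum_le_norm_mul_exp (u : ℂ) n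
  rw [Complex.norm_real, Real.norm_eq_abs] at this
  rw [← Real.norm_eq_abs (_ - _), ← Complex.norm_real]
  push_cast
  exact this

theorem integrable_exp_sum_sq : Integrable
    (fun y : ι → ℝ => Real.exp (3 / 8 * ∑ i, y i ^ 2)) (stdGauss ι) := by
  simp_rw [Finset.mul_sum, Real.exp_sum]
  refine Integrable.fintype_prod (f := fun _ (t : ℝ) => Real.exp (3 / 8 * t ^ 2)) fun i => ?_
  rw [integrable_gaussianReal_iff]
  have := integrable_exp_neg_mul_sq (b := 1 / 8) (by norm_num)
  convert! this using 2 with x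
  rw [← Real.exp_add]; congr 1; ring

theorem norm_vec_sq (y : ι → ℝ) : ‖vec b y‖ ^ 2 = ∑ i, y i ^ 2 := by
  rw [← b.sum_sq_inner_right]
  simp [inner_vec]

/-- The generating function and its Taylor polynomial, given by the Gaussian moments of the
biquadratic form, agree to high order. -/
theorem isBigO_genFun_sub {R : V →ₗ[ℝ] V →ₗ[ℝ] V →ₗ[ℝ] V} (hR : R ∈ Kr V) (k : ℕ) :
    (fun X => genFun R X - polyFun b (∑ j ∈ Finset.range (k + 1),
      (1 / (2 ^ j * j.factorial) : ℝ) • momentPoly b R j) X) =O[𝓝 0]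
      fun X => ‖X‖ ^ (2 * k + 1) := by
  -- With `S = |y|²` and `C ‖X‖² < 1/2`, the exponent `u` satisfies `|u| ≤ S / 4`.  Together with
  -- `S^(k+1) ≤ (k+1)! 8^(k+1) exp (S / 8)` this bounds the remainder of the exponential series by a
  -- multiple of `exp (3 S / 8)`, which is integrable since `3 / 8 < 1 / 2`.
  obtain ⟨C, hC0, hC⟩ := abs_biquad_le R
  have hev : ∀ᶠ X in 𝓝 (0 : V), C * ‖X‖ ^ 2 < 1 / 2 := by
    have : Continuous fun X : V => C * ‖X‖ ^ 2 := by fun_prop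
    exact this.continuousAt.eventually_lt continuousAt_const (by simp)
  set A : ℝ := (C / 2) ^ (k + 1) * ((k + 1).factorial * 8 ^ (k + 1)) *
    ∫ y : ι → ℝ, Real.exp (3 / 8 * ∑ i, y i ^ 2) ∂stdGauss ι with hA
  have hA0 : 0 ≤ A := by
    have : 0 ≤ ∫ y : ι → ℝ, Real.exp (3 / 8 * ∑ i, y i ^ 2) ∂stdGauss ι :=
      integral_nonneg fun y => (Real.exp_pos _).le
    positivity
  refine IsBigO.of_bound A ?_
  filter_upwards [hev, Metric.ball_mem_nhds (0 : V) one_pos] with X hX hX1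
  rw [mem_ball_zero_iff] at hX1
  have hgen := (genFun_eq_gaussian hR b (fun Y => hC X Y) (hX.trans (by norm_num))).1
  set u : (ι → ℝ) → ℝ := fun y => 1 / 2 * biquad R X (vec b y) with hu
  have hucont : Continuous u :=
    continuous_const.mul ((continuous_biquad_right R X).comp (continuous_vec b))
  have hule : ∀ y, |u y| ≤ C / 2 * ‖X‖ ^ 2 * ∑ i, y i ^ 2 := fun y => by
    have := hC X (vec b y)
    rw [norm_vec_sq] at this
    rw [hu, abs_mul, abs_of_pos (by norm_num : (0 : ℝ) < 1 / 2)]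
    linarith
  have hpoly : polyFun b (∑ j ∈ Finset.range (k + 1),
      (1 / (2 ^ j * j.factorial) : ℝ) • momentPoly b R j) X =
      ∫ y, ∑ j ∈ Finset.range (k + 1), u y ^ j / j.factorial ∂stdGauss ι := by
    have hint : ∀ j, Integrable (fun y => biquad R X (vec b y) ^ j) (stdGauss ι) := fun j => by
      have : (fun y => biquad R X (vec b y) ^ j) = fun y => ∑ s : Fin j → ι × ι × ι × ι,
        (∏ l, coeffs b R (s l)) * (MvPolynomial.eval (b.repr X).ofLp (momX s) *
          MvPolynomial.eval y (momY s)) := by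
        funext y
        rw [← biquad_vec_pow, vec_repr]
      rw [this]
      exact integrable_finsetSum _ fun s _ => ((integrable_eval (momY s)).const_mul _).const_mul _
    have heq : ∀ j y, u y ^ j / j.factorial =
        (1 / (2 ^ j * j.factorial) : ℝ) * biquad R X (vec b y) ^ j := fun j y => by
      rw [hu, mul_pow, div_pow, one_pow]; field_simp
    simp_rw [heq]
    rw [integral_finsetSum _ fun j _ => (hint j).const_mul _]
    simp only [polyFun, map_sum, MvPolynomial.smul_eval]
    refine Finset.sum_congr rfl fun j _ => ?_
    rw [integral_const_mul, eval_momentPoly, vec_repr]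
  have hexp_le : ∀ y, |u y| ≤ 1 / 4 * ∑ i, y i ^ 2 := fun y =>
    (hule y).trans (mul_le_mul_of_nonneg_right (by linarith)
      (Finset.sum_nonneg fun i _ => sq_nonneg _))
  have hbound : ∀ y, |u y| ^ (k + 1) * Real.exp |u y| ≤
      (C / 2) ^ (k + 1) * ((k + 1).factorial * 8 ^ (k + 1)) * ‖X‖ ^ (2 * k + 2) *
        Real.exp (3 / 8 * ∑ i, y i ^ 2) := fun y => by
    set S := ∑ i, y i ^ 2 with hS
    have hS0 : 0 ≤ S := Finset.sum_nonneg fun i _ => sq_nonneg _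
    have h1 : |u y| ^ (k + 1) ≤ (C / 2) ^ (k + 1) * ‖X‖ ^ (2 * k + 2) * S ^ (k + 1) := by
      calc |u y| ^ (k + 1) ≤ (C / 2 * ‖X‖ ^ 2 * S) ^ (k + 1) :=
            pow_le_pow_left₀ (abs_nonneg _) (hule y) _
        _ = _ := by rw [mul_pow, mul_pow, ← pow_mul]; ring_nf
    have h2 : S ^ (k + 1) ≤ (k + 1).factorial * 8 ^ (k + 1) * Real.exp (S / 8) := by
      have := Real.pow_div_factorial_le_exp (x := S / 8) (by positivity) (k + 1)
      rw [div_le_iff₀ (by positivity), div_pow, div_le_iff₀ (by positivity)] at this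
      linarith
    have h3 : Real.exp |u y| ≤ Real.exp (1 / 4 * S) := Real.exp_le_exp.2 (hexp_le y)
    have h4 : Real.exp (3 / 8 * S) = Real.exp (S / 8) * Real.exp (1 / 4 * S) := by
      rw [← Real.exp_add]; congr 1; ring
    rw [h4]
    calc |u y| ^ (k + 1) * Real.exp |u y|
        ≤ ((C / 2) ^ (k + 1) * ‖X‖ ^ (2 * k + 2) *
          ((k + 1).factorial * 8 ^ (k + 1) * Real.exp (S / 8))) * Real.exp (1 / 4 * S) := by
          refine mul_le_mul (h1.trans ?_) h3 (Real.exp_pos _).le (by positivity)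
          exact mul_le_mul_of_nonneg_left h2 (by positivity)
      _ = _ := by ring
  have hint1 : Integrable (fun y => Real.exp (u y)) (stdGauss ι) := by
    refine (integrable_exp_sum_sq (ι := ι)).mono' (Real.continuous_exp.comp hucont).aestronglyMeasurable
      (ae_of_all _ fun y => ?_)
    rw [Real.norm_eq_abs, Real.abs_exp]
    refine Real.exp_le_exp.2 ((le_abs_self _).trans ((hexp_le y).trans ?_))
    exact mul_le_mul_of_nonneg_right (by norm_num) (Finset.sum_nonneg fun i _ => sq_nonneg _)
  have hint2 : Integrable (fun y => ∑ j ∈ Finset.range (k + 1), u y ^ j / j.factorial)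
      (stdGauss ι) := by
    refine integrable_finsetSum _ fun j _ => ?_
    have heq : (fun y => u y ^ j / j.factorial) = fun y => ∑ s : Fin j → ι × ι × ι × ι,
        (1 / (2 ^ j * j.factorial) : ℝ) * ((∏ l, coeffs b R (s l)) *
          (MvPolynomial.eval (b.repr X).ofLp (momX s) * MvPolynomial.eval y (momY s))) := by
      funext y
      rw [← Finset.mul_sum, ← biquad_vec_pow, vec_repr, hu, mul_pow, div_pow, one_pow]; field_simp
    rw [heq]
    exact integrable_finsetSum _ fun s _ =>
      (((integrable_eval (momY s)).const_mul _).const_mul _).const_mul _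
  rw [hgen, hpoly, ← integral_sub hint1 hint2]
  calc ‖∫ y, (Real.exp (u y) - ∑ j ∈ Finset.range (k + 1), u y ^ j / j.factorial) ∂stdGauss ι‖
      ≤ ∫ y, (C / 2) ^ (k + 1) * ((k + 1).factorial * 8 ^ (k + 1)) * ‖X‖ ^ (2 * k + 2) *
        Real.exp (3 / 8 * ∑ i, y i ^ 2) ∂stdGauss ι :=
        norm_integral_le_of_norm_le ((integrable_exp_sum_sq (ι := ι)).const_mul _)
          (ae_of_all _ fun y => (abs_exp_sub_sum_le (u y) (k + 1)).trans (hbound y))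
    _ = A * ‖X‖ ^ (2 * k + 2) := by rw [integral_const_mul, hA]; ring
    _ ≤ A * ‖‖X‖ ^ (2 * k + 1)‖ := by
        refine mul_le_mul_of_nonneg_left ?_ hA0
        rw [norm_pow, norm_norm]
        exact pow_le_pow_of_le_one (norm_nonneg _) hX1.le (by omega)

/-- The iterated Laplacian of the generating function at the origin is a Gaussian moment of the
biquadratic form of the curvature tensor. -/
theorem laplacian_iterate_genFun {R : V →ₗ[ℝ] V →ₗ[ℝ] V →ₗ[ℝ] V} (hR : R ∈ Kr V) (k : ℕ) :
    ((fun f : V → ℝ => Laplacian.laplacian f)^[k] (genFun R)) 0 = gaussE (momentPoly b R k) := by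
  set p := ∑ j ∈ Finset.range (k + 1), (1 / (2 ^ j * j.factorial) : ℝ) • momentPoly b R j with hp
  have hG := isBigO_genFun_sub b hR k
  rw [laplacian_iterate_of_isBigO b k p (G := fun X => genFun R X - polyFun b p X)
    ((analyticAt_genFun hR).sub (analyticAt_polyFun b p 0)) hG
    (Eventually.of_forall fun X => by simp)]
  have hit : ∀ q, polyLap^[k] q = (polyLap ^ k) (q : MvPolynomial ι ℝ) := fun q => by
    rw [Module.End.pow_apply]
  have : polyLap^[k] p = MvPolynomial.C (gaussE (momentPoly b R k)) := by
    rw [hit, hp, map_sum, Finset.sum_range_succ, Finset.sum_eq_zero, zero_add, map_smul, ← hit,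
      polyLap_iterate_homogeneous (isHomogeneous_momentPoly b R k), ← MvPolynomial.C_mul',
      ← MvPolynomial.C_mul]
    · congr 1; field_simp
    · intro j hj
      rw [map_smul, ← hit, polyLap_iterate_eq_zero (isHomogeneous_momentPoly b R j)
        (Finset.mem_range.1 hj), smul_zero]
  rw [this]
  simp [polyFun]

end Moments

section GramMoments

theorem C_two {ι : Type*} : (MvPolynomial.C 2 : MvPolynomial ι ℝ) = 2 :=
  map_ofNat MvPolynomial.C 2

variable {ι : Type*} [Fintype ι]

open MvPolynomial in
/-- The Laplacian of a power of a quadratic polynomial `D` for which `|∇D|²` is a multiple of `D`. -/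
theorem polyLap_pow_succ {D : MvPolynomial ι ℝ} {c e : ℝ}
    (h1 : ∑ i, pderiv i D ^ 2 = C c * D) (h2 : polyLap D = C e) (k : ℕ) :
    polyLap (D ^ (k + 1)) = C ((k + 1) * (e + k * c)) * D ^ k := by
  rw [polyLap_apply] at h2 ⊢
  have h : ∀ i, pderiv i (pderiv i (D ^ (k + 1))) =
      C ((k + 1 : ℕ) * k : ℝ) * D ^ (k - 1) * pderiv i D ^ 2 +
        C ((k + 1 : ℕ) : ℝ) * D ^ k * pderiv i (pderiv i D) := fun i => by
    simp only [Derivation.leibniz_pow, Derivation.leibniz, smul_eq_mul, nsmul_eq_mul,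
      Nat.add_sub_cancel, C_mul, map_natCast, Derivation.map_natCast]
    push_cast
    ring
  simp_rw [h]
  rw [Finset.sum_add_distrib, ← Finset.mul_sum, ← Finset.mul_sum, h1, h2]
  rcases k with _ | k
  · simp
  · simp only [Nat.add_sub_cancel, C_mul, C_add, map_natCast, pow_succ]
    push_cast
    simp only [C_1]
    ring

open MvPolynomial in
/-- Recursion for the Gaussian moments of a quadratic polynomial `D` for which `|∇D|²` is a multiple
of `D`. -/
theorem gaussE_pow_succ {D : MvPolynomial ι ℝ} {c e : ℝ} (hD : D.IsHomogeneous 2)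
    (h1 : ∑ i, pderiv i D ^ 2 = C c * D) (h2 : polyLap D = C e) (k : ℕ) :
    gaussE (D ^ (k + 1)) = (e + k * c) / 2 * gaussE (D ^ k) := by
  have h := gaussE_polyLap (hD.pow (k + 1))
  rw [polyLap_pow_succ h1 h2, ← smul_eq_C_mul, gaussE_smul] at h
  push_cast at h
  have hk : (k + 1 : ℝ) ≠ 0 := by positivity
  have : (k + 1 : ℝ) * ((e + k * c) * gaussE (D ^ k) - 2 * gaussE (D ^ (k + 1))) = 0 := by
    linear_combination h
  rcases mul_eq_zero.1 this with h | h
  · exact absurd h hk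
  · linarith

open MvPolynomial in
theorem gaussE_sum_sq_pow_succ (k : ℕ) :
    gaussE ((∑ i : ι, X i ^ 2 : MvPolynomial ι ℝ) ^ (k + 1)) =
      (Fintype.card ι + 2 * k) * gaussE ((∑ i : ι, X i ^ 2 : MvPolynomial ι ℝ) ^ k) := by
  classical
  have hp : ∀ i, pderiv i (∑ j : ι, X j ^ 2 : MvPolynomial ι ℝ) = C 2 * X i := fun i => by
    simp only [map_sum, Derivation.leibniz_pow, pderiv_X, Pi.single_apply, C_two]
    simp
  rw [gaussE_pow_succ (c := 4) (e := 2 * Fintype.card ι)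
    (IsHomogeneous.sum _ _ _ fun i _ => by simpa using (isHomogeneous_X ℝ i).pow 2)]
  · ring
  · simp only [hp, mul_pow, ← Finset.mul_sum, ← C_pow]; norm_num
  · simp only [polyLap_apply, hp, Derivation.leibniz, pderiv_X, pderiv_C]
    simp [mul_comm]

open MvPolynomial in
/-- Recursion for the moments of `|x|² |Y|² - ⟨x, Y⟩²` with a fixed vector `x`.  Up to the factor
`|x|²` this is the square of the length of the projection of `Y` to the complement of `x`. -/
theorem gaussE_gram_pow_succ (x : ι → ℝ) (k : ℕ) :
    gaussE ((C (∑ i, x i ^ 2) * ∑ i, X i ^ 2 - (∑ i, C (x i) * X i) ^ 2 : MvPolynomial ι ℝ) ^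
      (k + 1)) = (Fintype.card ι + 2 * k - 1) * (∑ i, x i ^ 2) *
        gaussE ((C (∑ i, x i ^ 2) * ∑ i, X i ^ 2 - (∑ i, C (x i) * X i) ^ 2 :
          MvPolynomial ι ℝ) ^ k) := by
  classical
  set N := ∑ i, x i ^ 2 with hN
  set S : MvPolynomial ι ℝ := ∑ i, X i ^ 2 with hS
  set L : MvPolynomial ι ℝ := ∑ i, C (x i) * X i with hL
  have hpL : ∀ i, pderiv i L = C (x i) := fun i => by
    simp only [hL, map_sum, Derivation.leibniz, pderiv_X, pderiv_C, Pi.single_apply]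
    simp
  have hpS : ∀ i, pderiv i S = C 2 * X i := fun i => by
    simp only [hS, map_sum, Derivation.leibniz_pow, pderiv_X, Pi.single_apply, C_two]
    simp
  have hp : ∀ i, pderiv i (C N * S - L ^ 2) = C 2 * (C N * X i - L * C (x i)) := fun i => by
    simp only [map_sub, Derivation.leibniz, Derivation.leibniz_pow, hpL, hpS, pderiv_C, C_two]
    simp
    ring
  have hCN : ∑ i, C (x i) ^ 2 = (C N : MvPolynomial ι ℝ) := by simp [hN]
  rw [gaussE_pow_succ (c := 4 * N) (e := 2 * (Fintype.card ι - 1) * N)]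
  · ring
  · refine IsHomogeneous.sub ?_ ?_
    · simpa using (isHomogeneous_C ι N).mul (IsHomogeneous.sum Finset.univ (fun i => (X i ^ 2 : MvPolynomial ι ℝ))
        2 fun i _ => by simpa using (isHomogeneous_X ℝ i).pow 2)
    · simpa using (IsHomogeneous.sum Finset.univ (fun i => (C (x i) * X i : MvPolynomial ι ℝ))
        1 fun i _ => by simpa using (isHomogeneous_C ι (x i)).mul (isHomogeneous_X ℝ i)).pow 2
  · have : ∀ i, pderiv i (C N * S - L ^ 2) ^ 2 = C 4 * (C N * C N * X i ^ 2 -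
        C 2 * C N * L * (C (x i) * X i) + L ^ 2 * C (x i) ^ 2) := fun i => by
      rw [hp]
      have : (C 4 : MvPolynomial ι ℝ) = C 2 * C 2 := by rw [← C_mul]; norm_num
      rw [this, C_two]; ring
    simp_rw [this]
    rw [← Finset.mul_sum, Finset.sum_add_distrib, Finset.sum_sub_distrib, ← Finset.mul_sum,
      ← Finset.mul_sum, ← Finset.mul_sum, hCN, ← hS, ← hL]
    rw [C_mul, C_two]; ring
  · have : ∀ i, pderiv i (pderiv i (C N * S - L ^ 2)) = C 2 * (C N - C (x i) ^ 2) := fun i => by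
      rw [hp]
      simp only [Derivation.leibniz, map_sub, hpL, pderiv_C, pderiv_X]
      simp
      ring
    rw [polyLap_apply]
    simp_rw [this]
    rw [← Finset.mul_sum, Finset.sum_sub_distrib, hCN]
    simp only [Finset.sum_const, Finset.card_univ, nsmul_eq_mul, C_mul, C_sub, map_natCast, C_1]
    ring

end GramMoments

section ConstCurv

variable {V : Type*} [NormedAddCommGroup V] [InnerProductSpace ℝ V]

/-- The curvature tensor `R_{A,B} C = g(B, C) A - g(A, C) B` of constant sectional curvature
`1`. -/
def constCurv (V : Type*) [NormedAddCommGroup V] [InnerProductSpace ℝ V] :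
    V →ₗ[ℝ] V →ₗ[ℝ] V →ₗ[ℝ] V :=
  LinearMap.mk₂ ℝ (fun A B => (innerₗ V B).smulRight A - (innerₗ V A).smulRight B)
    (fun A A' B => by ext C; simp [add_smul]; abel)
    (fun c A B => by ext C; simp [smul_sub, smul_smul, mul_comm])
    (fun A B B' => by ext C; simp [add_smul]; abel)
    (fun c A B => by ext C; simp [smul_sub, smul_smul, mul_comm])

theorem constCurv_apply (A B C : V) :
    constCurv V A B C = (inner ℝ B C : ℝ) • A - (inner ℝ A C : ℝ) • B := rfl

theorem constCurv_mem_Kr : constCurv V ∈ Kr V := by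
  refine ⟨fun A B C => ?_, fun A B C D => ?_, fun A B C => ?_⟩
  · simp only [constCurv_apply]; abel
  · simp only [constCurv_apply, inner_sub_left, inner_sub_right, inner_smul_left, inner_smul_right,
      conj_trivial, real_inner_comm]
    ring
  · simp only [constCurv_apply]
    rw [real_inner_comm A C, real_inner_comm A B, real_inner_comm B C]
    abel

theorem biquad_constCurv (X Y : V) :
    biquad (constCurv V) X Y = inner ℝ X X * inner ℝ Y Y - inner ℝ X Y ^ 2 := by
  simp only [biquad, constCurv_apply, inner_sub_left, inner_smul_left, conj_trivial]
  rw [real_inner_comm X Y]; ring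

variable {ι : Type*} [Fintype ι] (b : OrthonormalBasis ι ℝ V)

theorem inner_vec_vec (x y : ι → ℝ) : inner ℝ (vec b x) (vec b y) = ∑ i, x i * y i := by
  nth_rewrite 1 [vec]
  simp only [sum_inner, inner_smul_left, conj_trivial]
  refine Finset.sum_congr rfl fun i _ => ?_
  classical
  simp [vec, inner_sum, inner_smul_right, b.inner_eq_ite]

theorem biquad_constCurv_vec (x y : ι → ℝ) :
    biquad (constCurv V) (vec b x) (vec b y) =
      (∑ i, x i ^ 2) * (∑ i, y i ^ 2) - (∑ i, x i * y i) ^ 2 := by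
  simp only [biquad_constCurv, inner_vec_vec, sq]

theorem gramDet_eq_biquad (Z : ι × Fin 2 → ℝ) :
    gramDet Z = biquad (constCurv V) (vec b (col Z 0)) (vec b (col Z 1)) := by
  rw [biquad_constCurv_vec]; rfl

end ConstCurv

section Psi

set_option linter.unusedSectionVars false

variable {ι : Type*} [Fintype ι]

theorem integrable_gramDet_pow (k : ℕ) :
    Integrable (fun Z : ι × Fin 2 → ℝ => gramDet Z ^ k) (stdGauss (ι × Fin 2)) := by
  simp_rw [gramDet_eq_biquad (EuclideanSpace.basisFun ι ℝ)]
  exact integrable_biquad_pow _ _ _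

theorem descPochhammer_eval_two_mul_succ (x : ℝ) (k : ℕ) :
    (descPochhammer ℝ (2 * (k + 1))).eval (x + 2 * ((k + 1 : ℕ) : ℝ) - 2) =
      (x + 2 * k) * (x + 2 * k - 1) * (descPochhammer ℝ (2 * k)).eval (x + 2 * k - 2) := by
  rw [show 2 * (k + 1) = (2 * k + 1) + 1 by ring, descPochhammer_succ_left,
    descPochhammer_succ_left]
  simp only [Polynomial.eval_mul, Polynomial.eval_X, Polynomial.eval_comp, Polynomial.eval_sub,
    Polynomial.eval_one]
  push_cast
  have h1 : x + 2 * ((k : ℝ) + 1) - 2 = x + 2 * k := by ring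
  have h2 : x + 2 * (k : ℝ) - 1 - 1 = x + 2 * k - 2 := by ring
  rw [h1, h2, mul_assoc]

open MvPolynomial in
/-- The falling factorials are the moments of the Gram determinant of two Gaussian vectors. -/
theorem integral_gramDet_pow (k : ℕ) :
    ∫ Z : ι × Fin 2 → ℝ, gramDet Z ^ k ∂stdGauss (ι × Fin 2) =
      (descPochhammer ℝ (2 * k)).eval ((Fintype.card ι : ℝ) + 2 * k - 2) := by
  let b := EuclideanSpace.basisFun ι ℝ
  simp_rw [gramDet_eq_biquad b]
  rw [← gaussE_momentPoly_eq_integral]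
  have hy : ∀ (x : ι → ℝ) (k : ℕ), gaussE ((C (∑ i, x i ^ 2) * ∑ i, X i ^ 2 -
      (∑ i, C (x i) * X i) ^ 2 : MvPolynomial ι ℝ) ^ k) =
      (∏ j ∈ Finset.range k, ((Fintype.card ι : ℝ) + 2 * j - 1)) * (∑ i, x i ^ 2) ^ k := by
    intro x k
    induction k with
    | zero => rw [pow_zero, ← C_1, gaussE_C]; simp
    | succ k ih => rw [gaussE_gram_pow_succ, ih, Finset.prod_range_succ]; ring
  have hx : ∀ k, gaussE ((∑ i : ι, X i ^ 2 : MvPolynomial ι ℝ) ^ k) =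
      ∏ j ∈ Finset.range k, ((Fintype.card ι : ℝ) + 2 * j) := by
    intro k
    induction k with
    | zero => rw [pow_zero, ← C_1, gaussE_C]; simp
    | succ k ih => rw [gaussE_sum_sq_pow_succ, ih, Finset.prod_range_succ]; ring
  have h1 : gaussE (momentPoly b (constCurv _) k) =
      (∏ j ∈ Finset.range k, ((Fintype.card ι : ℝ) + 2 * j - 1)) *
        ∏ j ∈ Finset.range k, ((Fintype.card ι : ℝ) + 2 * j) := by
    rw [← hx, ← gaussE_smul]
    unfold gaussE
    congr 1; funext x
    rw [eval_momentPoly, smul_eval, map_pow]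
    have := hy x k
    simp only [map_sum, map_pow, eval_X]
    rw [← this, gaussE]
    congr 1; funext y
    rw [biquad_constCurv_vec]
    simp
  rw [h1]
  clear h1
  induction k with
  | zero => simp
  | succ k ih =>
    rw [descPochhammer_eval_two_mul_succ, ← ih, Finset.prod_range_succ, Finset.prod_range_succ]
    ring

theorem integral_gramDet_pow_pos (hι : 2 ≤ Fintype.card ι) (k : ℕ) :
    0 < ∫ Z : ι × Fin 2 → ℝ, gramDet Z ^ k ∂stdGauss (ι × Fin 2) := by
  rw [integral_gramDet_pow]
  have h2 : (2 : ℝ) ≤ Fintype.card ι := by exact_mod_cast hι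
  induction k with
  | zero => simp
  | succ k ih =>
    rw [descPochhammer_eval_two_mul_succ]
    have hk : (0 : ℝ) ≤ k := by positivity
    exact mul_pos (mul_pos (by linarith) (by linarith)) ih

variable {V : Type*} [NormedAddCommGroup V] [InnerProductSpace ℝ V] [FiniteDimensional ℝ V]
  (b : OrthonormalBasis ι ℝ V)

theorem Psi_eq_gaussE {R : V →ₗ[ℝ] V →ₗ[ℝ] V →ₗ[ℝ] V} (hR : R ∈ Kr V) (k : ℕ) :
    Psi k R = gaussE (momentPoly b R k) /
      ∫ Z : ι × Fin 2 → ℝ, gramDet Z ^ k ∂stdGauss (ι × Fin 2) := by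
  rw [Psi, laplacian_iterate_genFun b hR, integral_gramDet_pow,
    Module.finrank_eq_card_basis b.toBasis]

/-- `Ψ_k` is the quotient of the `k`-th moments of the biquadratic form of the curvature tensor and
of the Gram determinant of two independent Gaussian vectors. -/
theorem Psi_eq_integral {R : V →ₗ[ℝ] V →ₗ[ℝ] V →ₗ[ℝ] V} (hR : R ∈ Kr V) (k : ℕ) :
    Psi k R =
      (∫ Z, biquad R (vec b (col Z 0)) (vec b (col Z 1)) ^ k ∂stdGauss (ι × Fin 2)) /
      ∫ Z : ι × Fin 2 → ℝ, gramDet Z ^ k ∂stdGauss (ι × Fin 2) := by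
  rw [Psi_eq_gaussE b hR, gaussE_momentPoly_eq_integral]

theorem isHomogeneousPoly_Psi (k : ℕ) :
    IsHomogeneousPoly k (fun R : Kr V => Psi k (R : V →ₗ[ℝ] V →ₗ[ℝ] V →ₗ[ℝ] V)) := by
  let ι := Fin (Module.finrank ℝ V)
  let b : OrthonormalBasis ι ℝ V := stdOrthonormalBasis ℝ V
  let e := Fintype.equivFin (ι × ι × ι × ι)
  let l (t : ι × ι × ι × ι) : Module.Dual ℝ (Kr V) :=
    { toFun := fun R => coeffs b R t
      map_add' := fun R S => by simp [coeffs, inner_add_left]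
      map_smul' := fun c R => by simp [coeffs, inner_smul_left] }
  let D := ∫ Z : ι × Fin 2 → ℝ, gramDet Z ^ k ∂stdGauss (ι × Fin 2)
  refine ⟨Fintype.card (ι × ι × ι × ι), fun i => l (e.symm i),
    ∑ s : Fin k → ι × ι × ι × ι, MvPolynomial.C (gaussE (momY s) * gaussE (momX s) / D) *
      ∏ i, MvPolynomial.X (e (s i)), ?_, fun R => ?_⟩
  · refine MvPolynomial.IsHomogeneous.sum _ _ _ fun s _ => ?_
    have h := (MvPolynomial.isHomogeneous_C (Fin (Fintype.card (ι × ι × ι × ι)))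
      (gaussE (momY s) * gaussE (momX s) / D)).mul
      (MvPolynomial.IsHomogeneous.prod Finset.univ
        (fun i => (MvPolynomial.X (e (s i)) : MvPolynomial _ ℝ)) (fun _ => 1)
        fun i _ => MvPolynomial.isHomogeneous_X ℝ _)
    simpa using h
  · beta_reduce
    rw [Psi_eq_gaussE b R.2, gaussE_momentPoly, Finset.sum_div, map_sum]
    refine Finset.sum_congr rfl fun s _ => ?_
    simp only [map_mul, map_prod, MvPolynomial.eval_C, MvPolynomial.eval_X, Equiv.symm_apply_apply]
    show _ = _ * ∏ i, coeffs b R (s i)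
    ring

theorem Psi_constCurv (h : 2 ≤ Module.finrank ℝ V) (k : ℕ) : Psi k (constCurv V) = 1 := by
  let b := stdOrthonormalBasis ℝ V
  rw [Psi_eq_integral b constCurv_mem_Kr]
  simp_rw [← gramDet_eq_biquad b]
  exact div_self (integral_gramDet_pow_pos (by simpa using h) k).ne'

theorem transport_apply {W : Type*} [NormedAddCommGroup W] [InnerProductSpace ℝ W]
    (φ : V ≃ₗᵢ[ℝ] W) (R : V →ₗ[ℝ] V →ₗ[ℝ] V →ₗ[ℝ] V) (X Y Z : W) :
    transport φ R X Y Z = φ (R (φ.symm X) (φ.symm Y) (φ.symm Z)) := rfl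

theorem transport_mem_Kr {W : Type*} [NormedAddCommGroup W] [InnerProductSpace ℝ W]
    (φ : V ≃ₗᵢ[ℝ] W) {R : V →ₗ[ℝ] V →ₗ[ℝ] V →ₗ[ℝ] V} (hR : R ∈ Kr V) :
    transport φ R ∈ Kr W := by
  obtain ⟨h1, h2, h3⟩ := hR
  have hφ : ∀ (v : V) (w : W), inner ℝ (φ v) w = inner ℝ v (φ.symm w) := fun v w => by
    rw [← φ.inner_map_map, φ.apply_symm_apply]
  refine ⟨fun X Y Z => ?_, fun X Y Z T => ?_, fun X Y Z => ?_⟩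
  · rw [transport_apply, transport_apply, h1, map_neg]
  · rw [transport_apply, transport_apply, hφ, h2, real_inner_comm, ← hφ, real_inner_comm]
  · simp only [transport_apply]
    rw [← map_add, ← map_add, h3, map_zero]

theorem Psi_transport {W : Type*} [NormedAddCommGroup W] [InnerProductSpace ℝ W]
    [FiniteDimensional ℝ W] (φ : V ≃ₗᵢ[ℝ] W) {R : V →ₗ[ℝ] V →ₗ[ℝ] V →ₗ[ℝ] V} (hR : R ∈ Kr V)
    (k : ℕ) : Psi k (transport φ R) = Psi k R := by
  let b := stdOrthonormalBasis ℝ V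
  rw [Psi_eq_gaussE (b.map φ) (transport_mem_Kr φ hR), Psi_eq_gaussE b hR, gaussE_momentPoly,
    gaussE_momentPoly]
  have : ∀ t, coeffs (b.map φ) (transport φ R) t = coeffs b R t := fun t => by
    simp [coeffs, transport_apply]
  simp_rw [this]

end Psi

/-! ### Graph coordinates for pairs of vectors -/

section Frames

set_option linter.unusedSectionVars false

open Matrix
open scoped Kronecker MatrixOrder

/-- A matrix with two columns as a matrix. -/
def toMat {κ : Type*} (Z : κ × Fin 2 → ℝ) : Matrix κ (Fin 2) ℝ := Matrix.of fun i a => Z (i, a)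

/-- The coordinates of a matrix with two columns. -/
def unMat {κ : Type*} (A : Matrix κ (Fin 2) ℝ) : κ × Fin 2 → ℝ := fun q => A q.1 q.2

@[simp] theorem toMat_unMat {κ : Type*} (A : Matrix κ (Fin 2) ℝ) : toMat (unMat A) = A := rfl

@[simp] theorem unMat_toMat {κ : Type*} (Z : κ × Fin 2 → ℝ) : unMat (toMat Z) = Z := rfl

theorem lintegral_mulVec {κ : Type*} [Fintype κ] [DecidableEq κ] {N : Matrix κ κ ℝ}
    (hN : N.det ≠ 0) (f : (κ → ℝ) → ENNReal) :
    ENNReal.ofReal |N.det| * ∫⁻ Z, f (N *ᵥ Z) = ∫⁻ Z, f Z := by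
  have h := Real.map_matrix_volume_pi_eq_smul_volume_pi hN
  let e : (κ → ℝ) ≃ᵐ (κ → ℝ) :=
    (LinearEquiv.toContinuousLinearEquiv
      (Matrix.toLinearEquiv' N (N.invertibleOfIsUnitDet hN.isUnit))).toHomeomorph.toMeasurableEquiv
  have he : (e : (κ → ℝ) → (κ → ℝ)) = toLin' N := rfl
  have h1 : ∫⁻ Z, f (N *ᵥ Z) = ∫⁻ Z, f Z ∂(Measure.map e volume) := by
    rw [lintegral_map_equiv]
    rfl
  rw [h1, he, h, lintegral_smul_measure, smul_eq_mul, ← mul_assoc,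
    ← ENNReal.ofReal_mul (abs_nonneg _), ← abs_mul, mul_inv_cancel₀ hN]
  simp

theorem lintegral_mul_left {κ : Type*} [Fintype κ] [DecidableEq κ] {T : Matrix κ κ ℝ}
    (hT : T.det ≠ 0) (f : (κ × Fin 2 → ℝ) → ENNReal) :
    ENNReal.ofReal (T.det ^ 2) * ∫⁻ Z : κ × Fin 2 → ℝ, f (unMat (T * toMat Z)) = ∫⁻ Z, f Z := by
  have hd : (T ⊗ₖ (1 : Matrix (Fin 2) (Fin 2) ℝ)).det = T.det ^ 2 := by
    rw [det_kronecker]; simp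
  have h := lintegral_mulVec (N := T ⊗ₖ (1 : Matrix (Fin 2) (Fin 2) ℝ))
    (by rw [hd]; positivity) f
  rw [hd, abs_of_nonneg (sq_nonneg _)] at h
  rw [← h]
  congr 2; funext Z; congr 1; funext ⟨i, a⟩
  simp only [unMat, Matrix.mul_apply, Matrix.mulVec, dotProduct, kroneckerMap_apply,
    Fintype.sum_prod_type, toMat, Matrix.of_apply, Matrix.one_apply]
  refine Finset.sum_congr rfl fun j _ => ?_
  simp

theorem lintegral_mul_right {κ : Type*} [Fintype κ] [DecidableEq κ] {B : Matrix (Fin 2) (Fin 2) ℝ}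
    (hB : B.det ≠ 0) (f : (κ × Fin 2 → ℝ) → ENNReal) :
    ENNReal.ofReal (|B.det| ^ Fintype.card κ) * ∫⁻ Z : κ × Fin 2 → ℝ, f (unMat (toMat Z * B)) = ∫⁻ Z, f Z := by
  have hd : ((1 : Matrix κ κ ℝ) ⊗ₖ Bᵀ).det = B.det ^ Fintype.card κ := by
    rw [det_kronecker]; simp
  have h := lintegral_mulVec (N := (1 : Matrix κ κ ℝ) ⊗ₖ Bᵀ)
    (by rw [hd]; positivity) f
  rw [hd, abs_pow] at h
  rw [← h]
  congr 2; funext Z; congr 1; funext ⟨i, a⟩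
  simp only [unMat, Matrix.mul_apply, Matrix.mulVec, dotProduct, kroneckerMap_apply,
    Fintype.sum_prod_type, toMat, Matrix.of_apply, Matrix.one_apply, Matrix.transpose_apply]
  rw [Finset.sum_eq_single i (fun j _ hj => by simp [hj.symm]) (by simp)]
  simp [mul_comm]

/-- If the first row of a `2 × 2` matrix is a fixed non-zero vector, the determinant is a non-zero
linear form in the second row. -/
theorem volume_det_eq_zero : volume {B : Fin 2 × Fin 2 → ℝ | (toMat B).det = 0} = 0 := by
  have hm : MeasurableSet {B : Fin 2 × Fin 2 → ℝ | (toMat B).det = 0} := by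
    have : Continuous fun B : Fin 2 × Fin 2 → ℝ => (toMat B).det := by
      simp only [Matrix.det_fin_two, toMat, Matrix.of_apply]; fun_prop
    exact (isClosed_singleton.preimage this).measurableSet
  have hp := measurePreserving_pairEquiv (ι := Fin 2) volume
  have hp' : volume {B : Fin 2 × Fin 2 → ℝ | (toMat B).det = 0} =
      (volume.prod volume) (pairEquiv (Fin 2) ⁻¹' {B | (toMat B).det = 0}) :=
    (hp.measure_preimage hm.nullMeasurableSet).symm
  rw [hp', Measure.measure_prod_null ((pairEquiv (Fin 2)).measurable hm)]
  have h0 : ∀ᵐ u : Fin 2 → ℝ, u ≠ 0 := by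
    simp [ae_iff]
  filter_upwards [h0] with u hu
  let L : (Fin 2 → ℝ) →ₗ[ℝ] ℝ := u 0 • LinearMap.proj 1 - u 1 • LinearMap.proj 0
  have hL : Prod.mk u ⁻¹' (pairEquiv (Fin 2) ⁻¹' {B | (toMat B).det = 0}) = LinearMap.ker L := by
    ext v
    simp only [Set.mem_preimage, Set.mem_ofPred_eq, Matrix.det_fin_two, toMat, Matrix.of_apply,
      pairEquiv, MeasurableEquiv.coe_mk, Equiv.coe_fn_mk, SetLike.mem_coe, LinearMap.mem_ker, L,
      LinearMap.sub_apply, LinearMap.smul_apply, LinearMap.proj_apply, smul_eq_mul]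
    simp [mul_comm]
  rw [hL]
  refine Measure.addHaar_submodule _ _ fun htop => hu ?_
  rw [LinearMap.ker_eq_top] at htop
  funext i
  have h1 := LinearMap.congr_fun htop (Pi.single 1 1)
  have h2 := LinearMap.congr_fun htop (Pi.single 0 1)
  simp [L] at h1 h2
  fin_cases i <;> simp [h1, h2]

theorem exists_transpose_mul_mul_eq_one {H : Matrix (Fin 2) (Fin 2) ℝ} (hH : H.PosDef) :
    ∃ C : Matrix (Fin 2) (Fin 2) ℝ, Cᵀ * H * C = 1 := by
  set P := CFC.sqrt H with hP
  have hPP : P * P = H := CFC.sqrt_mul_sqrt_self H hH.posSemidef.nonneg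
  have hPt : Pᵀ = P := by
    have := (CFC.sqrt_nonneg H).posSemidef.isHermitian
    simpa [Matrix.IsHermitian, Matrix.conjTranspose_eq_transpose_of_trivial] using this
  have hdet : P.det ≠ 0 := fun h => hH.det_pos.ne' (by rw [← hPP, det_mul, h, zero_mul])
  refine ⟨P⁻¹, ?_⟩
  rw [transpose_nonsing_inv, hPt, ← hPP, ← Matrix.mul_assoc, nonsing_inv_mul _ hdet.isUnit,
    Matrix.one_mul, mul_nonsing_inv _ hdet.isUnit]

variable {ι : Type*} [Fintype ι] [DecidableEq ι] {n : ℕ} (σ : Fin 2 ⊕ Fin n ≃ ι)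

/-- The matrix with the identity matrix as its upper and `A` as its lower block; its columns span
the graph of `A`. -/
def frameMat (A : Fin n × Fin 2 → ℝ) : Matrix ι (Fin 2) ℝ :=
  Matrix.of fun i a => Sum.elim (fun c => (1 : Matrix (Fin 2) (Fin 2) ℝ) c a) (fun c => A (c, a))
    (σ.symm i)

/-- The upper block of a matrix with two columns. -/
def topBlock (Z : ι × Fin 2 → ℝ) : Matrix (Fin 2) (Fin 2) ℝ :=
  Matrix.of fun c a => Z (σ (Sum.inl c), a)

/-- The lower block of a matrix with two columns. -/
def botBlock (Z : ι × Fin 2 → ℝ) : Matrix (Fin n) (Fin 2) ℝ :=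
  Matrix.of fun c a => Z (σ (Sum.inr c), a)

/-- The graph coordinates of the column space of a matrix with two columns. -/
def graphCoord (Z : ι × Fin 2 → ℝ) : Fin n × Fin 2 → ℝ :=
  unMat (botBlock σ Z * (topBlock σ Z)⁻¹)

theorem frameMat_graphCoord_mul {Z : ι × Fin 2 → ℝ} (h : (topBlock σ Z).det ≠ 0) :
    frameMat σ (graphCoord σ Z) * topBlock σ Z = toMat Z := by
  ext i a
  obtain ⟨i, rfl⟩ := σ.surjective i
  have h1 : botBlock σ Z * (topBlock σ Z)⁻¹ * topBlock σ Z = botBlock σ Z := by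
    rw [Matrix.mul_assoc, nonsing_inv_mul _ h.isUnit, Matrix.mul_one]
  rcases i with c | c
  · have : ((1 : Matrix (Fin 2) (Fin 2) ℝ) * topBlock σ Z) c a = topBlock σ Z c a := by
      rw [Matrix.one_mul]
    rw [Matrix.mul_apply] at this ⊢
    simpa [frameMat, topBlock, toMat] using this
  · have := congrFun (congrFun h1 c) a
    rw [Matrix.mul_apply] at this ⊢
    simpa [frameMat, graphCoord, unMat, botBlock, toMat] using this

theorem continuous_topBlock : Continuous (topBlock σ) := by
  unfold topBlock; fun_prop

theorem continuous_toMat {κ : Type*} : Continuous (toMat (κ := κ)) := by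
  unfold toMat; fun_prop

theorem measurable_graphCoord : Measurable (graphCoord σ) := by
  refine measurable_pi_iff.2 fun ⟨c, a⟩ => ?_
  have : (fun Z => graphCoord σ Z (c, a)) = fun Z => ∑ b, Z (σ (Sum.inr c), b) *
      (((topBlock σ Z).det)⁻¹ * (topBlock σ Z).adjugate b a) := by
    funext Z
    simp only [graphCoord, unMat, Matrix.mul_apply, Matrix.inv_def, Ring.inverse_eq_inv',
      Matrix.smul_apply, smul_eq_mul, botBlock, Matrix.of_apply]
  rw [this]
  refine Finset.measurable_sum _ fun b _ => ?_
  refine (measurable_pi_apply _).mul (Measurable.mul (Measurable.inv ?_) ?_)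
  · exact (continuous_topBlock σ).matrix_det.measurable
  · exact ((continuous_topBlock σ).matrix_adjugate.matrix_elem b a).measurable

/-- A matrix with two columns is given by its upper and lower blocks. -/
def splitEquiv : (Fin 2 × Fin 2 → ℝ) × (Fin n × Fin 2 → ℝ) ≃ᵐ (ι × Fin 2 → ℝ) where
  toFun p q := Sum.elim (fun c => p.1 (c, q.2)) (fun c => p.2 (c, q.2)) (σ.symm q.1)
  invFun Z := (fun q => Z (σ (Sum.inl q.1), q.2), fun q => Z (σ (Sum.inr q.1), q.2))
  left_inv p := by simp
  right_inv Z := by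
    funext ⟨i, a⟩
    obtain ⟨i, rfl⟩ := σ.surjective i
    rcases i with c | c <;> simp
  measurable_toFun := by
    refine measurable_pi_iff.2 fun ⟨i, a⟩ => ?_
    obtain ⟨i, rfl⟩ := σ.surjective i
    rcases i with c | c
    · simp only [Equiv.coe_fn_mk, Equiv.symm_apply_apply, Sum.elim_inl]; fun_prop
    · simp only [Equiv.coe_fn_mk, Equiv.symm_apply_apply, Sum.elim_inr]; fun_prop
  measurable_invFun := by
    simp only [Equiv.symm_mk, Equiv.coe_fn_mk]; fun_prop

theorem measurePreserving_splitEquiv : MeasurePreserving (splitEquiv σ) (volume.prod volume)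
    volume where
  measurable := (splitEquiv σ).measurable
  map_eq := by
    refine (Measure.pi_eq fun s _ => ?_).symm
    have : splitEquiv σ ⁻¹' Set.pi Set.univ s =
        (Set.pi Set.univ fun q => s (σ (Sum.inl q.1), q.2)) ×ˢ
          (Set.pi Set.univ fun q => s (σ (Sum.inr q.1), q.2)) := by
      ext p
      simp only [Set.mem_preimage, Set.mem_pi, Set.mem_univ, true_implies, Prod.forall,
        Set.mem_prod, splitEquiv, MeasurableEquiv.coe_mk, Equiv.coe_fn_mk]
      rw [← σ.forall_congr_right]
      simp
    rw [MeasurableEquiv.map_apply, this, Measure.prod_prod, volume_pi, volume_pi, Measure.pi_pi,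
      Measure.pi_pi, Fintype.prod_prod_type, Fintype.prod_prod_type, Fintype.prod_prod_type,
      ← σ.prod_comp, Fintype.prod_sum_type]

theorem topBlock_splitEquiv (p : (Fin 2 × Fin 2 → ℝ) × (Fin n × Fin 2 → ℝ)) :
    topBlock σ (splitEquiv σ p) = toMat p.1 := by
  ext c a; simp [topBlock, splitEquiv, toMat]

theorem botBlock_splitEquiv (p : (Fin 2 × Fin 2 → ℝ) × (Fin n × Fin 2 → ℝ)) :
    botBlock σ (splitEquiv σ p) = toMat p.2 := by
  ext c a; simp [botBlock, splitEquiv, toMat]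

theorem ae_det_topBlock_ne_zero : ∀ᵐ Z : ι × Fin 2 → ℝ, (topBlock σ Z).det ≠ 0 := by
  rw [← (measurePreserving_splitEquiv σ).map_eq, ae_map_iff (splitEquiv σ).measurable.aemeasurable]
  · simp_rw [topBlock_splitEquiv]
    have h : ∀ᵐ B : Fin 2 × Fin 2 → ℝ, (toMat B).det ≠ 0 := by
      rw [ae_iff]; simpa using volume_det_eq_zero
    exact Measure.quasiMeasurePreserving_fst.ae h
  · have : Continuous fun Z : ι × Fin 2 → ℝ => (topBlock σ Z).det := by
      simp only [Matrix.det_fin_two, topBlock, Matrix.of_apply]; fun_prop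
    exact (isClosed_singleton.preimage this).measurableSet.compl

/-- The integral over the matrices `B` that remains after the introduction of graph coordinates. -/
def frameConst (n : ℕ) (w : Matrix (Fin 2) (Fin 2) ℝ → ENNReal) : ENNReal :=
  ∫⁻ B : Fin 2 × Fin 2 → ℝ, ENNReal.ofReal (|(toMat B).det| ^ n) * w ((toMat B)ᵀ * toMat B)

theorem posDef_frameMat {g : Matrix ι ι ℝ} (hg : g.PosDef) (A : Fin n × Fin 2 → ℝ) :
    ((frameMat σ A)ᵀ * g * frameMat σ A).PosDef := by
  have hinj : Function.Injective (frameMat σ A).mulVec := by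
    intro v w h
    funext c
    have := congrFun h (σ (Sum.inl c))
    have h1 : ∀ u : Fin 2 → ℝ, (frameMat σ A *ᵥ u) (σ (Sum.inl c)) = u c := fun u => by
      have := congrFun (Matrix.one_mulVec u) c
      rw [Matrix.mulVec, dotProduct] at this ⊢
      simpa [frameMat] using this
    rwa [h1, h1] at this
  have := hg.conjTranspose_mul_mul_same hinj
  rwa [Matrix.conjTranspose_eq_transpose_of_trivial] at this

/-- Substitution of `C B` for `B`, where `Cᵀ H C = 1`. -/
theorem lintegral_det_pow_mul {H : Matrix (Fin 2) (Fin 2) ℝ} (hH : H.PosDef)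
    (w : Matrix (Fin 2) (Fin 2) ℝ → ENNReal) :
    ∫⁻ B : Fin 2 × Fin 2 → ℝ, ENNReal.ofReal (|(toMat B).det| ^ n) *
      w ((toMat B)ᵀ * H * toMat B) =
      ENNReal.ofReal ((√H.det ^ (n + 2))⁻¹) * frameConst n w := by
  obtain ⟨C, hC⟩ := exists_transpose_mul_mul_eq_one hH
  have hdet : C.det ^ 2 * H.det = 1 := by
    have := congrArg Matrix.det hC
    rw [det_mul, det_mul, det_transpose, det_one] at this
    linarith
  have hC0 : C.det ≠ 0 := fun h => by rw [h] at hdet; norm_num at hdet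
  have habs : |C.det| = (√H.det)⁻¹ := by
    have h1 : 0 < √H.det := Real.sqrt_pos.2 hH.det_pos
    have h2 : (|C.det| * √H.det) ^ 2 = 1 := by
      rw [mul_pow, sq_abs, Real.sq_sqrt hH.det_pos.le, hdet]
    have h3 : |C.det| * √H.det = 1 := by
      nlinarith [mul_nonneg (abs_nonneg C.det) h1.le]
    field_simp at h3 ⊢; linarith
  rw [← lintegral_mul_left hC0, frameConst]
  have : ∀ B : Fin 2 × Fin 2 → ℝ, ENNReal.ofReal (|(toMat (unMat (C * toMat B))).det| ^ n) *
      w ((toMat (unMat (C * toMat B)))ᵀ * H * toMat (unMat (C * toMat B))) =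
      ENNReal.ofReal (|C.det| ^ n) * (ENNReal.ofReal (|(toMat B).det| ^ n) *
        w ((toMat B)ᵀ * toMat B)) := fun B => by
    rw [toMat_unMat, det_mul, abs_mul, mul_pow, ENNReal.ofReal_mul (by positivity), mul_assoc]
    congr 3
    rw [transpose_mul]
    calc (toMat B)ᵀ * Cᵀ * H * (C * toMat B) = (toMat B)ᵀ * (Cᵀ * H * C) * toMat B := by
          simp only [Matrix.mul_assoc]
      _ = _ := by rw [hC, Matrix.mul_one]
  simp_rw [this]
  rw [lintegral_const_mul' _ _ ENNReal.ofReal_ne_top, ← mul_assoc,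
    ← ENNReal.ofReal_mul (sq_nonneg _)]
  congr 2
  rw [← sq_abs, habs, ← pow_add, inv_pow, add_comm]

/-- Change of variables from matrices with two columns to graph coordinates. -/
theorem lintegral_graphCoord {g : Matrix ι ι ℝ} (hg : g.PosDef)
    {φ : (Fin n × Fin 2 → ℝ) → ENNReal} (hφ : Measurable φ)
    {w : Matrix (Fin 2) (Fin 2) ℝ → ENNReal} (hw : Continuous w) :
    ∫⁻ Z : ι × Fin 2 → ℝ, φ (graphCoord σ Z) * w ((toMat Z)ᵀ * g * toMat Z) =
      frameConst n w * ∫⁻ A, φ A * ENNReal.ofReal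
        ((√((frameMat σ A)ᵀ * g * frameMat σ A).det ^ (n + 2))⁻¹) := by
  have hwm : ∀ {κ : Type _} [Fintype κ] (g : Matrix κ κ ℝ),
      Measurable fun Z : κ × Fin 2 → ℝ => w ((toMat Z)ᵀ * g * toMat Z) := fun g => by
    refine (hw.comp ?_).measurable
    exact (continuous_toMat.matrix_transpose.matrix_mul continuous_const).matrix_mul continuous_toMat
  have hframe : Continuous (frameMat σ (ι := ι)) := by
    refine continuous_matrix fun i a => ?_
    obtain ⟨i, rfl⟩ := σ.surjective i
    rcases i with c | c
    · simp only [frameMat, Matrix.of_apply, Equiv.symm_apply_apply, Sum.elim_inl]; fun_prop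
    · simp only [frameMat, Matrix.of_apply, Equiv.symm_apply_apply, Sum.elim_inr]; fun_prop
  have hF : Measurable fun Z : ι × Fin 2 → ℝ =>
      φ (graphCoord σ Z) * w ((toMat Z)ᵀ * g * toMat Z) :=
    (hφ.comp (measurable_graphCoord σ)).mul (hwm g)
  have hF' := (hF.comp (splitEquiv σ).measurable).aemeasurable (μ := volume.prod volume)
  simp only [Function.comp_def] at hF'
  rw [← (measurePreserving_splitEquiv σ).lintegral_comp hF, lintegral_prod _ hF']
  have hdet : ∀ᵐ B : Fin 2 × Fin 2 → ℝ, (toMat B).det ≠ 0 := by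
    rw [ae_iff]; simpa using volume_det_eq_zero
  have hinner : ∀ᵐ B : Fin 2 × Fin 2 → ℝ,
      ∫⁻ N, φ (graphCoord σ (splitEquiv σ (B, N))) *
        w ((toMat (splitEquiv σ (B, N)))ᵀ * g * toMat (splitEquiv σ (B, N))) =
      ∫⁻ A, φ A * (ENNReal.ofReal (|(toMat B).det| ^ n) *
        w ((toMat B)ᵀ * ((frameMat σ A)ᵀ * g * frameMat σ A) * toMat B)) := by
    filter_upwards [hdet] with B hB
    rw [← lintegral_mul_right hB, Fintype.card_fin, ← lintegral_const_mul' _ _ ENNReal.ofReal_ne_top]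
    congr 1; funext A
    have h1 : graphCoord σ (splitEquiv σ (B, unMat (toMat A * toMat B))) = A := by
      rw [graphCoord, topBlock_splitEquiv, botBlock_splitEquiv, toMat_unMat, Matrix.mul_assoc,
        mul_nonsing_inv _ hB.isUnit, Matrix.mul_one, unMat_toMat]
    have h2 : toMat (splitEquiv σ (B, unMat (toMat A * toMat B))) = frameMat σ A * toMat B := by
      rw [← frameMat_graphCoord_mul σ (by rwa [topBlock_splitEquiv]), h1, topBlock_splitEquiv]
    rw [h1, h2, transpose_mul]
    have h3 : (toMat B)ᵀ * (frameMat σ A)ᵀ * g * (frameMat σ A * toMat B) =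
        (toMat B)ᵀ * ((frameMat σ A)ᵀ * g * frameMat σ A) * toMat B := by
      simp only [Matrix.mul_assoc]
    rw [h3]; ring
  have hH : Continuous fun A => (frameMat σ A)ᵀ * g * frameMat σ A :=
    (hframe.matrix_transpose.matrix_mul continuous_const).matrix_mul hframe
  have hBA : Continuous fun p : (Fin 2 × Fin 2 → ℝ) × (Fin n × Fin 2 → ℝ) =>
      ENNReal.ofReal (|(toMat p.1).det| ^ n) := by
    have := (continuous_toMat (κ := Fin 2)).matrix_det
    exact ENNReal.continuous_ofReal.comp (((this.comp continuous_fst).abs).pow n)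
  have hmeas : Measurable fun p : (Fin 2 × Fin 2 → ℝ) × (Fin n × Fin 2 → ℝ) =>
      ENNReal.ofReal (|(toMat p.1).det| ^ n) *
        w ((toMat p.1)ᵀ * ((frameMat σ p.2)ᵀ * g * frameMat σ p.2) * toMat p.1) := by
    refine hBA.measurable.mul (hw.comp ?_).measurable
    have h1 := continuous_toMat.comp (continuous_fst (X := Fin 2 × Fin 2 → ℝ)
      (Y := Fin n × Fin 2 → ℝ))
    exact (h1.matrix_transpose.matrix_mul (hH.comp continuous_snd)).matrix_mul h1
  rw [lintegral_congr_ae hinner, lintegral_lintegral_swap]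
  · have h1 : ∀ A, ∫⁻ B : Fin 2 × Fin 2 → ℝ, φ A * (ENNReal.ofReal (|(toMat B).det| ^ n) *
        w ((toMat B)ᵀ * ((frameMat σ A)ᵀ * g * frameMat σ A) * toMat B)) =
        frameConst n w * (φ A * ENNReal.ofReal
          ((√((frameMat σ A)ᵀ * g * frameMat σ A).det ^ (n + 2))⁻¹)) := fun A => by
      have hm2 := hmeas.comp (measurable_prodMk_right (y := A))
      simp only [Function.comp_def] at hm2
      rw [lintegral_const_mul _ hm2,
        lintegral_det_pow_mul (posDef_frameMat σ hg A)]
      ring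
    simp_rw [h1]
    refine lintegral_const_mul _ (hφ.mul ?_)
    have := hH.matrix_det.measurable
    fun_prop
  · exact ((hφ.comp measurable_snd).mul hmeas).aemeasurable

end Frames

/-! ### Gaussian averages over planes -/

section PlaneAverage

set_option linter.unusedSectionVars false

open Matrix

theorem stdGauss_eq_withDensity (κ : Type*) [Fintype κ] : stdGauss κ =
    volume.withDensity fun x => ENNReal.ofReal (∏ i, gaussianPDFReal 0 1 (x i)) := by
  refine Measure.pi_eq fun s hs => ?_
  have hint : ∀ i, Integrable (gaussianPDFReal 0 1) (volume.restrict (s i)) := fun i =>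
    (integrable_gaussianPDFReal 0 1).restrict
  rw [withDensity_apply _ (MeasurableSet.univ_pi hs), volume_pi, Measure.restrict_pi_pi,
    ← ofReal_integral_eq_lintegral_ofReal (Integrable.fintype_prod hint)
      (ae_of_all _ fun x => Finset.prod_nonneg fun i _ => gaussianPDFReal_nonneg 0 1 _),
    integral_fintype_prod_eq_prod, ENNReal.ofReal_prod_of_nonneg]
  · exact Finset.prod_congr rfl fun i _ => (gaussianReal_apply_eq_integral 0 one_ne_zero _).symm
  · exact fun i _ => integral_nonneg fun x => gaussianPDFReal_nonneg 0 1 x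

/-- The normalizing constant of the standard Gaussian density. -/
def gaussConst (κ : Type*) [Fintype κ] : ENNReal :=
  ENNReal.ofReal ((√(2 * Real.pi))⁻¹ ^ Fintype.card κ)

theorem lintegral_stdGauss {κ : Type*} [Fintype κ] (f : (κ → ℝ) → ENNReal) :
    ∫⁻ x, f x ∂stdGauss κ =
      gaussConst κ * ∫⁻ x, f x * ENNReal.ofReal (Real.exp (-(1 / 2) * ∑ i, x i ^ 2)) := by
  have hm : Measurable fun x : κ → ℝ => ENNReal.ofReal (∏ i, gaussianPDFReal 0 1 (x i)) :=
    (Finset.measurable_prod _ fun i _ =>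
      (measurable_gaussianPDFReal 0 1).comp (measurable_pi_apply i)).ennreal_ofReal
  rw [stdGauss_eq_withDensity, lintegral_withDensity_eq_lintegral_mul_non_measurable _ hm
    (ae_of_all _ fun _ => ENNReal.ofReal_lt_top), gaussConst,
    ← lintegral_const_mul' _ _ ENNReal.ofReal_ne_top]
  congr 1; funext x
  simp only [Pi.mul_apply, gaussianPDFReal_std, Finset.prod_mul_distrib, Finset.prod_const,
    Finset.card_univ, ← Real.exp_sum, ← Finset.mul_sum]
  rw [ENNReal.ofReal_mul (by positivity)]
  ring

/-- The weight `det(G)ᵏ exp(-tr(G)/2)`. -/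
def momentWeight (k : ℕ) (G : Matrix (Fin 2) (Fin 2) ℝ) : ENNReal :=
  ENNReal.ofReal (G.det ^ k * Real.exp (-(1 / 2) * G.trace))

theorem continuous_momentWeight (k : ℕ) : Continuous (momentWeight k) := by
  unfold momentWeight
  have h1 : Continuous fun G : Matrix (Fin 2) (Fin 2) ℝ => G.det := continuous_id.matrix_det
  have h2 : Continuous fun G : Matrix (Fin 2) (Fin 2) ℝ => G.trace := continuous_id.matrix_trace
  exact ENNReal.continuous_ofReal.comp ((h1.pow k).mul
    (Real.continuous_exp.comp (continuous_const.mul h2)))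

variable {ι : Type*} [Fintype ι] [DecidableEq ι] {n : ℕ} (σ : Fin 2 ⊕ Fin n ≃ ι)

theorem det_transpose_mul_toMat (Z : ι × Fin 2 → ℝ) : ((toMat Z)ᵀ * toMat Z).det = gramDet Z := by
  simp only [Matrix.det_fin_two, Matrix.mul_apply, Matrix.transpose_apply, toMat, Matrix.of_apply,
    gramDet, pow_two]
  have : ∑ i, Z (i, 1) * Z (i, 0) = ∑ i, Z (i, 0) * Z (i, 1) :=
    Finset.sum_congr rfl fun i _ => mul_comm _ _
  rw [this]

theorem trace_transpose_mul_toMat (Z : ι × Fin 2 → ℝ) :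
    ((toMat Z)ᵀ * toMat Z).trace = ∑ q, Z q ^ 2 := by
  simp only [Matrix.trace, Matrix.diag, Matrix.mul_apply, Matrix.transpose_apply, toMat,
    Matrix.of_apply, Fintype.sum_prod_type, pow_two]
  exact Finset.sum_comm

theorem momentWeight_gram (k : ℕ) (Z : ι × Fin 2 → ℝ) :
    momentWeight k ((toMat Z)ᵀ * (1 : Matrix ι ι ℝ) * toMat Z) =
      ENNReal.ofReal (gramDet Z ^ k) * ENNReal.ofReal (Real.exp (-(1 / 2) * ∑ q, Z q ^ 2)) := by
  rw [Matrix.mul_one, momentWeight, det_transpose_mul_toMat, trace_transpose_mul_toMat,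
    ENNReal.ofReal_mul (pow_nonneg (gramDet_nonneg Z) k)]

/-- The density of the invariant volume of the Grassmannian with respect to the metric `g` in graph
coordinates, up to the factor `det g`. -/
def frameDensity (g : Matrix ι ι ℝ) (A : Fin n × Fin 2 → ℝ) : ENNReal :=
  ENNReal.ofReal ((√((frameMat σ A)ᵀ * g * frameMat σ A).det ^ (n + 2))⁻¹)

theorem lintegral_graphCoord_eq {g : Matrix ι ι ℝ} (hg : g.PosDef)
    {φ : (Fin n × Fin 2 → ℝ) → ENNReal} (hφ : Measurable φ) (k : ℕ) :
    ∫⁻ Z : ι × Fin 2 → ℝ, φ (graphCoord σ Z) * momentWeight k ((toMat Z)ᵀ * g * toMat Z) =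
      frameConst n (momentWeight k) * ∫⁻ A, φ A * frameDensity σ g A :=
  lintegral_graphCoord σ hg hφ (continuous_momentWeight k)

theorem lintegral_graphCoord_mul_gramDet_pow {φ : (Fin n × Fin 2 → ℝ) → ENNReal}
    (hφ : Measurable φ) (k : ℕ) :
    ∫⁻ Z : ι × Fin 2 → ℝ, φ (graphCoord σ Z) * ENNReal.ofReal (gramDet Z ^ k)
        ∂stdGauss (ι × Fin 2) =
      gaussConst (ι × Fin 2) * (frameConst n (momentWeight k) * ∫⁻ A, φ A * frameDensity σ 1 A) := by
  rw [lintegral_stdGauss, ← lintegral_graphCoord_eq σ Matrix.PosDef.one hφ k]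
  congr 2; funext Z
  rw [momentWeight_gram, mul_assoc]

/-- The constant by which the Gaussian average over the planes differs from the invariant volume
of the Grassmannian, i.e. the reciprocal of the volume of `Gr₂ ℝ^ι`. -/
def planeConst (ι : Type*) [Fintype ι] (n : ℕ) : ENNReal :=
  gaussConst (ι × Fin 2) * frameConst n (momentWeight 0)

theorem planeConst_mul_eq_one : planeConst ι n * ∫⁻ A, frameDensity σ 1 A = 1 := by
  have := lintegral_graphCoord_mul_gramDet_pow σ (φ := fun _ => 1) measurable_const 0
  simp only [pow_zero, ENNReal.ofReal_one, mul_one, one_mul, lintegral_const, measure_univ] at this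
  rw [planeConst, this]; simp [mul_assoc]

theorem planeConst_ne_zero (σ : Fin 2 ⊕ Fin n ≃ ι) : planeConst ι n ≠ 0 := by
  intro h
  have := planeConst_mul_eq_one σ
  rw [h, zero_mul] at this
  exact zero_ne_one this

theorem planeConst_ne_top (σ : Fin 2 ⊕ Fin n ≃ ι) : planeConst ι n ≠ ⊤ := by
  intro h
  have h1 := planeConst_mul_eq_one σ
  rw [h, ENNReal.top_mul'] at h1
  split_ifs at h1 <;> simp at h1

/-- For a Gaussian pair of vectors, the spanned plane and the area of the spanned parallelogram are
independent. -/
theorem lintegral_graphCoord_mul_gramDet_pow_eq_mul {φ : (Fin n × Fin 2 → ℝ) → ENNReal}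
    (hφ : Measurable φ) (k : ℕ) :
    ∫⁻ Z : ι × Fin 2 → ℝ, φ (graphCoord σ Z) * ENNReal.ofReal (gramDet Z ^ k)
        ∂stdGauss (ι × Fin 2) =
      (∫⁻ Z : ι × Fin 2 → ℝ, φ (graphCoord σ Z) ∂stdGauss (ι × Fin 2)) *
        ∫⁻ Z : ι × Fin 2 → ℝ, ENNReal.ofReal (gramDet Z ^ k) ∂stdGauss (ι × Fin 2) := by
  have h0 := lintegral_graphCoord_mul_gramDet_pow σ hφ 0
  have h1 := lintegral_graphCoord_mul_gramDet_pow σ (φ := fun _ => 1) measurable_const k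
  simp only [pow_zero, ENNReal.ofReal_one, mul_one, one_mul] at h0 h1
  rw [lintegral_graphCoord_mul_gramDet_pow σ hφ, h0, h1]
  have h2 := planeConst_mul_eq_one σ
  generalize (∫⁻ A, frameDensity σ 1 A) = I at h2 ⊢
  generalize (∫⁻ A, φ A * frameDensity σ 1 A) = J
  rw [planeConst] at h2
  calc _ = (gaussConst (ι × Fin 2) * frameConst n (momentWeight 0) * I) *
        (gaussConst (ι × Fin 2) * (frameConst n (momentWeight k) * J)) := by rw [h2, one_mul]
    _ = _ := by ring

theorem ae_stdGauss_det_topBlock : ∀ᵐ Z ∂stdGauss (ι × Fin 2), (topBlock σ Z).det ≠ 0 := by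
  rw [stdGauss_eq_withDensity]
  exact (withDensity_absolutelyContinuous _ _).ae_le (ae_det_topBlock_ne_zero σ)

variable {V : Type*} [NormedAddCommGroup V] [InnerProductSpace ℝ V]

/-- The average of `F(X, Y)` over independent standard Gaussian vectors `X`, `Y`, in terms of an
arbitrary frame `E` with Gram matrix `g`, if `F(X, Y)` only depends on the plane spanned by `X` and
`Y`. -/
theorem lintegral_vec_eq_graphCoord (b : OrthonormalBasis ι ℝ V) {E : ι → V}
    (hE : LinearIndependent ℝ E) {F : V → V → ENNReal} {φ : (Fin n × Fin 2 → ℝ) → ENNReal}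
    (hφ : Measurable φ)
    (hF : ∀ Z : ι × Fin 2 → ℝ, (topBlock σ Z).det ≠ 0 →
      F (∑ i, Z (i, 0) • E i) (∑ i, Z (i, 1) • E i) = φ (graphCoord σ Z)) :
    ∫⁻ Z, F (vec b (col Z 0)) (vec b (col Z 1)) ∂stdGauss (ι × Fin 2) =
      planeConst ι n * (ENNReal.ofReal (Matrix.gram ℝ E).det *
        ∫⁻ A, φ A * frameDensity σ (Matrix.gram ℝ E) A) := by
  set g := Matrix.gram ℝ E with hg
  have hgp : g.PosDef := Matrix.posDef_gram_of_linearIndependent hE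
  -- The columns of `T` are the coordinates of the frame `E` in the basis `b`; the substitution of
  -- `T Z` for `Z` turns linear combinations of `b` into linear combinations of `E`.
  let T : Matrix ι ι ℝ := Matrix.of fun j i => inner ℝ (b j) (E i)
  have hT : Tᵀ * T = g := by
    ext i j
    simp only [Matrix.mul_apply, Matrix.transpose_apply, T, Matrix.of_apply, hg, Matrix.gram_apply]
    rw [← b.sum_inner_mul_inner]
    exact Finset.sum_congr rfl fun k _ => by rw [real_inner_comm]
  have hdet : T.det ^ 2 = g.det := by
    rw [← hT, Matrix.det_mul, Matrix.det_transpose, pow_two]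
  have hT0 : T.det ≠ 0 := fun h => hgp.det_pos.ne' (by rw [← hdet, h]; norm_num)
  have hvec : ∀ (Z : ι × Fin 2 → ℝ) a,
      vec b (col (unMat (T * toMat Z)) a) = ∑ i, Z (i, a) • E i := fun Z a => by
    have : ∀ i, E i = ∑ j, T j i • b j := fun i => (b.sum_repr' (E i)).symm
    simp_rw [vec, col, unMat, Matrix.mul_apply, this, Finset.sum_smul, Finset.smul_sum, smul_smul]
    rw [Finset.sum_comm]
    refine Finset.sum_congr rfl fun i _ => Finset.sum_congr rfl fun j _ => ?_
    rw [toMat, Matrix.of_apply, mul_comm]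
  rw [lintegral_stdGauss, ← lintegral_mul_left hT0, hdet, planeConst, mul_assoc]
  congr 1
  rw [mul_left_comm, ← lintegral_graphCoord_eq σ hgp hφ 0]
  congr 1
  refine lintegral_congr_ae ?_
  filter_upwards [ae_det_topBlock_ne_zero σ] with Z hZ
  rw [hvec, hvec, hF Z hZ]
  congr 1
  rw [← trace_transpose_mul_toMat, momentWeight, pow_zero, one_mul, toMat_unMat,
    Matrix.transpose_mul, ← hT]
  simp only [Matrix.mul_assoc]

end PlaneAverage

/-! ### Planes spanned by frames, and the moments of the sectional curvature -/

section FrameVec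

set_option linter.unusedSectionVars false

open Matrix

variable {ι : Type*} [Fintype ι] [DecidableEq ι] {n : ℕ} (σ : Fin 2 ⊕ Fin n ≃ ι)
  {V : Type*} [NormedAddCommGroup V] [InnerProductSpace ℝ V]

/-- The two linear combinations of the vectors `E` with coefficients in the columns of `Z`. -/
def frameVec (E : ι → V) (Z : ι × Fin 2 → ℝ) (a : Fin 2) : V := ∑ i, Z (i, a) • E i

theorem frameVec_basis (b : OrthonormalBasis ι ℝ V) (Z : ι × Fin 2 → ℝ) (a : Fin 2) :
    frameVec b Z a = vec b (col Z a) := rfl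

theorem frameVec_mul (E : ι → V) (N : Matrix ι (Fin 2) ℝ) (B : Matrix (Fin 2) (Fin 2) ℝ)
    (a : Fin 2) : frameVec E (unMat (N * B)) a = ∑ c, B c a • frameVec E (unMat N) c := by
  simp_rw [frameVec, unMat, Matrix.mul_apply, Finset.sum_smul, Finset.smul_sum, smul_smul]
  rw [Finset.sum_comm]
  exact Finset.sum_congr rfl fun i _ => Finset.sum_congr rfl fun j _ => by rw [mul_comm]

theorem span_frameVec_mul (E : ι → V) (N : Matrix ι (Fin 2) ℝ) {B : Matrix (Fin 2) (Fin 2) ℝ}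
    (hB : B.det ≠ 0) :
    Submodule.span ℝ (Set.range (frameVec E (unMat (N * B)))) =
      Submodule.span ℝ (Set.range (frameVec E (unMat N))) := by
  have key : ∀ (N : Matrix ι (Fin 2) ℝ) (B : Matrix (Fin 2) (Fin 2) ℝ),
      Submodule.span ℝ (Set.range (frameVec E (unMat (N * B)))) ≤
        Submodule.span ℝ (Set.range (frameVec E (unMat N))) := fun N B => by
    rw [Submodule.span_le]
    rintro _ ⟨a, rfl⟩
    rw [frameVec_mul]
    exact Submodule.sum_mem _ fun c _ => Submodule.smul_mem _ _ (Submodule.subset_span ⟨c, rfl⟩)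
  refine le_antisymm (key N B) ?_
  have h := key (N * B) B⁻¹
  rwa [Matrix.mul_assoc, mul_nonsing_inv _ hB.isUnit, Matrix.mul_one] at h

theorem linearIndependent_frameVec {E : ι → V} (hE : LinearIndependent ℝ E)
    (A : Fin n × Fin 2 → ℝ) : LinearIndependent ℝ (frameVec E (unMat (frameMat σ A))) := by
  rw [Fintype.linearIndependent_iff] at hE ⊢
  intro g hg a
  have h := hE (fun i => ∑ a, g a * frameMat σ A i a) (by
    rw [← hg]
    simp_rw [frameVec, unMat, Finset.sum_smul, Finset.smul_sum, smul_smul]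
    exact Finset.sum_comm) (σ (Sum.inl a))
  simpa [frameMat, Matrix.one_apply] using h

theorem range_fin_two {α : Type*} (f : Fin 2 → α) : Set.range f = {f 0, f 1} := by
  ext x; simp [Fin.exists_fin_two, eq_comm]

theorem finrank_span_frameVec {E : ι → V} (hE : LinearIndependent ℝ E)
    {Z : ι × Fin 2 → ℝ} (hZ : (topBlock σ Z).det ≠ 0) :
    Submodule.span ℝ (Set.range (frameVec E Z)) =
      Submodule.span ℝ (Set.range (frameVec E (unMat (frameMat σ (graphCoord σ Z))))) ∧
    Module.finrank ℝ (Submodule.span ℝ (Set.range (frameVec E Z))) = 2 := by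
  have h1 := span_frameVec_mul E (frameMat σ (graphCoord σ Z)) hZ
  rw [frameMat_graphCoord_mul σ hZ, unMat_toMat] at h1
  refine ⟨h1, ?_⟩
  rw [h1, finrank_span_eq_card (linearIndependent_frameVec σ hE _), Fintype.card_fin]

theorem gramDet_pos {Z : ι × Fin 2 → ℝ} (hZ : (topBlock σ Z).det ≠ 0) : 0 < gramDet Z := by
  have h1 := frameMat_graphCoord_mul σ hZ
  have h2 := (posDef_frameMat σ (Matrix.PosDef.one (n := ι) (R := ℝ)) (graphCoord σ Z)).det_pos
  rw [← det_transpose_mul_toMat, ← h1, Matrix.transpose_mul, Matrix.mul_assoc,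
    ← Matrix.mul_assoc _ _ (topBlock σ Z), Matrix.det_mul, Matrix.det_mul, Matrix.det_transpose]
  rw [Matrix.mul_one] at h2
  have := pow_pos (abs_pos.2 hZ) 2
  rw [sq_abs] at this
  nlinarith [mul_pos this h2]

theorem sectional_eq_of_span_eq [FiniteDimensional ℝ V] {R : V →ₗ[ℝ] V →ₗ[ℝ] V →ₗ[ℝ] V}
    (hR : R ∈ Kr V) {X Y : Fin 2 → V}
    (h : Submodule.span ℝ (Set.range X) = Submodule.span ℝ (Set.range Y))
    (h2 : Module.finrank ℝ (Submodule.span ℝ (Set.range X)) = 2) :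
    sectional R (X 0) (X 1) = sectional R (Y 0) (Y 1) := by
  rw [← sec_eq hR ⟨_, h2⟩ (X := X 0) (Y := X 1) (by rw [← range_fin_two]),
    ← sec_eq hR ⟨_, h2⟩ (X := Y 0) (Y := Y 1) (by rw [← range_fin_two]; exact h)]

theorem continuous_frameMat_elem (i : ι) (a : Fin 2) :
    Continuous fun A : Fin n × Fin 2 → ℝ => frameMat σ A i a := by
  obtain ⟨i, rfl⟩ := σ.surjective i
  rcases i with c | c
  · simp only [frameMat, Matrix.of_apply, Equiv.symm_apply_apply, Sum.elim_inl]; fun_prop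
  · simp only [frameMat, Matrix.of_apply, Equiv.symm_apply_apply, Sum.elim_inr]; fun_prop

theorem sectional_vec (b : OrthonormalBasis ι ℝ V) (R : V →ₗ[ℝ] V →ₗ[ℝ] V →ₗ[ℝ] V)
    (Z : ι × Fin 2 → ℝ) : sectional R (vec b (col Z 0)) (vec b (col Z 1)) =
      biquad R (vec b (col Z 0)) (vec b (col Z 1)) / gramDet Z := by
  rw [sectional, inner_vec_vec, inner_vec_vec, inner_vec_vec]
  simp only [gramDet, col, biquad, pow_two]

/-- `Ψ_k(R)` is the average of the `k`-th power of the sectional curvature.  The statement is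
shifted by a constant in order to deal with non-negative functions only. -/
theorem lintegral_sectional_pow [FiniteDimensional ℝ V] (b : OrthonormalBasis ι ℝ V)
    {R : V →ₗ[ℝ] V →ₗ[ℝ] V →ₗ[ℝ] V} (hR : R ∈ Kr V) (hι : 2 ≤ Fintype.card ι) {k : ℕ} {C : ℝ}
    (hC : ∀ X Y, |sectional R X Y ^ k| ≤ C) :
    ∫⁻ Z, ENNReal.ofReal (sectional R (vec b (col Z 0)) (vec b (col Z 1)) ^ k + C)
      ∂stdGauss (ι × Fin 2) = ENNReal.ofReal (Psi k R + C) ∧ 0 ≤ Psi k R + C := by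
  obtain ⟨n, ⟨σ⟩⟩ : ∃ n, Nonempty (Fin 2 ⊕ Fin n ≃ ι) := by
    refine ⟨Fintype.card ι - 2, ⟨Fintype.equivOfCardEq ?_⟩⟩
    simp only [Fintype.card_sum, Fintype.card_fin]
    omega
  let φ : (Fin n × Fin 2 → ℝ) → ENNReal := fun A =>
    ENNReal.ofReal (sectional R (vec b (col (unMat (frameMat σ A)) 0))
      (vec b (col (unMat (frameMat σ A)) 1)) ^ k + C)
  have hφ : Measurable φ := by
    have hc : ∀ i a, Measurable fun A : Fin n × Fin 2 → ℝ => frameMat σ A i a := fun i a =>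
      (continuous_frameMat_elem σ i a).measurable
    have h1 : Measurable fun A : Fin n × Fin 2 → ℝ =>
        sectional R (vec b (col (unMat (frameMat σ A)) 0))
          (vec b (col (unMat (frameMat σ A)) 1)) := by
      simp_rw [sectional_vec, biquad_vec, gramDet, col, unMat]
      fun_prop
    exact ((h1.pow_const k).add_const C).ennreal_ofReal
  have hae := ae_stdGauss_det_topBlock σ
  have hsec : ∀ Z : ι × Fin 2 → ℝ, (topBlock σ Z).det ≠ 0 →
      ENNReal.ofReal (sectional R (vec b (col Z 0)) (vec b (col Z 1)) ^ k + C) =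
        φ (graphCoord σ Z) := fun Z hZ => by
    obtain ⟨h1, h2⟩ := finrank_span_frameVec σ b.toBasis.linearIndependent hZ
    have := sectional_eq_of_span_eq hR h1 h2
    simp only [b.coe_toBasis, frameVec_basis] at this
    simp only [φ, this]
  have hpos : ∀ X Y, 0 ≤ sectional R X Y ^ k + C := fun X Y => by
    linarith [neg_abs_le (sectional R X Y ^ k), hC X Y]
  -- The numerator of the `k`-th power of the sectional curvature is `biquad ^ k`, the denominator is
  -- `gramDet ^ k`; the quotient depends on the plane only, hence is independent of `gramDet`.
  have key := lintegral_graphCoord_mul_gramDet_pow_eq_mul σ hφ k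
  have h1 : ∫⁻ Z : ι × Fin 2 → ℝ, φ (graphCoord σ Z) ∂stdGauss (ι × Fin 2) =
      ∫⁻ Z, ENNReal.ofReal (sectional R (vec b (col Z 0)) (vec b (col Z 1)) ^ k + C)
        ∂stdGauss (ι × Fin 2) := by
    refine lintegral_congr_ae ?_
    filter_upwards [hae] with Z hZ using (hsec Z hZ).symm
  have hI1 := integrable_biquad_pow b R k
  have hI2 := (integrable_gramDet_pow (ι := ι) k).const_mul C
  set D := ∫ Z : ι × Fin 2 → ℝ, gramDet Z ^ k ∂stdGauss (ι × Fin 2) with hD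
  have hDpos : 0 < D := integral_gramDet_pow_pos hι k
  have h2 : ∫⁻ Z : ι × Fin 2 → ℝ, φ (graphCoord σ Z) * ENNReal.ofReal (gramDet Z ^ k)
      ∂stdGauss (ι × Fin 2) = ENNReal.ofReal ((Psi k R + C) * D) ∧ 0 ≤ (Psi k R + C) * D := by
    have e1 : ∀ᵐ Z ∂stdGauss (ι × Fin 2),
        φ (graphCoord σ Z) * ENNReal.ofReal (gramDet Z ^ k) = ENNReal.ofReal
          (biquad R (vec b (col Z 0)) (vec b (col Z 1)) ^ k + C * gramDet Z ^ k) ∧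
        0 ≤ biquad R (vec b (col Z 0)) (vec b (col Z 1)) ^ k + C * gramDet Z ^ k := by
      filter_upwards [hae] with Z hZ
      have hg := gramDet_pos σ hZ
      have e : (sectional R (vec b (col Z 0)) (vec b (col Z 1)) ^ k + C) * gramDet Z ^ k =
          biquad R (vec b (col Z 0)) (vec b (col Z 1)) ^ k + C * gramDet Z ^ k := by
        rw [sectional_vec, div_pow, add_mul, div_mul_cancel₀ _ (pow_pos hg k).ne']
      rw [← hsec Z hZ, ← ENNReal.ofReal_mul (hpos _ _), e]
      refine ⟨rfl, ?_⟩
      rw [← e]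
      exact mul_nonneg (hpos _ _) (by positivity)
    have e2 : ∫ Z, (biquad R (vec b (col Z 0)) (vec b (col Z 1)) ^ k + C * gramDet Z ^ k)
        ∂stdGauss (ι × Fin 2) = (Psi k R + C) * D := by
      rw [integral_add hI1 hI2, integral_const_mul, Psi_eq_integral b hR, ← hD]
      field_simp
    rw [lintegral_congr_ae (e1.mono fun Z h => h.1), ← e2]
    exact ⟨(ofReal_integral_eq_lintegral_ofReal (hI1.add hI2) (e1.mono fun Z h => h.2)).symm,
      integral_nonneg_of_ae (e1.mono fun Z h => h.2)⟩
  have h3 : ∫⁻ Z : ι × Fin 2 → ℝ, ENNReal.ofReal (gramDet Z ^ k) ∂stdGauss (ι × Fin 2) =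
      ENNReal.ofReal D :=
    (ofReal_integral_eq_lintegral_ofReal (integrable_gramDet_pow k)
      (ae_of_all _ fun Z => pow_nonneg (gramDet_nonneg Z) k)).symm
  have h4 : 0 ≤ Psi k R + C := nonneg_of_mul_nonneg_left h2.2 hDpos
  refine ⟨?_, h4⟩
  rw [h1, h2.1, h3, ENNReal.ofReal_mul h4] at key
  exact ((ENNReal.mul_left_inj (by simpa using hDpos) ENNReal.ofReal_ne_top).1 key).symm

theorem abs_Psi_le [FiniteDimensional ℝ V] {R : V →ₗ[ℝ] V →ₗ[ℝ] V →ₗ[ℝ] V} (hR : R ∈ Kr V)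
    (hV : 2 ≤ Module.finrank ℝ V) {k : ℕ} {C : ℝ} (hC : ∀ X Y, |sectional R X Y ^ k| ≤ C) :
    |Psi k R| ≤ C := by
  obtain ⟨h1, h2⟩ := lintegral_sectional_pow (stdOrthonormalBasis ℝ V) hR (by simpa using hV) hC
  have hC0 : 0 ≤ C := (abs_nonneg _).trans (hC 0 0)
  rw [abs_le]
  refine ⟨by linarith, ?_⟩
  have h3 : ENNReal.ofReal (Psi k R + C) ≤ ENNReal.ofReal (C + C) := by
    rw [← h1]
    refine (lintegral_mono fun Z => ENNReal.ofReal_le_ofReal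
      (add_le_add_left ((le_abs_self _).trans (hC _ _)) C)).trans ?_
    simp
  have := (ENNReal.ofReal_le_ofReal_iff (by linarith)).1 h3
  linarith

end FrameVec

/-! ### Local Riemannian geometry on a vector space -/

section LocalGeometry

set_option synthInstance.maxHeartbeats 400000
set_option maxHeartbeats 1000000

variable {E : Type*} [NormedAddCommGroup E] [NormedSpace ℝ E]

/-- The curvature of the connection `∇_a b = ∂_a b + Γ(a, b)` on an open subset of `E`. -/
def localCurv (Γ : E → E →L[ℝ] E →L[ℝ] E) (x a b c : E) : E :=
  fderiv ℝ Γ x a b c - fderiv ℝ Γ x b a c + Γ x a (Γ x b c) - Γ x b (Γ x a c)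

theorem localCurv_antisymm (Γ : E → E →L[ℝ] E →L[ℝ] E) (x a b c : E) :
    localCurv Γ x a b c = -localCurv Γ x b a c := by
  unfold localCurv; abel

theorem hasFDerivAt_apply₂ {F G H : Type*} [NormedAddCommGroup F] [NormedSpace ℝ F]
    [NormedAddCommGroup G] [NormedSpace ℝ G] [NormedAddCommGroup H] [NormedSpace ℝ H]
    {Γ : E → G →L[ℝ] H →L[ℝ] F} {Γ' : E →L[ℝ] G →L[ℝ] H →L[ℝ] F} {x : E} (h : HasFDerivAt Γ Γ' x)
    (b : G) (c : H) : HasFDerivAt (fun y => Γ y b c) ((Γ'.flip b).flip c) x := by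
  have h1 := h.clm_apply (hasFDerivAt_const b x)
  have h2 := h1.clm_apply (hasFDerivAt_const c x)
  exact h2.congr_fderiv (by ext; simp)

theorem hasFDerivAt_apply₂' {F G H : Type*} [NormedAddCommGroup F] [NormedSpace ℝ F]
    [NormedAddCommGroup G] [NormedSpace ℝ G] [NormedAddCommGroup H] [NormedSpace ℝ H]
    {Γ : E → G →L[ℝ] H →L[ℝ] F} {Γ' : E →L[ℝ] G →L[ℝ] H →L[ℝ] F} {x : E} (h : HasFDerivAt Γ Γ' x)
    {b : E → G} {c : E → H} {b' : E →L[ℝ] G} {c' : E →L[ℝ] H} (hb : HasFDerivAt b b' x)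
    (hc : HasFDerivAt c c' x) : HasFDerivAt (fun y => Γ y (b y) (c y))
      ((Γ'.flip (b x)).flip (c x) + ((Γ x).flip (c x)).comp b' + (Γ x (b x)).comp c') x := by
  have h1 := h.clm_apply hb
  have h2 := h1.clm_apply hc
  exact h2.congr_fderiv (by ext; simp; abel)

theorem hasFDerivAt_apply₁ {F G : Type*} [NormedAddCommGroup F] [NormedSpace ℝ F]
    [NormedAddCommGroup G] [NormedSpace ℝ G] {Γ : E → G →L[ℝ] F} {Γ' : E →L[ℝ] G →L[ℝ] F} {x : E}
    (h : HasFDerivAt Γ Γ' x) (b : G) : HasFDerivAt (fun y => Γ y b) (Γ'.flip b) x := by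
  have h1 := h.clm_apply (hasFDerivAt_const b x)
  exact h1.congr_fderiv (by ext; simp)

theorem exists_hasFDerivAt_apply₃ {F G H K : Type*} [NormedAddCommGroup F] [NormedSpace ℝ F]
    [NormedAddCommGroup G] [NormedSpace ℝ G] [NormedAddCommGroup H] [NormedSpace ℝ H]
    [NormedAddCommGroup K] [NormedSpace ℝ K]
    {Γ : E → G →L[ℝ] H →L[ℝ] K →L[ℝ] F} {Γ' : E →L[ℝ] G →L[ℝ] H →L[ℝ] K →L[ℝ] F} {x : E}
    (h : HasFDerivAt Γ Γ' x) (b : G) (c : H) (d : K) :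
    ∃ L : E →L[ℝ] F, HasFDerivAt (fun y => Γ y b c d) L x ∧ ∀ a, L a = Γ' a b c d := by
  have h1 := hasFDerivAt_apply₁ (F := H →L[ℝ] K →L[ℝ] F) h b
  have h2 := hasFDerivAt_apply₂ h1 c d
  exact ⟨_, h2, fun a => by simp⟩

theorem fderiv_apply_eq_of_eventuallyEq {F : Type*} [NormedAddCommGroup F] [NormedSpace ℝ F]
    {f₁ f₂ : E → F} {L₁ L₂ : E →L[ℝ] F} {x : E} (h₁ : HasFDerivAt f₁ L₁ x)
    (h₂ : HasFDerivAt f₂ L₂ x) (h : f₁ =ᶠ[𝓝 x] f₂) (a : E) : L₁ a = L₂ a := by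
  rw [h₁.unique (h₂.congr_of_eventuallyEq h)]

theorem fderiv_symm_of_eventually {F : Type*} [NormedAddCommGroup F] [NormedSpace ℝ F]
    {Γ : E → E →L[ℝ] E →L[ℝ] F} {x : E} (hΓ : DifferentiableAt ℝ Γ x)
    (hs : ∀ᶠ y in 𝓝 x, ∀ a b, Γ y a b = Γ y b a) (a b c : E) :
    fderiv ℝ Γ x a b c = fderiv ℝ Γ x a c b := by
  have h1 := hasFDerivAt_apply₂ hΓ.hasFDerivAt
  have h2 := (h1 c b).congr_of_eventuallyEq (f₁ := fun y => Γ y b c)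
    (hs.mono fun y hy => hy b c)
  exact congrArg (fun L : E →L[ℝ] F => L a) ((h1 b c).unique h2)

/-- The first Bianchi identity of a torsion-free connection. -/
theorem localCurv_bianchi {Γ : E → E →L[ℝ] E →L[ℝ] E} {x : E} (hΓ : DifferentiableAt ℝ Γ x)
    (hs : ∀ᶠ y in 𝓝 x, ∀ a b, Γ y a b = Γ y b a) (a b c : E) :
    localCurv Γ x a b c + localCurv Γ x b c a + localCurv Γ x c a b = 0 := by
  have h := fderiv_symm_of_eventually hΓ hs
  have hx := hs.self_of_nhds
  unfold localCurv
  rw [h a b c, h b c a, h c a b, hx b c, hx a c, hx a b]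
  abel

/-- The derivative of the identity `∇g = 0`. -/
theorem deriv_compat {F : Type*} [NormedAddCommGroup F] [NormedSpace ℝ F]
    {g : E → E →L[ℝ] E →L[ℝ] F} {Γ : E → E →L[ℝ] E →L[ℝ] E} {x : E}
    {g' : E → E →L[ℝ] E →L[ℝ] E →L[ℝ] F} {g'' : E →L[ℝ] E →L[ℝ] E →L[ℝ] E →L[ℝ] F}
    {Γ' : E →L[ℝ] E →L[ℝ] E →L[ℝ] E}
    (hg : HasFDerivAt g (g' x) x) (hg' : HasFDerivAt g' g'' x) (hΓ : HasFDerivAt Γ Γ' x)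
    (hc : ∀ᶠ y in 𝓝 x, ∀ a b c, g' y a b c = g y (Γ y a b) c + g y b (Γ y a c)) (a b c d : E) :
    g'' a b c d = g' x a (Γ x b c) d + g x (Γ' a b c) d +
      (g' x a c (Γ x b d) + g x c (Γ' a b d)) := by
  obtain ⟨L, h1, hL⟩ := exists_hasFDerivAt_apply₃ hg' b c d
  have hΓ' := hasFDerivAt_apply₂ hΓ b
  have h2a := hasFDerivAt_apply₂' hg (hΓ' c) (hasFDerivAt_const d x)
  have h2b := hasFDerivAt_apply₂' hg (hasFDerivAt_const c x) (hΓ' d)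
  have h2 := h2a.add h2b
  have := fderiv_apply_eq_of_eventuallyEq h1 h2 (hc.mono fun y hy => hy b c d) a
  simp only [add_apply, ContinuousLinearMap.comp_apply, ContinuousLinearMap.flip_apply,
    zero_apply, map_zero, add_zero, hL] at this
  exact this

/-- The curvature of a connection that is compatible with the metric `g` is skew-symmetric. -/
theorem localCurv_skew {F : Type*} [NormedAddCommGroup F] [NormedSpace ℝ F]
    {g : E → E →L[ℝ] E →L[ℝ] F} {Γ : E → E →L[ℝ] E →L[ℝ] E} {x : E}
    (hg : ContDiffAt ℝ 2 g x) (hΓ : DifferentiableAt ℝ Γ x)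
    (hc : ∀ᶠ y in 𝓝 x, ∀ a b c, fderiv ℝ g y a b c = g y (Γ y a b) c + g y b (Γ y a c))
    (a b c d : E) : g x (localCurv Γ x a b c) d = -g x c (localCurv Γ x a b d) := by
  have hg1 : HasFDerivAt g (fderiv ℝ g x) x := (hg.differentiableAt (by norm_num)).hasFDerivAt
  have hg2 : HasFDerivAt (fderiv ℝ g) (fderiv ℝ (fderiv ℝ g) x) x :=
    ((hg.fderiv_right (m := 1) (by norm_num)).differentiableAt (by norm_num)).hasFDerivAt
  have hsymm : fderiv ℝ (fderiv ℝ g) x a b = fderiv ℝ (fderiv ℝ g) x b a := by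
    have := hg.isSymmSndFDerivAt (by simp)
    exact this a b
  have hx := hc.self_of_nhds
  have h1 := deriv_compat hg1 hg2 hΓ.hasFDerivAt hc a b c d
  have h2 := deriv_compat hg1 hg2 hΓ.hasFDerivAt hc b a c d
  rw [hsymm, h2] at h1
  simp only [hx] at h1
  unfold localCurv
  rw [← sub_eq_zero] at h1 ⊢
  rw [← neg_eq_zero, ← h1]
  simp only [map_add, map_sub, add_apply, sub_apply]
  abel

/-- The Koszul formula, which determines the Levi-Civita connection `Γ` of the metric `g`. -/
def Koszul (g : E → E →L[ℝ] E →L[ℝ] ℝ) (Γ : E → E →L[ℝ] E →L[ℝ] E) (x : E) : Prop :=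
  ∀ a b c, 2 * g x (Γ x a b) c = fderiv ℝ g x a b c + fderiv ℝ g x b a c - fderiv ℝ g x c a b

/-- The Levi-Civita connection is compatible with the metric. -/
theorem Koszul.compat {g : E → E →L[ℝ] E →L[ℝ] ℝ} {Γ : E → E →L[ℝ] E →L[ℝ] E} {x : E}
    (h : Koszul g Γ x) (hg : DifferentiableAt ℝ g x)
    (hs : ∀ᶠ y in 𝓝 x, ∀ a b, g y a b = g y b a) (a b c : E) :
    fderiv ℝ g x a b c = g x (Γ x a b) c + g x b (Γ x a c) := by
  have h1 := h a b c
  have h2 := h a c b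
  have hs' := fderiv_symm_of_eventually hg hs
  rw [hs.self_of_nhds b]
  have := hs' a c b
  have := hs' b a c
  have := hs' c a b
  linarith

/-- The Levi-Civita connection is torsion-free. -/
theorem Koszul.symm {g : E → E →L[ℝ] E →L[ℝ] ℝ} {Γ : E → E →L[ℝ] E →L[ℝ] E} {x : E}
    (h : Koszul g Γ x) (hg : DifferentiableAt ℝ g x)
    (hs : ∀ᶠ y in 𝓝 x, ∀ a b, g y a b = g y b a)
    (hn : ∀ v, (∀ c, g x v c = 0) → v = 0) (a b : E) : Γ x a b = Γ x b a := by
  rw [← sub_eq_zero]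
  refine hn _ fun c => ?_
  have h1 := h a b c
  have h2 := h b a c
  have := fderiv_symm_of_eventually hg hs c a b
  rw [map_sub, sub_apply]
  linarith

/-- The derivative of the pullback of a bilinear form. -/
theorem fderiv_pullback {F : Type*} [NormedAddCommGroup F] [NormedSpace ℝ F]
    {g g' : E → E →L[ℝ] E →L[ℝ] F} {τ : E → E} {x : E} (hτ : ContDiffAt ℝ 2 τ x)
    (hg : DifferentiableAt ℝ g x) (hg' : DifferentiableAt ℝ g' (τ x))
    (hiso : ∀ᶠ y in 𝓝 x, ∀ a b, g y a b = g' (τ y) (fderiv ℝ τ y a) (fderiv ℝ τ y b)) (c a b : E) :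
    fderiv ℝ g x c a b =
      fderiv ℝ g' (τ x) (fderiv ℝ τ x c) (fderiv ℝ τ x a) (fderiv ℝ τ x b) +
      g' (τ x) (fderiv ℝ (fderiv ℝ τ) x c a) (fderiv ℝ τ x b) +
      g' (τ x) (fderiv ℝ τ x a) (fderiv ℝ (fderiv ℝ τ) x c b) := by
  have hτ1 : HasFDerivAt τ (fderiv ℝ τ x) x := (hτ.differentiableAt (by norm_num)).hasFDerivAt
  have hτ2 : HasFDerivAt (fderiv ℝ τ) (fderiv ℝ (fderiv ℝ τ) x) x :=
    ((hτ.fderiv_right (m := 1) (by norm_num)).differentiableAt (by norm_num)).hasFDerivAt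
  have h1 := hasFDerivAt_apply₂ hg.hasFDerivAt a b
  have hτa := hasFDerivAt_apply₁ hτ2
  have h0 : HasFDerivAt (fun y => g' (τ y)) ((fderiv ℝ g' (τ x)).comp (fderiv ℝ τ x)) x :=
    HasFDerivAt.comp x (g := g') hg'.hasFDerivAt hτ1
  have h2 := hasFDerivAt_apply₂' h0 (hτa a) (hτa b)
  have := fderiv_apply_eq_of_eventuallyEq h1 h2 (hiso.mono fun y hy => hy a b) c
  simp only [add_apply, ContinuousLinearMap.comp_apply, ContinuousLinearMap.flip_apply]
    at this
  rw [this]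

/-- The transformation law of the Levi-Civita connection under a local isometry `τ`. -/
theorem Koszul.transform {g g' : E → E →L[ℝ] E →L[ℝ] ℝ} {Γ Γ' : E → E →L[ℝ] E →L[ℝ] E} {τ : E → E}
    {x : E} (h : Koszul g Γ x) (h' : Koszul g' Γ' (τ x)) (hτ : ContDiffAt ℝ 2 τ x)
    (hg : DifferentiableAt ℝ g x) (hg' : DifferentiableAt ℝ g' (τ x))
    (hs : ∀ᶠ y in 𝓝 (τ x), ∀ a b, g' y a b = g' y b a)
    (hn : ∀ v, (∀ c, g' (τ x) v c = 0) → v = 0)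
    (hsurj : Function.Surjective (fderiv ℝ τ x))
    (hiso : ∀ᶠ y in 𝓝 x, ∀ a b, g y a b = g' (τ y) (fderiv ℝ τ y a) (fderiv ℝ τ y b)) (a b : E) :
    fderiv ℝ τ x (Γ x a b) =
      fderiv ℝ (fderiv ℝ τ) x a b + Γ' (τ x) (fderiv ℝ τ x a) (fderiv ℝ τ x b) := by
  set T := fderiv ℝ τ x with hT
  set D2 := fderiv ℝ (fderiv ℝ τ) x with hD2
  have hsymm : ∀ a b, D2 a b = D2 b a := by
    have := hτ.isSymmSndFDerivAt (by simp)
    exact fun a b => this a b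
  have hsx := hs.self_of_nhds
  have hD := fderiv_pullback hτ hg hg' hiso
  rw [← sub_eq_zero]
  refine hn _ fun c' => ?_
  obtain ⟨c, rfl⟩ := hsurj c'
  have h1 := h a b c
  have h2 := h' (T a) (T b) (T c)
  have h3 := hiso.self_of_nhds (Γ x a b) c
  rw [hD, hD, hD, h3] at h1
  rw [hsymm b a, hsymm c a, hsymm c b, hsx (T b), hsx (T a) (D2 b c)] at h1
  simp only [map_sub, map_add, sub_apply, add_apply]
  linarith

/-- Naturality of the curvature under a local diffeomorphism `τ` relating the connections. -/
theorem localCurv_transform {Γ Γ' : E → E →L[ℝ] E →L[ℝ] E} {τ : E → E} {x : E}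
    (hτ : ContDiffAt ℝ 3 τ x) (hΓ : DifferentiableAt ℝ Γ x) (hΓ' : DifferentiableAt ℝ Γ' (τ x))
    (h : ∀ᶠ y in 𝓝 x, ∀ a b, fderiv ℝ τ y (Γ y a b) =
      fderiv ℝ (fderiv ℝ τ) y a b + Γ' (τ y) (fderiv ℝ τ y a) (fderiv ℝ τ y b)) (a b c : E) :
    fderiv ℝ τ x (localCurv Γ x a b c) =
      localCurv Γ' (τ x) (fderiv ℝ τ x a) (fderiv ℝ τ x b) (fderiv ℝ τ x c) := by
  have hx := h.self_of_nhds
  have hτ1 : HasFDerivAt τ (fderiv ℝ τ x) x := (hτ.differentiableAt (by norm_num)).hasFDerivAt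
  have hc1 := hτ.fderiv_right (m := 2) (by norm_num)
  have hτ2 : HasFDerivAt (fderiv ℝ τ) (fderiv ℝ (fderiv ℝ τ) x) x :=
    (hc1.differentiableAt (by norm_num)).hasFDerivAt
  have hτ3 : HasFDerivAt (fderiv ℝ (fderiv ℝ τ)) (fderiv ℝ (fderiv ℝ (fderiv ℝ τ)) x) x :=
    ((hc1.fderiv_right (m := 1) (by norm_num)).differentiableAt (by norm_num)).hasFDerivAt
  set T := fderiv ℝ τ x with hT
  set D2 := fderiv ℝ (fderiv ℝ τ) x with hD2
  set D3 := fderiv ℝ (fderiv ℝ (fderiv ℝ τ)) x with hD3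
  have hsymm : ∀ a b, D2 a b = D2 b a := by
    have := (hτ.of_le (m := 2) (by norm_num)).isSymmSndFDerivAt (by simp)
    exact fun a b => this a b
  have hsymm3 : ∀ a b, D3 a b = D3 b a := by
    have := hc1.isSymmSndFDerivAt (by simp)
    exact fun a b => this a b
  -- The derivative of the transformation law of the connections.  Its third-order term drops out
  -- after antisymmetrization in `a` and `b`.
  have key : ∀ a b c, D2 a (Γ x b c) + T (fderiv ℝ Γ x a b c) = D3 a b c +
      (fderiv ℝ Γ' (τ x) (T a) (T b) (T c) + Γ' (τ x) (D2 a b) (T c) +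
        Γ' (τ x) (T b) (D2 a c)) := fun a b c => by
    have hΓb := hasFDerivAt_apply₂ hΓ.hasFDerivAt b c
    have h1 := hτ2.clm_apply hΓb
    have hτa := hasFDerivAt_apply₁ hτ2
    have h0 : HasFDerivAt (fun y => Γ' (τ y)) ((fderiv ℝ Γ' (τ x)).comp T) x :=
      HasFDerivAt.comp x (g := Γ') hΓ'.hasFDerivAt hτ1
    have h2 := (hasFDerivAt_apply₂ hτ3 b c).add
      (hasFDerivAt_apply₂' h0 (hτa b) (hτa c))
    have := fderiv_apply_eq_of_eventuallyEq h1 h2 (h.mono fun y hy => hy b c) a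
    simp only [add_apply, ContinuousLinearMap.comp_apply, ContinuousLinearMap.flip_apply]
      at this
    rw [add_comm, this]
  have e1 := key a b c
  have e2 := key b a c
  have hD : ∀ a b, D2 a b = T (Γ x a b) - Γ' (τ x) (T a) (T b) := fun a b => by
    rw [hx a b]; abel
  have e3 : T (fderiv ℝ Γ x a b c) - T (fderiv ℝ Γ x b a c) =
      (fderiv ℝ Γ' (τ x) (T a) (T b) (T c) + Γ' (τ x) (T b) (D2 a c)) -
      (fderiv ℝ Γ' (τ x) (T b) (T a) (T c) + Γ' (τ x) (T a) (D2 b c)) -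
      (D2 a (Γ x b c) - D2 b (Γ x a c)) := by
    rw [← eq_sub_iff_add_eq'] at e1 e2
    rw [e1, e2, hsymm3 b a, hsymm b a]
    abel
  unfold localCurv
  simp only [map_add, map_sub]
  rw [e3]
  simp only [hD, map_sub]
  abel

end LocalGeometry

/-! ### Coordinate frames and transition maps -/

section Charts

set_option linter.unusedSectionVars false

variable {m : ℕ} {M : Type*} [TopologicalSpace M] [ChartedSpace (Coord m) M]
  [IsManifold (𝓡 m) ∞ M] {e e' : OpenPartialHomeomorph M (Coord m)}

/-- The differential of a chart as a linear isomorphism. -/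
def chartEquiv (he : e ∈ atlas (Coord m) M) {q : M} (hq : q ∈ e.source) :
    TangentSpace (𝓡 m) q ≃L[ℝ] Coord m :=
  (mdifferentiable_of_mem_atlas (I := 𝓡 m) he).mfderiv hq

theorem chartEquiv_apply (he : e ∈ atlas (Coord m) M) {q : M} (hq : q ∈ e.source)
    (v : TangentSpace (𝓡 m) q) : chartEquiv he hq v = chartD e q v := rfl

theorem chartD_inverse (he : e ∈ atlas (Coord m) M) {q : M} (hq : q ∈ e.source)
    (v : Coord m) : (chartD e q).inverse v = (chartEquiv he hq).symm v := by
  have h1 : ((chartEquiv he hq : TangentSpace (𝓡 m) q →L[ℝ] Coord m)) = chartD e q := rfl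
  rw [← h1, ContinuousLinearMap.inverse_equiv]
  rfl

theorem coordVec_eq (he : e ∈ atlas (Coord m) M) {q : M} (hq : q ∈ e.source) (i : Fin m) :
    coordVec e q i = (chartEquiv he hq).symm (EuclideanSpace.single i 1) :=
  chartD_inverse he hq _

theorem chartD_coordVec (he : e ∈ atlas (Coord m) M) {q : M} (hq : q ∈ e.source) (i : Fin m) :
    chartD e q (coordVec e q i) = EuclideanSpace.single i 1 := by
  rw [coordVec_eq he hq, ← chartEquiv_apply he hq, ContinuousLinearEquiv.apply_symm_apply]

theorem sum_smul_single (u : Coord m) :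
    ∑ i, u i • (EuclideanSpace.single i 1 : Coord m) = u := by
  ext j; simp [Pi.single_apply]

theorem chartEquiv_symm_eq_sum (he : e ∈ atlas (Coord m) M) {q : M} (hq : q ∈ e.source)
    (u : Coord m) : (chartEquiv he hq).symm u = ∑ i, u i • coordVec e q i := by
  conv_lhs => rw [← sum_smul_single u]
  simp only [map_sum, map_smul, coordVec_eq he hq]

theorem sum_coordForm_smul (he : e ∈ atlas (Coord m) M) {q : M} (hq : q ∈ e.source)
    (v : TangentSpace (𝓡 m) q) : ∑ i, coordForm e q i v • coordVec e q i = v := by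
  rw [← (chartEquiv he hq).symm_apply_apply v, chartEquiv_symm_eq_sum he hq]
  congr 1
  funext i
  rw [← chartEquiv_symm_eq_sum he hq, ContinuousLinearEquiv.symm_apply_apply]
  rfl

theorem mfderiv_symm_single (he : e ∈ atlas (Coord m) M) {x : Coord m} (hx : x ∈ e.target)
    (u : Coord m) : mfderiv (𝓡 m) (𝓡 m) e.symm x u =
      (chartEquiv he (e.map_target hx)).symm u := by
  have h := (mdifferentiable_of_mem_atlas (I := 𝓡 m) he).comp_symm_deriv hx
  have h1 := congrArg (fun L => L u) h
  rw [ContinuousLinearEquiv.eq_symm_apply]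
  exact h1

/-- The transition map between two charts. -/
def trans (e e' : OpenPartialHomeomorph M (Coord m)) : OpenPartialHomeomorph (Coord m) (Coord m) :=
  e.symm.trans e'

theorem trans_source (e e' : OpenPartialHomeomorph M (Coord m)) :
    (trans e e').source = e.target ∩ e.symm ⁻¹' e'.source := by
  simp [trans]

theorem contDiffOn_trans (he : e ∈ atlas (Coord m) M) (he' : e' ∈ atlas (Coord m) M) :
    ContDiffOn ℝ ∞ (trans e e') (trans e e').source := by
  have h := (contDiffGroupoid ∞ (𝓡 m)).compatible he he'
  rw [contDiffGroupoid, mem_groupoid_of_pregroupoid] at h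
  have := h.1
  simpa [contDiffPregroupoid, trans] using this

theorem contDiffAt_trans (he : e ∈ atlas (Coord m) M) (he' : e' ∈ atlas (Coord m) M) {q : M}
    (hq : q ∈ e.source) (hq' : q ∈ e'.source) : ContDiffAt ℝ ∞ (trans e e') (e q) := by
  refine (contDiffOn_trans he he').contDiffAt ((trans e e').open_source.mem_nhds ?_)
  rw [trans_source]
  exact ⟨e.map_source hq, by rwa [Set.mem_preimage, e.left_inv hq]⟩

theorem trans_apply {q : M} (hq : q ∈ e.source) : trans e e' (e q) = e' q := by
  simp [trans, e.left_inv hq]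

theorem chartD_eq_fderiv_trans (he : e ∈ atlas (Coord m) M) (he' : e' ∈ atlas (Coord m) M) {q : M}
    (hq : q ∈ e.source) (hq' : q ∈ e'.source) (v : TangentSpace (𝓡 m) q) :
    chartD e' q v = fderiv ℝ (trans e e') (e q) (chartD e q v) := by
  have h1 : (trans e e') ∘ e =ᶠ[𝓝 q] e' := by
    filter_upwards [e.open_source.mem_nhds hq] with p hp
    exact trans_apply hp
  have h2 : MDifferentiableAt (𝓡 m) (𝓡 m) e q :=
    (mdifferentiable_of_mem_atlas (I := 𝓡 m) he).mdifferentiableAt hq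
  have h3 : MDifferentiableAt (𝓡 m) (𝓡 m) (trans e e') (e q) :=
    ((contDiffAt_trans he he' hq hq').differentiableAt (by simp)).mdifferentiableAt
  have h4 := mfderiv_comp q h3 h2
  have h5 := h1.mfderiv_eq (I := 𝓡 m) (I' := 𝓡 m)
  rw [chartD, ← h5, h4]
  rw [mfderiv_eq_fderiv]
  rfl

end Charts

section Metric

set_option linter.unusedSectionVars false

variable {m : ℕ} {M : Type*} [TopologicalSpace M] [ChartedSpace (Coord m) M]
  [IsManifold (𝓡 m) ∞ M] {e e' : OpenPartialHomeomorph M (Coord m)}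
  [RiemannianBundle (fun x : M => TangentSpace (𝓡 m) x)]

theorem posDef_metricCoeff (he : e ∈ atlas (Coord m) M) {x : Coord m} (hx : x ∈ e.target) :
    (metricCoeff e x).PosDef :=
  Matrix.posDef_gram_of_linearIndependent (linearIndependent_coordVec he (e.map_target hx))

variable [IsContMDiffRiemannianBundle (𝓡 m) ∞ (Coord m) (fun x : M => TangentSpace (𝓡 m) x)]

theorem contDiffOn_metricCoeff (he : e ∈ atlas (Coord m) M) (i j : Fin m) :
    ContDiffOn ℝ ∞ (fun x => metricCoeff e x i j) e.target := by
  have hsymm : ContMDiffOn (𝓡 m) (𝓡 m) ∞ e.symm e.target :=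
    contMDiffOn_symm_of_mem_maximalAtlas (IsManifold.subset_maximalAtlas he)
  have htan := hsymm.contMDiffOn_tangentMapWithin (m := ∞) (by simp)
    e.open_target.uniqueMDiffOn
  have hsec : ∀ i : Fin m, ContMDiffOn (𝓡 m) ((𝓡 m).prod 𝓘(ℝ, Coord m)) ∞
      (fun x : Coord m => (⟨e.symm x, coordVec e (e.symm x) i⟩ :
        Bundle.TotalSpace (Coord m) (fun q : M => TangentSpace (𝓡 m) q))) e.target := fun i => by
    have hc : ContMDiff (𝓡 m) ((𝓡 m).prod 𝓘(ℝ, Coord m)) ∞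
        (fun x : Coord m => (⟨x, (EuclideanSpace.single i 1 : Coord m)⟩ :
          Bundle.TotalSpace (Coord m) (fun q : Coord m => TangentSpace (𝓡 m) q))) := by
      exact contMDiff_vectorSpace_iff_contDiff.2 contDiff_const
    have h := htan.comp hc.contMDiffOn (s := e.target) fun x hx => hx
    refine h.congr fun x hx => ?_
    simp only [Function.comp, tangentMapWithin]
    rw [mfderivWithin_of_isOpen e.open_target hx, mfderiv_symm_single he hx, coordVec_eq he]
  have := (hsec i).inner_bundle (hsec j)
  exact this.contDiffOn

end Metric

/-! ### The curvature tensor in charts -/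

section Bilin

variable {m : ℕ} {F : Type*} [NormedAddCommGroup F] [NormedSpace ℝ F]

/-- The bilinear map on `ℝᵐ` with prescribed values on the standard basis. -/
def bilin (c : Fin m → Fin m → F) : Coord m →L[ℝ] Coord m →L[ℝ] F :=
  ∑ i, ∑ j, (EuclideanSpace.proj i : Coord m →L[ℝ] ℝ).smulRight
    ((EuclideanSpace.proj j : Coord m →L[ℝ] ℝ).smulRight (c i j))

theorem bilin_apply (c : Fin m → Fin m → F) (u v : Coord m) :
    bilin c u v = ∑ i, ∑ j, u i • v j • c i j := by
  simp [bilin]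

theorem bilin_single (c : Fin m → Fin m → F) (i j : Fin m) :
    bilin c (EuclideanSpace.single i 1) (EuclideanSpace.single j 1) = c i j := by
  rw [bilin_apply, Finset.sum_eq_single i (fun a _ ha => by simp [ha]) (by simp),
    Finset.sum_eq_single j (fun a _ ha => by simp [ha]) (by simp)]
  simp

theorem contDiffOn_bilin {E : Type*} [NormedAddCommGroup E] [NormedSpace ℝ E] {s : Set E}
    {n : WithTop ℕ∞} {c : Fin m → Fin m → E → F} (hc : ∀ i j, ContDiffOn ℝ n (c i j) s) :
    ContDiffOn ℝ n (fun x => bilin fun i j => c i j x) s := by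
  unfold bilin
  refine ContDiffOn.sum fun i _ => ContDiffOn.sum fun j _ => ?_
  exact contDiffOn_const.smulRight (contDiffOn_const.smulRight (hc i j))

theorem fderiv_apply₂ {E : Type*} [NormedAddCommGroup E] [NormedSpace ℝ E]
    {G H : Type*} [NormedAddCommGroup G] [NormedSpace ℝ G] [NormedAddCommGroup H] [NormedSpace ℝ H]
    {Γ : E → G →L[ℝ] H →L[ℝ] F} {x : E} (h : DifferentiableAt ℝ Γ x) (a : E) (b : G) (c : H) :
    fderiv ℝ Γ x a b c = fderiv ℝ (fun y => Γ y b c) x a := by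
  rw [(hasFDerivAt_apply₂ h.hasFDerivAt b c).fderiv]
  rfl

theorem eq_zero_of_single {T : Coord m → F} (hadd : ∀ u v, T (u + v) = T u + T v)
    (hsmul : ∀ (r : ℝ) u, T (r • u) = r • T u) (h : ∀ i, T (EuclideanSpace.single i 1) = 0)
    (u : Coord m) : T u = 0 := by
  let L : Coord m →ₗ[ℝ] F := ⟨⟨T, hadd⟩, hsmul⟩
  have hL : ∀ u, T u = L u := fun _ => rfl
  rw [hL, ← sum_smul_single u, map_sum]
  exact Finset.sum_eq_zero fun i _ => by rw [map_smul, ← hL, h, smul_zero]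

end Bilin

section Conn

set_option synthInstance.maxHeartbeats 400000
set_option maxHeartbeats 1000000

set_option linter.unusedSectionVars false

variable {m : ℕ} {M : Type*} [TopologicalSpace M] [ChartedSpace (Coord m) M]
  [IsManifold (𝓡 m) ∞ M] {e e' : OpenPartialHomeomorph M (Coord m)}
  [RiemannianBundle (fun x : M => TangentSpace (𝓡 m) x)]

/-- The metric in a chart as a field of bilinear forms. -/
def metricForm (e : OpenPartialHomeomorph M (Coord m)) (x : Coord m) :
    Coord m →L[ℝ] Coord m →L[ℝ] ℝ := bilin fun i j => metricCoeff e x i j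

/-- The Christoffel symbols in a chart as a field of bilinear maps. -/
def connForm (e : OpenPartialHomeomorph M (Coord m)) (x : Coord m) :
    Coord m →L[ℝ] Coord m →L[ℝ] Coord m :=
  bilin fun i j => WithLp.toLp 2 fun k => christoffel e k i j x

theorem metricForm_apply (he : e ∈ atlas (Coord m) M) {x : Coord m} (hx : x ∈ e.target)
    (u v : Coord m) : metricForm e x u v = inner ℝ ((chartEquiv he (e.map_target hx)).symm u)
      ((chartEquiv he (e.map_target hx)).symm v) := by
  rw [chartEquiv_symm_eq_sum, chartEquiv_symm_eq_sum, metricForm, bilin_apply]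
  simp only [sum_inner, inner_sum, inner_smul_left, inner_smul_right, conj_trivial, smul_eq_mul,
    metricCoeff, Matrix.of_apply, Finset.mul_sum]
  rw [Finset.sum_comm]
  exact Finset.sum_congr rfl fun i _ => Finset.sum_congr rfl fun j _ => by ring

theorem metricForm_symm (e : OpenPartialHomeomorph M (Coord m)) (x u v : Coord m) :
    metricForm e x u v = metricForm e x v u := by
  rw [metricForm, bilin_apply, bilin_apply, Finset.sum_comm]
  refine Finset.sum_congr rfl fun i _ => Finset.sum_congr rfl fun j _ => ?_
  simp only [metricCoeff, Matrix.of_apply, smul_eq_mul]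
  rw [real_inner_comm]; ring

theorem metricForm_nondeg (he : e ∈ atlas (Coord m) M) {x : Coord m} (hx : x ∈ e.target)
    (v : Coord m) (h : ∀ c, metricForm e x v c = 0) : v = 0 := by
  have := h v
  rw [metricForm_apply he hx, inner_self_eq_zero] at this
  simpa using this

theorem metricForm_chartD (he : e ∈ atlas (Coord m) M) {p : M} (hp : p ∈ e.source)
    (X Y : TangentSpace (𝓡 m) p) :
    metricForm e (e p) (chartD e p X) (chartD e p Y) = inner ℝ X Y := by
  have h1 : ∀ X : TangentSpace (𝓡 m) p, X = ∑ i, (chartD e p X) i • coordVec e p i := fun X =>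
    (sum_coordForm_smul he hp X).symm
  have h2 : ∀ i j, metricCoeff e (e p) i j = inner ℝ (coordVec e p i) (coordVec e p j) :=
    fun i j => by
      rw [metricCoeff, Matrix.of_apply, e.left_inv hp]
  conv_rhs => rw [h1 X, h1 Y]
  rw [metricForm, bilin_apply]
  simp only [sum_inner, inner_sum, inner_smul_left, inner_smul_right, conj_trivial, smul_eq_mul,
    h2, Finset.mul_sum]
  rw [Finset.sum_comm]
  exact Finset.sum_congr rfl fun i _ => Finset.sum_congr rfl fun j _ => by ring

theorem metricForm_trans (he : e ∈ atlas (Coord m) M) (he' : e' ∈ atlas (Coord m) M)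
    {x : Coord m} (hx : x ∈ (trans e e').source) (u v : Coord m) :
    metricForm e x u v = metricForm e' (trans e e' x) (fderiv ℝ (trans e e') x u)
      (fderiv ℝ (trans e e') x v) := by
  rw [trans_source] at hx
  obtain ⟨q, hq, rfl⟩ : ∃ q ∈ e.source, e q = x := ⟨e.symm x, e.map_target hx.1, e.right_inv hx.1⟩
  have hq' : q ∈ e'.source := by have := hx.2; rwa [Set.mem_preimage, e.left_inv hq] at this
  have h2 : ∀ u : Coord m, u = chartD e q ((chartEquiv he hq).symm u) := fun u => by
    rw [← chartEquiv_apply he hq, ContinuousLinearEquiv.apply_symm_apply]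
  rw [h2 u, h2 v, metricForm_chartD he hq, ← chartD_eq_fderiv_trans he he' hq hq',
    ← chartD_eq_fderiv_trans he he' hq hq', trans_apply hq, metricForm_chartD he' hq']

variable [IsContMDiffRiemannianBundle (𝓡 m) ∞ (Coord m) (fun x : M => TangentSpace (𝓡 m) x)]

theorem contDiffOn_metricForm (he : e ∈ atlas (Coord m) M) :
    ContDiffOn ℝ ∞ (metricForm e) e.target :=
  contDiffOn_bilin fun i j => contDiffOn_metricCoeff he i j

theorem contDiffOn_partialD {f : Coord m → ℝ} {s : Set (Coord m)} (hs : IsOpen s)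
    (hf : ContDiffOn ℝ ∞ f s) (i : Fin m) : ContDiffOn ℝ ∞ (partialD i f) s :=
  (hf.fderiv_of_isOpen hs (m := ∞) (by simp)).clm_apply contDiffOn_const

theorem contDiffOn_det {E κ : Type*} [NormedAddCommGroup E] [NormedSpace ℝ E] [Fintype κ]
    [DecidableEq κ] {s : Set E} {n : WithTop ℕ∞} {A : E → Matrix κ κ ℝ}
    (hA : ∀ i j, ContDiffOn ℝ n (fun x => A x i j) s) : ContDiffOn ℝ n (fun x => (A x).det) s := by
  simp_rw [Matrix.det_apply']
  exact ContDiffOn.sum fun σ _ => contDiffOn_const.mul (contDiffOn_prod fun i _ => hA _ _)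

theorem contDiffOn_inv {E κ : Type*} [NormedAddCommGroup E] [NormedSpace ℝ E] [Fintype κ]
    [DecidableEq κ] {s : Set E} {n : WithTop ℕ∞} {A : E → Matrix κ κ ℝ}
    (hA : ∀ i j, ContDiffOn ℝ n (fun x => A x i j) s) (hdet : ∀ x ∈ s, (A x).det ≠ 0) (i j : κ) :
    ContDiffOn ℝ n (fun x => (A x)⁻¹ i j) s := by
  simp_rw [Matrix.inv_def, Matrix.smul_apply, Ring.inverse_eq_inv', Matrix.adjugate_apply,
    smul_eq_mul]
  refine ((contDiffOn_det hA).inv hdet).mul (contDiffOn_det fun k l => ?_)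
  by_cases hk : k = j
  · subst hk; simp only [Matrix.updateRow_self]; exact contDiffOn_const
  · simp only [Matrix.updateRow_ne hk]; exact hA k l

theorem contDiffOn_christoffel (he : e ∈ atlas (Coord m) M) (k i j : Fin m) :
    ContDiffOn ℝ ∞ (christoffel e k i j) e.target := by
  unfold christoffel
  have hg := fun i j => contDiffOn_metricCoeff he i j
  refine contDiffOn_const.mul (ContDiffOn.sum fun l _ => ContDiffOn.mul ?_ ?_)
  · exact contDiffOn_inv hg (fun x hx => (posDef_metricCoeff he hx).det_pos.ne') k l
  · exact ((contDiffOn_partialD e.open_target (hg j l) i).add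
      (contDiffOn_partialD e.open_target (hg i l) j)).sub
      (contDiffOn_partialD e.open_target (hg i j) l)

theorem contDiffOn_connForm (he : e ∈ atlas (Coord m) M) :
    ContDiffOn ℝ ∞ (connForm e) e.target :=
  contDiffOn_bilin fun i j => contDiffOn_euclidean.2 fun k => contDiffOn_christoffel he k i j

theorem koszul_connForm (he : e ∈ atlas (Coord m) M) {x : Coord m} (hx : x ∈ e.target) :
    Koszul (metricForm e) (connForm e) x := by
  have hd : DifferentiableAt ℝ (metricForm e) x :=
    ((contDiffOn_metricForm he).contDiffAt (e.open_target.mem_nhds hx)).differentiableAt (by simp)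
  intro a b c
  rw [← sub_eq_zero]
  revert a
  refine eq_zero_of_single (fun u v => by simp only [map_add, add_apply]; ring)
    (fun r u => by simp only [map_smul, smul_apply, smul_eq_mul]; ring) fun i => ?_
  revert b
  refine eq_zero_of_single (fun u v => by simp only [map_add, add_apply]; ring)
    (fun r u => by simp only [map_smul, smul_apply, smul_eq_mul]; ring) fun j => ?_
  revert c
  refine eq_zero_of_single (fun u v => by simp only [map_add, add_apply]; ring)
    (fun r u => by simp only [map_smul, smul_apply, smul_eq_mul]; ring) fun l => ?_
  have hD : ∀ i j l : Fin m, fderiv ℝ (metricForm e) x (EuclideanSpace.single i 1)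
      (EuclideanSpace.single j 1) (EuclideanSpace.single l 1) =
      partialD i (fun y => metricCoeff e y j l) x := fun i j l => by
    rw [fderiv_apply₂ hd]
    simp only [metricForm, bilin_single, partialD]
  rw [hD, hD, hD, connForm, bilin_single, metricForm, bilin_apply]
  have h1 : ∀ (u : Coord m), ∑ i, ∑ j, u i • (EuclideanSpace.single l (1 : ℝ) : Coord m) j •
      metricCoeff e x i j = ∑ i, u i * metricCoeff e x i l := fun u => by
    refine Finset.sum_congr rfl fun i _ => ?_
    rw [Finset.sum_eq_single l (fun a _ ha => by simp [ha]) (by simp)]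
    simp
  rw [h1, sub_eq_zero]
  simp only [christoffel]
  set d : Fin m → ℝ := fun l => partialD i (fun y => metricCoeff e y j l) x +
    partialD j (fun y => metricCoeff e y i l) x - partialD l (fun y => metricCoeff e y i j) x with hdd
  have hsymm : ∀ k, metricCoeff e x k l = metricCoeff e x l k := fun k => by
    simp only [metricCoeff, Matrix.of_apply]; rw [real_inner_comm]
  have hinv : metricCoeff e x * (metricCoeff e x)⁻¹ = 1 :=
    Matrix.mul_nonsing_inv _ (posDef_metricCoeff he hx).det_pos.ne'.isUnit
  have : ∑ k, (1 / 2 * ∑ l', (metricCoeff e x)⁻¹ k l' * d l') * metricCoeff e x k l =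
      1 / 2 * ∑ l', (metricCoeff e x * (metricCoeff e x)⁻¹) l l' * d l' := by
    simp_rw [Matrix.mul_apply, Finset.sum_mul, Finset.mul_sum, Finset.sum_mul]
    rw [Finset.sum_comm]
    refine Finset.sum_congr rfl fun a _ => Finset.sum_congr rfl fun k _ => ?_
    rw [hsymm]; ring
  rw [this, hinv]
  simp [Matrix.one_apply, hdd]

theorem localCurv_connForm_single (he : e ∈ atlas (Coord m) M) {x : Coord m} (hx : x ∈ e.target)
    (i j k : Fin m) : localCurv (connForm e) x (EuclideanSpace.single i 1)
      (EuclideanSpace.single j 1) (EuclideanSpace.single k 1) =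
      WithLp.toLp 2 fun l => curvCoeff e l i j k x := by
  have hd : DifferentiableAt ℝ (connForm e) x :=
    ((contDiffOn_connForm he).contDiffAt (e.open_target.mem_nhds hx)).differentiableAt (by simp)
  have hdc : ∀ k i j, DifferentiableAt ℝ (christoffel e k i j) x := fun k i j =>
    ((contDiffOn_christoffel he k i j).contDiffAt (e.open_target.mem_nhds hx)).differentiableAt
      (by simp)
  have hD : ∀ i j k l : Fin m, (fderiv ℝ (connForm e) x (EuclideanSpace.single i 1)
      (EuclideanSpace.single j 1) (EuclideanSpace.single k 1)) l =
      partialD i (christoffel e l j k) x := fun i j k l => by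
    rw [fderiv_apply₂ hd]
    simp only [connForm, bilin_single, partialD]
    have h1 : DifferentiableAt ℝ (fun y => (WithLp.toLp 2 fun k_1 => christoffel e k_1 j k y :
        Coord m)) x := differentiableAt_euclidean.2 fun l => hdc l j k
    have h2 := ((EuclideanSpace.proj l : Coord m →L[ℝ] ℝ).hasFDerivAt.comp x h1.hasFDerivAt).fderiv
    exact (congrArg (fun L => L (EuclideanSpace.single i 1)) h2).symm
  have hΓ : ∀ i j k l : Fin m, (connForm e x (EuclideanSpace.single i 1)
      (connForm e x (EuclideanSpace.single j 1) (EuclideanSpace.single k 1))) l =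
      ∑ s, christoffel e s j k x * christoffel e l i s x := fun i j k l => by
    have h1 : connForm e x (EuclideanSpace.single j 1) (EuclideanSpace.single k 1) =
        WithLp.toLp 2 fun l => christoffel e l j k x := bilin_single _ _ _
    rw [h1, connForm, bilin_apply, Finset.sum_eq_single i (fun a _ ha => by simp [ha]) (by simp)]
    simp
  ext l
  simp only [localCurv, PiLp.add_apply, PiLp.sub_apply, hD, hΓ, curvCoeff, Finset.sum_sub_distrib]
  ring

theorem localCurv_add_left (Γ : Coord m → Coord m →L[ℝ] Coord m →L[ℝ] Coord m)
    (x u v b c : Coord m) :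
    localCurv Γ x (u + v) b c = localCurv Γ x u b c + localCurv Γ x v b c := by
  simp only [localCurv, map_add, add_apply]; abel

theorem localCurv_smul_left (Γ : Coord m → Coord m →L[ℝ] Coord m →L[ℝ] Coord m)
    (x : Coord m) (r : ℝ) (u b c : Coord m) :
    localCurv Γ x (r • u) b c = r • localCurv Γ x u b c := by
  simp only [localCurv, map_smul, smul_apply]; module

theorem localCurv_add_right (Γ : Coord m → Coord m →L[ℝ] Coord m →L[ℝ] Coord m)
    (x a b u v : Coord m) :
    localCurv Γ x a b (u + v) = localCurv Γ x a b u + localCurv Γ x a b v := by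
  simp only [localCurv, map_add]; abel

theorem localCurv_smul_right (Γ : Coord m → Coord m →L[ℝ] Coord m →L[ℝ] Coord m)
    (x : Coord m) (r : ℝ) (a b u : Coord m) :
    localCurv Γ x a b (r • u) = r • localCurv Γ x a b u := by
  simp only [localCurv, map_smul]; module

theorem chartD_curv_chartAt (p : M) (X Y Z : TangentSpace (𝓡 m) p) :
    chartD (chartAt (Coord m) p) p (curv m p X Y Z) =
      localCurv (connForm (chartAt (Coord m) p)) (chartAt (Coord m) p p)
        (chartD (chartAt (Coord m) p) p X) (chartD (chartAt (Coord m) p) p Y)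
        (chartD (chartAt (Coord m) p) p Z) := by
  set e := chartAt (Coord m) p with he0
  have he : e ∈ atlas (Coord m) M := chart_mem_atlas _ p
  have hp : p ∈ e.source := mem_chart_source _ p
  let L := chartEquiv he hp
  have hL : ∀ X, chartD e p X = L X := fun _ => rfl
  rw [hL X, hL Y, hL Z]
  have h2 : ∀ X, X = L.symm (L X) := fun X => (L.symm_apply_apply X).symm
  conv_lhs => rw [h2 X, h2 Y, h2 Z]
  generalize L X = u
  generalize L Y = v
  generalize L Z = w
  rw [← sub_eq_zero]
  revert u
  refine eq_zero_of_single (fun u v => by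
      simp only [map_add, LinearMap.add_apply, localCurv_add_left]; abel)
    (fun r u => by
      simp only [map_smul, LinearMap.smul_apply, localCurv_smul_left, smul_sub]) fun i => ?_
  revert v
  refine eq_zero_of_single (fun u v => by
      rw [localCurv_antisymm]; simp only [map_add, LinearMap.add_apply, localCurv_add_left]
      rw [localCurv_antisymm _ _ u, localCurv_antisymm _ _ v]; abel)
    (fun r u => by
      rw [localCurv_antisymm]; simp only [map_smul, LinearMap.smul_apply, localCurv_smul_left]
      rw [localCurv_antisymm _ _ u]; module) fun j => ?_
  revert w
  refine eq_zero_of_single (fun u v => by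
      simp only [map_add, localCurv_add_right]; abel)
    (fun r u => by
      simp only [map_smul, localCurv_smul_right, smul_sub]) fun k => ?_
  rw [localCurv_connForm_single he (e.map_source hp), sub_eq_zero]
  have hdx : ∀ i j, coordForm e p i (L.symm (EuclideanSpace.single j 1)) =
      (EuclideanSpace.single j (1 : ℝ) : Coord m) i := fun i j => by
    have : chartD e p (L.symm (EuclideanSpace.single j 1)) = EuclideanSpace.single j 1 :=
      L.apply_symm_apply _
    rw [coordForm, ContinuousLinearMap.comp_apply, this]
    rfl
  have hc : curv m p (L.symm (EuclideanSpace.single i 1)) (L.symm (EuclideanSpace.single j 1))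
      (L.symm (EuclideanSpace.single k 1)) = ∑ l, curvCoeff e l i j k (e p) • coordVec e p l := by
    simp only [curv, ← he0, LinearMap.sum_apply, LinearMap.smulRight_apply, LinearMap.smul_apply,
      ContinuousLinearMap.coe_coe, hdx]
    rw [Finset.sum_eq_single i (fun a _ ha => by simp [ha]) (by simp),
      Finset.sum_eq_single j (fun a _ ha => by simp [ha]) (by simp),
      Finset.sum_eq_single k (fun a _ ha => by simp [ha]) (by simp)]
    simp
  rw [hc, map_sum]
  simp only [map_smul, chartD_coordVec he hp]
  exact sum_smul_single (WithLp.toLp 2 fun l => curvCoeff e l i j k (e p))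

end Conn

section Curvature

set_option synthInstance.maxHeartbeats 400000
set_option maxHeartbeats 1000000
set_option linter.unusedSectionVars false

variable {m : ℕ} {M : Type*} [TopologicalSpace M] [ChartedSpace (Coord m) M]
  [IsManifold (𝓡 m) ∞ M] {e e' : OpenPartialHomeomorph M (Coord m)}
  [RiemannianBundle (fun x : M => TangentSpace (𝓡 m) x)]
  [IsContMDiffRiemannianBundle (𝓡 m) ∞ (Coord m) (fun x : M => TangentSpace (𝓡 m) x)]

theorem contDiffAt_metricForm (he : e ∈ atlas (Coord m) M) {x : Coord m} (hx : x ∈ e.target) :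
    ContDiffAt ℝ ∞ (metricForm e) x :=
  (contDiffOn_metricForm he).contDiffAt (e.open_target.mem_nhds hx)

theorem differentiableAt_metricForm (he : e ∈ atlas (Coord m) M) {x : Coord m}
    (hx : x ∈ e.target) : DifferentiableAt ℝ (metricForm e) x :=
  (contDiffAt_metricForm he hx).differentiableAt (by simp)

theorem differentiableAt_connForm (he : e ∈ atlas (Coord m) M) {x : Coord m}
    (hx : x ∈ e.target) : DifferentiableAt ℝ (connForm e) x :=
  ((contDiffOn_connForm he).contDiffAt (e.open_target.mem_nhds hx)).differentiableAt (by simp)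

theorem connForm_compat (he : e ∈ atlas (Coord m) M) {x : Coord m} (hx : x ∈ e.target)
    (a b c : Coord m) : fderiv ℝ (metricForm e) x a b c =
      metricForm e x (connForm e x a b) c + metricForm e x b (connForm e x a c) :=
  (koszul_connForm he hx).compat (differentiableAt_metricForm he hx)
    (Eventually.of_forall fun _ => metricForm_symm e _) a b c

theorem connForm_symm (he : e ∈ atlas (Coord m) M) {x : Coord m} (hx : x ∈ e.target)
    (a b : Coord m) : connForm e x a b = connForm e x b a :=
  (koszul_connForm he hx).symm (differentiableAt_metricForm he hx)
    (Eventually.of_forall fun _ => metricForm_symm e _) (metricForm_nondeg he hx) a b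

theorem fderiv_trans_bijective (he : e ∈ atlas (Coord m) M) (he' : e' ∈ atlas (Coord m) M)
    {q : M} (hq : q ∈ e.source) (hq' : q ∈ e'.source) :
    Function.Bijective (fderiv ℝ (trans e e') (e q)) := by
  have : (fderiv ℝ (trans e e') (e q) : Coord m → Coord m) =
      chartEquiv he' hq' ∘ (chartEquiv he hq).symm := by
    funext u
    have := chartD_eq_fderiv_trans he he' hq hq' ((chartEquiv he hq).symm u)
    rw [← chartEquiv_apply he hq, ← chartEquiv_apply he' hq',
      ContinuousLinearEquiv.apply_symm_apply] at this
    exact this.symm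
  rw [this]
  exact (chartEquiv he' hq').bijective.comp (chartEquiv he hq).symm.bijective

theorem localCurv_trans (he : e ∈ atlas (Coord m) M) (he' : e' ∈ atlas (Coord m) M)
    {q : M} (hq : q ∈ e.source) (hq' : q ∈ e'.source) (a b c : Coord m) :
    fderiv ℝ (trans e e') (e q) (localCurv (connForm e) (e q) a b c) =
      localCurv (connForm e') (e' q) (fderiv ℝ (trans e e') (e q) a)
        (fderiv ℝ (trans e e') (e q) b) (fderiv ℝ (trans e e') (e q) c) := by
  have hmem : e q ∈ (trans e e').source := by
    rw [trans_source]
    exact ⟨e.map_source hq, by rwa [Set.mem_preimage, e.left_inv hq]⟩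
  have hnhds := (trans e e').open_source.mem_nhds hmem
  have h3 := (contDiffAt_trans he he' hq hq').of_le (m := 3) ENat.LEInfty.out
  have h := localCurv_transform (Γ := connForm e) (Γ' := connForm e') h3
    (differentiableAt_connForm he (e.map_source hq)) (by
      rw [trans_apply hq]
      exact differentiableAt_connForm he' (e'.map_source hq')) ?_ a b c
  · rw [h, trans_apply hq]
  filter_upwards [hnhds] with y hy
  have hy' := hy
  rw [trans_source] at hy'
  obtain ⟨p, hp, rfl⟩ : ∃ p ∈ e.source, e p = y :=
    ⟨e.symm y, e.map_target hy'.1, e.right_inv hy'.1⟩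
  have hp' : p ∈ e'.source := by have := hy'.2; rwa [Set.mem_preimage, e.left_inv hp] at this
  refine (koszul_connForm he hy'.1).transform (g' := metricForm e') ?_
    ((contDiffAt_trans he he' hp hp').of_le ENat.LEInfty.out)
    (differentiableAt_metricForm he hy'.1) ?_
    (Eventually.of_forall fun _ => metricForm_symm e' _) ?_
    (fderiv_trans_bijective he he' hp hp').2 ?_
  · rw [trans_apply hp]; exact koszul_connForm he' (e'.map_source hp')
  · rw [trans_apply hp]; exact differentiableAt_metricForm he' (e'.map_source hp')
  · rw [trans_apply hp]; exact metricForm_nondeg he' (e'.map_source hp')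
  · filter_upwards [(trans e e').open_source.mem_nhds hy] with z hz
    exact metricForm_trans he he' hz

/-- The curvature tensor can be computed in every chart. -/
theorem chartD_curv (he : e ∈ atlas (Coord m) M) {p : M} (hp : p ∈ e.source)
    (X Y Z : TangentSpace (𝓡 m) p) : chartD e p (curv m p X Y Z) =
      localCurv (connForm e) (e p) (chartD e p X) (chartD e p Y) (chartD e p Z) := by
  have he' := chart_mem_atlas (Coord m) p
  have hp' := mem_chart_source (Coord m) p
  refine (fderiv_trans_bijective he he' hp hp').1 ?_
  rw [localCurv_trans he he' hp hp']
  simp only [← chartD_eq_fderiv_trans he he' hp hp', chartD_curv_chartAt]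

theorem curv_mem_Kr (p : M) : curv m p ∈ Kr (TangentSpace (𝓡 m) p) := by
  set e := chartAt (Coord m) p with he0
  have he : e ∈ atlas (Coord m) M := chart_mem_atlas _ p
  have hp : p ∈ e.source := mem_chart_source _ p
  have hx := e.map_source hp
  have hinj : Function.Injective (chartD e p) := (chartEquiv he hp).injective
  have hnhds := e.open_target.mem_nhds hx
  refine ⟨fun X Y Z => hinj ?_, fun X Y Z W => ?_, fun X Y Z => hinj ?_⟩
  · rw [map_neg, chartD_curv he hp, chartD_curv he hp, localCurv_antisymm]
  · rw [← metricForm_chartD he hp, ← metricForm_chartD he hp, chartD_curv he hp, chartD_curv he hp]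
    refine localCurv_skew ((contDiffAt_metricForm he hx).of_le ENat.LEInfty.out)
      (differentiableAt_connForm he hx) ?_ _ _ _ _
    filter_upwards [hnhds] with y hy
    exact connForm_compat he hy
  · rw [map_add, map_add, map_zero, chartD_curv he hp, chartD_curv he hp, chartD_curv he hp]
    refine localCurv_bianchi (differentiableAt_connForm he hx) ?_ _ _ _
    filter_upwards [hnhds] with y hy
    exact connForm_symm he hy

end Curvature

/-! ### The Gram determinant of the Grassmann bundle: linear algebra -/

section GramDet

set_option linter.unusedSectionVars false

open Matrix
open scoped Kronecker

variable {ι : Type*} [Fintype ι] [DecidableEq ι] {n : ℕ} (σ : Fin 2 ⊕ Fin n ≃ ι)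
  (g : Matrix ι ι ℝ) (A : Fin n × Fin 2 → ℝ)

/-- The Gram matrix of the frame `frameMat σ A` with respect to the metric `g`. -/
def frameGram : Matrix (Fin 2) (Fin 2) ℝ := (frameMat σ A)ᵀ * g * frameMat σ A

/-- The left inverse of `frameMat σ A` that vanishes on the `g`-orthogonal complement. -/
def framePinv : Matrix (Fin 2) ι ℝ := (frameGram σ g A)⁻¹ * ((frameMat σ A)ᵀ * g)

/-- The `g`-orthogonal projection onto the column space of `frameMat σ A`. -/
def frameProj : Matrix ι ι ℝ := frameMat σ A * framePinv σ g A

variable {g}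

theorem isUnit_det_frameGram (hg : g.PosDef) : IsUnit (frameGram σ g A).det :=
  (posDef_frameMat σ hg A).det_pos.ne'.isUnit

theorem transpose_eq_self (hg : g.PosDef) : gᵀ = g := by
  have := hg.isHermitian
  rwa [Matrix.IsHermitian, Matrix.conjTranspose_eq_transpose_of_trivial] at this

theorem frameGram_transpose (hg : g.PosDef) : (frameGram σ g A)ᵀ = frameGram σ g A :=
  transpose_eq_self (posDef_frameMat σ hg A)

theorem framePinv_mul (hg : g.PosDef) : framePinv σ g A * frameMat σ A = 1 := by
  rw [framePinv, Matrix.mul_assoc]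
  exact nonsing_inv_mul _ (isUnit_det_frameGram σ A hg)

theorem frameProj_mul (hg : g.PosDef) : frameProj σ g A * frameMat σ A = frameMat σ A := by
  rw [frameProj, Matrix.mul_assoc, framePinv_mul σ A hg, Matrix.mul_one]

theorem framePinv_mul_frameProj (hg : g.PosDef) :
    framePinv σ g A * frameProj σ g A = framePinv σ g A := by
  rw [frameProj, ← Matrix.mul_assoc, framePinv_mul σ A hg, Matrix.one_mul]

theorem frameProj_mul_self (hg : g.PosDef) :
    frameProj σ g A * frameProj σ g A = frameProj σ g A := by
  nth_rewrite 2 [frameProj]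
  rw [← Matrix.mul_assoc, frameProj_mul σ A hg, frameProj]

theorem metric_mul_frameProj (hg : g.PosDef) :
    g * frameProj σ g A = (frameProj σ g A)ᵀ * g := by
  rw [frameProj, framePinv]
  simp only [transpose_mul, transpose_nonsing_inv, frameGram_transpose σ A hg,
    transpose_eq_self hg, transpose_transpose, Matrix.mul_assoc]

/-- The metric on the orthogonal complement of the column space of the frame. -/
def frameSchur (g : Matrix ι ι ℝ) : Matrix ι ι ℝ := g * (1 - frameProj σ g A)

theorem frameSchur_mul (hg : g.PosDef) : frameSchur σ A g * frameMat σ A = 0 := by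
  rw [frameSchur, Matrix.mul_assoc, Matrix.sub_mul, frameProj_mul σ A hg, Matrix.one_mul, sub_self,
    Matrix.mul_zero]

theorem frameSchur_transpose (hg : g.PosDef) : (frameSchur σ A g)ᵀ = frameSchur σ A g := by
  rw [frameSchur, transpose_mul, transpose_sub, transpose_one, transpose_eq_self hg,
    Matrix.sub_mul, ← metric_mul_frameProj σ A hg, Matrix.mul_sub, Matrix.one_mul, Matrix.mul_one]

theorem transpose_mul_frameSchur (hg : g.PosDef) : (frameMat σ A)ᵀ * frameSchur σ A g = 0 := by
  have := congrArg Matrix.transpose (frameSchur_mul σ A hg)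
  rwa [transpose_mul, frameSchur_transpose σ A hg, transpose_zero] at this

theorem frameSchur_eq (hg : g.PosDef) :
    (1 - frameProj σ g A)ᵀ * g * (1 - frameProj σ g A) = frameSchur σ A g := by
  rw [transpose_sub, transpose_one, Matrix.sub_mul, ← metric_mul_frameProj σ A hg, frameSchur,
    Matrix.one_mul, Matrix.sub_mul, Matrix.mul_assoc g (frameProj σ g A), Matrix.mul_sub
    (frameProj σ g A), frameProj_mul_self σ A hg, Matrix.mul_one, sub_self, Matrix.mul_zero,
    sub_zero]

/-- The derivative of the orthogonal projection in the direction of the change `N` of the frame. -/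
def projDeriv (g : Matrix ι ι ℝ) (N : Matrix ι (Fin 2) ℝ) : Matrix ι ι ℝ :=
  (1 - frameProj σ g A) * N * framePinv σ g A +
    g⁻¹ * (((1 - frameProj σ g A) * N * framePinv σ g A)ᵀ * g)

/-- The scalar product of two tangent vectors of the Grassmannian. -/
def tangentForm (g : Matrix ι ι ℝ) (N N' : Matrix ι (Fin 2) ℝ) : ℝ :=
  (Nᵀ * frameSchur σ A g * N' * (frameGram σ g A)⁻¹).trace

theorem framePinv_mul_inv_mul (hg : g.PosDef) :
    framePinv σ g A * g⁻¹ * (framePinv σ g A)ᵀ = (frameGram σ g A)⁻¹ := by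
  have hgd : IsUnit g.det := hg.det_pos.ne'.isUnit
  rw [framePinv]
  simp only [transpose_mul, transpose_nonsing_inv, frameGram_transpose σ A hg,
    transpose_eq_self hg, transpose_transpose]
  calc (frameGram σ g A)⁻¹ * ((frameMat σ A)ᵀ * g) * g⁻¹ *
        (g * frameMat σ A * (frameGram σ g A)⁻¹)
      = (frameGram σ g A)⁻¹ * ((frameMat σ A)ᵀ * (g * g⁻¹) * g * frameMat σ A) *
        (frameGram σ g A)⁻¹ := by simp only [Matrix.mul_assoc]
    _ = (frameGram σ g A)⁻¹ * frameGram σ g A * (frameGram σ g A)⁻¹ := by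
        rw [mul_nonsing_inv _ hgd, Matrix.mul_one, frameGram]
    _ = _ := by rw [nonsing_inv_mul _ (isUnit_det_frameGram σ A hg), Matrix.one_mul]

/-- The scalar product, half the trace of the product, of two derivatives of the projection.  Each
derivative is the sum of a map from the plane to its complement and of the adjoint of that map; only
the mixed products contribute to the trace. -/
theorem half_trace_projDeriv_mul (hg : g.PosDef) (N N' : Matrix ι (Fin 2) ℝ) :
    1 / 2 * (projDeriv σ A g N * projDeriv σ A g N').trace = tangentForm σ A g N N' := by
  have hgd : IsUnit g.det := hg.det_pos.ne'.isUnit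
  have hgt := transpose_eq_self hg
  have hgit : (g⁻¹)ᵀ = g⁻¹ := by rw [transpose_nonsing_inv, hgt]
  have hzero : framePinv σ g A * (1 - frameProj σ g A) = 0 := by
    rw [Matrix.mul_sub, framePinv_mul_frameProj σ A hg, Matrix.mul_one, sub_self]
  have hYY : ∀ N N' : Matrix ι (Fin 2) ℝ, (1 - frameProj σ g A) * N * framePinv σ g A *
      ((1 - frameProj σ g A) * N' * framePinv σ g A) = 0 := fun N N' => by
    calc _ = (1 - frameProj σ g A) * N * (framePinv σ g A * (1 - frameProj σ g A)) * N' *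
          framePinv σ g A := by simp only [Matrix.mul_assoc]
      _ = 0 := by rw [hzero, Matrix.mul_zero, Matrix.zero_mul, Matrix.zero_mul]
  have htr : (g⁻¹ * (((1 - frameProj σ g A) * N * framePinv σ g A)ᵀ * g) *
      ((1 - frameProj σ g A) * N' * framePinv σ g A)).trace = tangentForm σ A g N N' := by
    rw [tangentForm, ← framePinv_mul_inv_mul σ A hg, ← frameSchur_eq σ A hg, transpose_mul,
      transpose_mul]
    calc (g⁻¹ * ((framePinv σ g A)ᵀ * (Nᵀ * (1 - frameProj σ g A)ᵀ) * g) *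
          ((1 - frameProj σ g A) * N' * framePinv σ g A)).trace
        = ((g⁻¹ * (framePinv σ g A)ᵀ) * (Nᵀ * ((1 - frameProj σ g A)ᵀ * g *
          (1 - frameProj σ g A)) * N' * framePinv σ g A)).trace := by
          simp only [Matrix.mul_assoc]
      _ = _ := by rw [Matrix.trace_mul_comm]; simp only [Matrix.mul_assoc]
  have hY0 := hYY N N'
  have hY1 := hYY N' N
  set Y := (1 - frameProj σ g A) * N * framePinv σ g A with hY
  set Y' := (1 - frameProj σ g A) * N' * framePinv σ g A with hY'
  have e1 : (Y * (g⁻¹ * (Y'ᵀ * g))).trace = (g⁻¹ * (Yᵀ * g) * Y').trace := by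
    rw [← Matrix.trace_transpose, Matrix.trace_mul_comm (g⁻¹ * (Yᵀ * g))]
    simp only [transpose_mul, transpose_transpose, hgt, hgit]
    rw [Matrix.mul_assoc g Y', Matrix.mul_assoc g, Matrix.trace_mul_comm g]
    simp only [Matrix.mul_assoc]
  have e2 : (g⁻¹ * (Yᵀ * g) * (g⁻¹ * (Y'ᵀ * g))).trace = 0 := by
    have : g⁻¹ * (Yᵀ * g) * (g⁻¹ * (Y'ᵀ * g)) = g⁻¹ * ((Y' * Y)ᵀ * g) := by
      calc g⁻¹ * (Yᵀ * g) * (g⁻¹ * (Y'ᵀ * g)) = g⁻¹ * (Yᵀ * (g * g⁻¹) * Y'ᵀ * g) := by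
            simp only [Matrix.mul_assoc]
        _ = _ := by rw [mul_nonsing_inv _ hgd, Matrix.mul_one, transpose_mul Y' Y]
    rw [this, hY1]; simp
  rw [projDeriv, projDeriv, ← hY, ← hY', Matrix.add_mul, Matrix.mul_add, Matrix.mul_add,
    Matrix.trace_add, Matrix.trace_add, Matrix.trace_add, hY0, e1, e2, htr]
  simp; ring

/-- The covariant derivative of the orthogonal projection `P` onto a moving plane, spanned by the
columns of a frame `F`.  The hypotheses are the derivatives of the identities `P F = F`, `P P = P`
and `g P = Pᵀ g`, and the compatibility of the connection `Γ` with the metric `g`. -/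
theorem covariant_eq_projDeriv (hg : g.PosDef) {dP dg Γ : Matrix ι ι ℝ} {dF : Matrix ι (Fin 2) ℝ}
    (h1 : dP * frameMat σ A + frameProj σ g A * dF = dF)
    (h2 : dP * frameProj σ g A + frameProj σ g A * dP = dP)
    (h3 : dg * frameProj σ g A + g * dP = dPᵀ * g + (frameProj σ g A)ᵀ * dg)
    (h4 : dg = g * Γ + Γᵀ * g) :
    dP + (Γ * frameProj σ g A - frameProj σ g A * Γ) =
      projDeriv σ A g (dF + Γ * frameMat σ A) := by
  have hgd : IsUnit g.det := hg.det_pos.ne'.isUnit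
  have hgP := metric_mul_frameProj σ A hg
  have hPP := frameProj_mul_self σ A hg
  have hdPP : dP * frameProj σ g A = (1 - frameProj σ g A) * dF * framePinv σ g A := by
    have : dP * frameMat σ A = (1 - frameProj σ g A) * dF := by
      rw [Matrix.sub_mul, Matrix.one_mul]
      exact eq_sub_of_add_eq h1
    rw [frameProj, ← Matrix.mul_assoc, this]
    rfl
  have hY : (1 - frameProj σ g A) * (dF + Γ * frameMat σ A) * framePinv σ g A =
      dP * frameProj σ g A + (1 - frameProj σ g A) * Γ * frameProj σ g A := by
    rw [hdPP, Matrix.mul_add, Matrix.add_mul]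
    simp only [frameProj, Matrix.mul_assoc]
  rw [projDeriv, hY]
  set P := frameProj σ g A with hP
  have hkey : g * (dP + (Γ * P - P * Γ)) =
      g * (dP * P + (1 - P) * Γ * P) + (dP * P + (1 - P) * Γ * P)ᵀ * g := by
    have hgPdP : g * (P * dP) = (dP * P)ᵀ * g + Pᵀ * dg - Pᵀ * dg * P := by
      rw [← Matrix.mul_assoc, hgP, Matrix.mul_assoc]
      have : g * dP = dPᵀ * g + Pᵀ * dg - dg * P := by rw [← h3]; abel
      rw [this, Matrix.mul_sub, Matrix.mul_add, transpose_mul, ← Matrix.mul_assoc Pᵀ Pᵀ,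
        ← transpose_mul, hPP]
      simp only [Matrix.mul_assoc]
    have hPgP : Pᵀ * (g * P) = Pᵀ * g := by
      rw [hgP, ← Matrix.mul_assoc, ← transpose_mul, hPP]
    have e0 : g * dP = g * (dP * P) + ((dP * P)ᵀ * g + Pᵀ * dg - Pᵀ * dg * P) := by
      rw [← hgPdP, ← Matrix.mul_add, h2]
    rw [Matrix.mul_add, e0, h4]
    simp only [Matrix.mul_add, Matrix.add_mul, Matrix.mul_sub, Matrix.sub_mul, transpose_add,
      transpose_sub, transpose_mul, Matrix.one_mul, Matrix.mul_assoc]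
    have hgP' : ∀ X : Matrix ι ι ℝ, g * (P * X) = Pᵀ * (g * X) := fun X => by
      rw [← Matrix.mul_assoc, hgP, Matrix.mul_assoc]
    simp only [hgP', hgP]
    abel
  rw [← nonsing_inv_mul_cancel_left _ (dP + (Γ * P - P * Γ)) hgd, hkey, Matrix.mul_add,
    nonsing_inv_mul_cancel_left _ _ hgd]

/-- The matrix unit in the lower block that corresponds to a graph coordinate. -/
def coordUnit (q : Fin n × Fin 2) : Matrix ι (Fin 2) ℝ :=
  Matrix.of fun i a => if i = σ (Sum.inr q.1) ∧ a = q.2 then 1 else 0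

/-- The Gram matrix of the fibre in graph coordinates. -/
def fibreGram (g : Matrix ι ι ℝ) : Matrix (Fin n × Fin 2) (Fin n × Fin 2) ℝ :=
  ((frameSchur σ A g).submatrix (σ ∘ Sum.inr) (σ ∘ Sum.inr)) ⊗ₖ (frameGram σ g A)⁻¹

theorem tangentForm_coordUnit (hg : g.PosDef) (q q' : Fin n × Fin 2) :
    tangentForm σ A g (coordUnit σ q) (coordUnit σ q') = fibreGram σ A g q q' := by
  have hH : ((frameGram σ g A)⁻¹)ᵀ = (frameGram σ g A)⁻¹ := by
    rw [transpose_nonsing_inv, frameGram_transpose σ A hg]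
  have h1 : ∀ a b, ((coordUnit σ q)ᵀ * frameSchur σ A g * coordUnit σ q') a b =
      if a = q.2 ∧ b = q'.2 then frameSchur σ A g (σ (Sum.inr q.1)) (σ (Sum.inr q'.1)) else 0 := by
    intro a b
    simp only [Matrix.mul_apply, transpose_apply, coordUnit, Matrix.of_apply, ite_and]
    by_cases ha : a = q.2 <;> by_cases hb : b = q'.2 <;> simp [ha, hb]
  rw [tangentForm]
  generalize (coordUnit σ q)ᵀ * frameSchur σ A g * coordUnit σ q' = X at h1
  simp only [Matrix.trace, Matrix.diag_apply, Matrix.mul_apply, h1, ite_and]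
  rw [Finset.sum_eq_single q.2 (fun a _ ha => by simp [ha]) (by simp),
    Finset.sum_eq_single q'.2 (fun a _ ha => by simp [ha]) (by simp)]
  simp only [if_true, fibreGram, kroneckerMap_apply, submatrix_apply, Function.comp]
  rw [← hH, transpose_apply, hH]

theorem tangentForm_symm (hg : g.PosDef) (N N' : Matrix ι (Fin 2) ℝ) :
    tangentForm σ A g N N' = tangentForm σ A g N' N := by
  have hH : ((frameGram σ g A)⁻¹)ᵀ = (frameGram σ g A)⁻¹ := by
    rw [transpose_nonsing_inv, frameGram_transpose σ A hg]
  rw [tangentForm, tangentForm, ← Matrix.trace_transpose, transpose_mul, transpose_mul,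
    transpose_mul, hH, frameSchur_transpose σ A hg, transpose_transpose, Matrix.trace_mul_comm]
  simp only [Matrix.mul_assoc]

/-- The components of a change of the frame in graph coordinates. -/
def frameComp (N : Matrix ι (Fin 2) ℝ) (q : Fin n × Fin 2) : ℝ :=
  N (σ (Sum.inr q.1)) q.2 - ∑ c, A (q.1, c) * N (σ (Sum.inl c)) q.2

/-- Every change of the frame is, modulo changes within the plane, a combination of the coordinate
directions. -/
theorem frame_decomp (N : Matrix ι (Fin 2) ℝ) :
    N = frameMat σ A * (Matrix.of fun c a => N (σ (Sum.inl c)) a) +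
      ∑ q, frameComp σ A N q • coordUnit σ q := by
  ext i a
  obtain ⟨i, rfl⟩ := σ.surjective i
  simp only [Matrix.add_apply, Matrix.mul_apply, Matrix.sum_apply, Matrix.smul_apply, smul_eq_mul,
    coordUnit, Matrix.of_apply, frameMat, Equiv.symm_apply_apply, EmbeddingLike.apply_eq_iff_eq]
  rcases i with c | c
  · simp [Matrix.one_apply]
  · rw [Finset.sum_eq_single (c, a) (fun q _ hq => by
      rw [if_neg, mul_zero]
      rintro ⟨h1, h2⟩
      exact hq (Prod.ext (Sum.inr_injective h1).symm h2.symm)) (by simp)]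
    simp [frameComp]

theorem tangentForm_left (hg : g.PosDef) (N N' : Matrix ι (Fin 2) ℝ) :
    tangentForm σ A g N N' = ∑ q, frameComp σ A N q * tangentForm σ A g (coordUnit σ q) N' := by
  conv_lhs => rw [frame_decomp σ A N]
  rw [tangentForm, transpose_add, transpose_mul, Matrix.add_mul,
    Matrix.mul_assoc _ _ (frameSchur σ A g), transpose_mul_frameSchur σ A hg, Matrix.mul_zero, zero_add, Matrix.transpose_sum]
  simp only [Matrix.sum_mul, Matrix.trace_sum, transpose_smul, Matrix.smul_mul, Matrix.trace_smul,
    smul_eq_mul, tangentForm]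

/-- In the basis consisting of the frame and of coordinate vectors, `frameSchur` is the Schur
complement of the block `frameGram` of the metric. -/
theorem det_frameSchur (hg : g.PosDef) :
    ((frameSchur σ A g).submatrix (σ ∘ Sum.inr) (σ ∘ Sum.inr)).det =
      g.det / (frameGram σ g A).det := by
  have hH := isUnit_det_frameGram σ A hg
  let E : Matrix ι (Fin n) ℝ := Matrix.of fun i c => if i = σ (Sum.inr c) then 1 else 0
  have hE : ∀ X : Matrix ι ι ℝ, X.submatrix (σ ∘ Sum.inr) (σ ∘ Sum.inr) = Eᵀ * X * E := fun X => by
    ext c c'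
    simp [Matrix.mul_apply, E]
  let Q := Matrix.fromCols (frameMat σ A) E
  have hQ : (Qᵀ * g * Q).det = g.det := by
    have h1 : Q.submatrix σ id = Matrix.fromBlocks 1 0 (toMat A) 1 := by
      ext i j
      rcases i with i | i <;> rcases j with j | j <;>
        simp [Q, E, frameMat, toMat, Matrix.one_apply]
    have h2 : Qᵀ * g * Q = (Q.submatrix σ id)ᵀ * g.submatrix σ σ * Q.submatrix σ id := by
      rw [transpose_submatrix, Matrix.submatrix_mul_equiv, Matrix.submatrix_mul_equiv,
        Matrix.submatrix_id_id]
    rw [h2, h1, det_mul, det_mul, det_transpose, det_fromBlocks_zero₁₂, det_submatrix_equiv_self]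
    simp
  have hQ' : Qᵀ * g * Q = Matrix.fromBlocks (frameGram σ g A) ((frameMat σ A)ᵀ * g * E)
      (Eᵀ * g * frameMat σ A) (Eᵀ * g * E) := by
    rw [Matrix.transpose_fromCols, Matrix.fromRows_mul, Matrix.fromRows_mul_fromCols, frameGram]
  let _ : Invertible (frameGram σ g A) := Matrix.invertibleOfIsUnitDet _ hH
  rw [hQ', det_fromBlocks₁₁, Matrix.invOf_eq_nonsing_inv] at hQ
  rw [eq_div_iff hH.ne_zero, mul_comm, ← hQ, hE]
  congr 2
  rw [frameSchur, frameProj, framePinv, Matrix.mul_sub, Matrix.mul_sub, Matrix.sub_mul,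
    Matrix.mul_one]
  simp only [Matrix.mul_assoc]

theorem det_fibreGram (hg : g.PosDef) :
    (fibreGram σ A g).det = g.det ^ 2 / (frameGram σ g A).det ^ (n + 2) := by
  have hH := (isUnit_det_frameGram σ A hg).ne_zero
  rw [fibreGram, det_kronecker, det_frameSchur σ A hg, det_nonsing_inv, Ring.inverse_eq_inv',
    Fintype.card_fin, Fintype.card_fin, inv_pow, div_pow, pow_add]
  field_simp

/-- The determinant of the Gram matrix of a bundle metric: the product of the determinants of the
base metric and of the fibre metric. -/
theorem det_bundleGram {κ : Type*} [Fintype κ] [DecidableEq κ] {G : Matrix κ κ ℝ}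
    {N : κ ⊕ (Fin n × Fin 2) → Matrix ι (Fin 2) ℝ} (hg : g.PosDef)
    (hN : ∀ q, N (Sum.inr q) = coordUnit σ q) :
    (Matrix.fromBlocks G 0 0 0 + Matrix.of fun a b => tangentForm σ A g (N a) (N b)).det =
      G.det * (g.det ^ 2 / (frameGram σ g A).det ^ (n + 2)) := by
  let Λ : Matrix κ (Fin n × Fin 2) ℝ := Matrix.of fun i q => frameComp σ A (N (Sum.inl i)) q
  set K := fibreGram σ A g with hK
  have h1 : ∀ i q, tangentForm σ A g (N (Sum.inl i)) (coordUnit σ q) = (Λ * K) i q := fun i q => by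
    rw [tangentForm_left σ A hg, Matrix.mul_apply]
    exact Finset.sum_congr rfl fun q' _ => by rw [tangentForm_coordUnit σ A hg]; rfl
  have hKt : Kᵀ = K := by
    ext q q'
    rw [transpose_apply, hK, ← tangentForm_coordUnit σ A hg, ← tangentForm_coordUnit σ A hg,
      tangentForm_symm σ A hg]
  have h2 : ∀ i q, tangentForm σ A g (coordUnit σ q) (N (Sum.inl i)) = (K * Λᵀ) q i := fun i q => by
    rw [tangentForm_symm σ A hg, h1, ← Matrix.transpose_apply (Λ * K), transpose_mul, hKt]
  have h3 : ∀ i j, tangentForm σ A g (N (Sum.inl i)) (N (Sum.inl j)) = (Λ * K * Λᵀ) i j := by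
    intro i j
    rw [tangentForm_left σ A hg, Matrix.mul_assoc, Matrix.mul_apply]
    exact Finset.sum_congr rfl fun q' _ => by rw [h2]; rfl
  -- The Gram matrix splits off unipotent block-triangular factors, because the vertical component
  -- of a coordinate direction of the base is a combination of the fibre directions.
  have h4 : (Matrix.fromBlocks G 0 0 0 + Matrix.of fun a b => tangentForm σ A g (N a) (N b)) =
      Matrix.fromBlocks 1 Λ 0 1 * Matrix.fromBlocks G 0 0 K * Matrix.fromBlocks 1 0 Λᵀ 1 := by
    rw [Matrix.fromBlocks_multiply, Matrix.fromBlocks_multiply]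
    ext a b
    rcases a with a | a <;> rcases b with b | b
    · simp [h3]
    · simp [hN, h1]
    · simp [hN, h2]
    · simp [hN, tangentForm_coordUnit σ A hg, hK]
  rw [h4, det_mul, det_mul, det_fromBlocks_zero₂₁, det_fromBlocks_zero₁₂, det_fromBlocks_zero₁₂,
    hK, det_fibreGram σ A hg]
  simp

end GramDet

/-! ### The Gram determinant of the Grassmann bundle: derivatives of the projections -/

section MatrixDeriv

set_option linter.unusedSectionVars false

open Matrix

variable {W : Type*} [NormedAddCommGroup W] [NormedSpace ℝ W] {κ l k : Type*} [Fintype κ] [Fintype l]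
  [Fintype k]

/-- The derivative of a matrix-valued function in the direction `u`, entry by entry. -/
def matDeriv (N : W → Matrix κ l ℝ) (w u : W) : Matrix κ l ℝ :=
  Matrix.of fun i j => fderiv ℝ (fun v => N v i j) w u

theorem matDeriv_mul {N : W → Matrix κ l ℝ} {N' : W → Matrix l k ℝ} {w : W}
    (hN : ∀ i j, DifferentiableAt ℝ (fun v => N v i j) w)
    (hN' : ∀ i j, DifferentiableAt ℝ (fun v => N' v i j) w) (u : W) :
    matDeriv (fun v => N v * N' v) w u = matDeriv N w u * N' w + N w * matDeriv N' w u := by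
  ext i j
  have h := HasFDerivAt.fun_sum (u := Finset.univ) fun a _ =>
    (hN i a).hasFDerivAt.mul (hN' a j).hasFDerivAt
  simp only [matDeriv, Matrix.of_apply, Matrix.mul_apply, Matrix.add_apply]
  have h' := h.fderiv
  simp only [Pi.mul_def] at h'
  rw [h', _root_.sum_apply, ← Finset.sum_add_distrib]
  refine Finset.sum_congr rfl fun a _ => ?_
  simp only [_root_.add_apply, _root_.smul_apply, smul_eq_mul]
  ring

theorem matDeriv_congr {N N' : W → Matrix κ l ℝ} {w : W} (h : ∀ᶠ v in 𝓝 w, N v = N' v) (u : W) :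
    matDeriv N w u = matDeriv N' w u := by
  ext i j
  simp only [matDeriv, Matrix.of_apply]
  have h' : (fun v => N v i j) =ᶠ[𝓝 w] fun v => N' v i j := h.mono fun v hv => by simp only [hv]
  rw [h'.fderiv_eq]

end MatrixDeriv

section GrGram

set_option linter.unusedSectionVars false
set_option synthInstance.maxHeartbeats 400000

open Matrix

variable {m : ℕ} {M : Type*} [TopologicalSpace M] [ChartedSpace (Coord m) M]
  [IsManifold (𝓡 m) ∞ M] {e : OpenPartialHomeomorph M (Coord m)}
  [RiemannianBundle (fun x : M => TangentSpace (𝓡 m) x)]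
  (σ : Fin 2 ⊕ Fin (m - 2) ≃ Fin m)

theorem graphFrame_eq (e : OpenPartialHomeomorph M (Coord m)) (w : GrCoord m) (a : Fin 2) :
    graphFrame e σ w a = frameVec (coordVec e (e.symm w.1)) (unMat (frameMat σ w.2)) a := by
  rw [graphFrame, frameVec, ← σ.sum_comp, Fintype.sum_sum_type]
  simp [unMat, frameMat, Matrix.one_apply]

/-- The coordinate matrix of the orthogonal projection onto the plane in graph coordinates. -/
theorem projCoeff_eq_frameProj (he : e ∈ atlas (Coord m) M) {w : GrCoord m} (hw : w ∈ grDomain e) :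
    projCoeff e σ w = frameProj σ (metricCoeff e w.1) w.2 := by
  have hg := posDef_metricCoeff he hw
  have hq := e.map_target hw
  set g := metricCoeff e w.1 with hgdef
  set P := frameProj σ g w.2 with hP
  ext k j
  have hproj : (graphPlane e σ w).starProjection (coordVec e (e.symm w.1) j) =
      ∑ i, P i j • coordVec e (e.symm w.1) i := by
    refine Submodule.eq_starProjection_of_mem_of_inner_eq_zero ?_ ?_
    · have : ∑ i, P i j • coordVec e (e.symm w.1) i =
          ∑ a, framePinv σ g w.2 a j • graphFrame e σ w a := by
        simp_rw [graphFrame_eq, frameVec, hP, frameProj, Matrix.mul_apply, Finset.sum_smul,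
          Finset.smul_sum, smul_smul]
        rw [Finset.sum_comm]
        exact Finset.sum_congr rfl fun a _ => Finset.sum_congr rfl fun i _ => by
          rw [mul_comm]; rfl
      rw [this]
      exact Submodule.sum_mem _ fun a _ => Submodule.smul_mem _ _ (Submodule.subset_span ⟨a, rfl⟩)
    · intro v hv
      have key : ∀ a, inner ℝ (coordVec e (e.symm w.1) j - ∑ i, P i j • coordVec e (e.symm w.1) i)
          (graphFrame e σ w a) = 0 := fun a => by
        have h0 : (g * frameMat σ w.2 - Pᵀ * g * frameMat σ w.2) j a = 0 := by
          rw [← metric_mul_frameProj σ w.2 hg, Matrix.mul_assoc, frameProj_mul σ w.2 hg, sub_self]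
          rfl
        rw [graphFrame_eq, frameVec]
        simp only [inner_sub_left, sum_inner, inner_sum, inner_smul_left, inner_smul_right,
          conj_trivial]
        rw [Matrix.mul_assoc, Matrix.sub_apply] at h0
        simp only [Matrix.mul_apply, transpose_apply] at h0
        have h1 : ∀ i j, inner ℝ (coordVec e (e.symm w.1) i) (coordVec e (e.symm w.1) j) = g i j :=
          fun _ _ => rfl
        refine Eq.trans ?_ h0
        simp only [h1, unMat, mul_sub, Finset.sum_sub_distrib, Finset.mul_sum]
        refine congrArg₂ (fun x y : ℝ => x - y) ?_ ?_
        · exact Finset.sum_congr rfl fun i _ => mul_comm _ _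
        · rw [Finset.sum_comm]
          refine Finset.sum_congr rfl fun i _ => Finset.sum_congr rfl fun i _ => ?_
          ring
      induction hv using Submodule.span_induction with
      | mem x hx => obtain ⟨a, rfl⟩ := hx; exact key a
      | zero => exact inner_zero_right _
      | add x y _ _ hx hy => rw [inner_add_right, hx, hy, add_zero]
      | smul r x _ hx => rw [inner_smul_right, hx, mul_zero]
  rw [projCoeff, Matrix.of_apply, hproj, map_sum, Finset.sum_eq_single k]
  · rw [map_smul, coordForm, ContinuousLinearMap.comp_apply, chartD_coordVec he hq]
    simp
  · intro i _ hi
    rw [map_smul, coordForm, ContinuousLinearMap.comp_apply, chartD_coordVec he hq]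
    simp [hi.symm]
  · simp

theorem hasFDerivAt_frameMat (w : GrCoord m) (i : Fin m) (a : Fin 2) :
    ∃ L : GrCoord m →L[ℝ] ℝ, HasFDerivAt (fun v : GrCoord m => frameMat σ v.2 i a) L w ∧
      (∀ u, L (u, 0) = 0) ∧ ∀ q, L (0, Pi.single q 1) = coordUnit σ q i a := by
  obtain ⟨i, rfl⟩ := σ.surjective i
  rcases i with c | c
  · refine ⟨0, ?_, by simp, by simp [coordUnit]⟩
    simp only [frameMat, Matrix.of_apply, Equiv.symm_apply_apply, Sum.elim_inl]
    exact hasFDerivAt_const _ _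
  · refine ⟨(ContinuousLinearMap.proj (c, a)).comp (ContinuousLinearMap.snd ℝ _ _), ?_, by simp, ?_⟩
    · simp only [frameMat, Matrix.of_apply, Equiv.symm_apply_apply, Sum.elim_inr]
      exact ((ContinuousLinearMap.proj (R := ℝ) (φ := fun _ => ℝ) (c, a)).comp
        (ContinuousLinearMap.snd ℝ (Coord m) (Fin (m - 2) × Fin 2 → ℝ))).hasFDerivAt
    · rintro ⟨c', a'⟩
      simp [coordUnit, Pi.single_apply]

variable [IsContMDiffRiemannianBundle (𝓡 m) ∞ (Coord m) (fun x : M => TangentSpace (𝓡 m) x)]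

theorem isOpen_grDomain (e : OpenPartialHomeomorph M (Coord m)) : IsOpen (grDomain e) :=
  e.open_target.preimage continuous_fst

theorem differentiableAt_metricCoeff_fst (he : e ∈ atlas (Coord m) M) {w : GrCoord m}
    (hw : w ∈ grDomain e) (i j : Fin m) :
    DifferentiableAt ℝ (fun v : GrCoord m => metricCoeff e v.1 i j) w :=
  DifferentiableAt.comp w (g := fun x => metricCoeff e x i j)
    (((contDiffOn_metricCoeff he i j).contDiffAt (e.open_target.mem_nhds hw)).differentiableAt
      (by simp)) differentiableAt_fst

theorem differentiableAt_projCoeff (he : e ∈ atlas (Coord m) M) {w : GrCoord m}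
    (hw : w ∈ grDomain e) (i j : Fin m) :
    DifferentiableAt ℝ (fun v : GrCoord m => projCoeff e σ v i j) w := by
  have hF : ∀ i a, ContDiffOn ℝ ∞ (fun v : GrCoord m => frameMat σ v.2 i a) (grDomain e) := by
    intro i a
    obtain ⟨i, rfl⟩ := σ.surjective i
    rcases i with c | c
    · simp only [frameMat, Matrix.of_apply, Equiv.symm_apply_apply, Sum.elim_inl]
      exact contDiffOn_const
    · simp only [frameMat, Matrix.of_apply, Equiv.symm_apply_apply, Sum.elim_inr]
      exact ((contDiff_apply ℝ ℝ (c, a)).comp contDiff_snd).contDiffOn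
  have hg : ∀ i j, ContDiffOn ℝ ∞ (fun v : GrCoord m => metricCoeff e v.1 i j) (grDomain e) :=
    fun i j => (contDiffOn_metricCoeff he i j).comp contDiff_fst.contDiffOn fun v hv => hv
  have hmul : ∀ {a b c : Type} [Fintype b] {N : GrCoord m → Matrix a b ℝ}
      {N' : GrCoord m → Matrix b c ℝ} (_ : ∀ i j, ContDiffOn ℝ ∞ (fun v => N v i j) (grDomain e))
      (_ : ∀ i j, ContDiffOn ℝ ∞ (fun v => N' v i j) (grDomain e)),
      ∀ i j, ContDiffOn ℝ ∞ (fun v => (N v * N' v) i j) (grDomain e) := by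
    intro a b c _ N N' h h' i j
    simp only [Matrix.mul_apply]
    exact ContDiffOn.sum fun s _ => (h i s).mul (h' s j)
  have hFt : ∀ a i, ContDiffOn ℝ ∞ (fun v : GrCoord m => (frameMat σ v.2)ᵀ a i) (grDomain e) :=
    fun a i => hF i a
  have hH := hmul (hmul hFt hg) hF
  have hHi := contDiffOn_inv hH fun v hv =>
    (isUnit_det_frameGram σ v.2 (posDef_metricCoeff he hv)).ne_zero
  have hP := hmul hF (hmul hHi (hmul hFt hg)) i j
  have hd := (hP.contDiffAt ((isOpen_grDomain e).mem_nhds hw)).differentiableAt (by simp)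
  refine hd.congr_of_eventuallyEq ?_
  filter_upwards [(isOpen_grDomain e).mem_nhds hw] with v hv
  rw [projCoeff_eq_frameProj σ he hv]
  rfl

theorem covProj_eq_projDeriv_aux (he : e ∈ atlas (Coord m) M) {w : GrCoord m} (hw : w ∈ grDomain e)
    (u : GrCoord m) {Γ : Matrix (Fin m) (Fin m) ℝ}
    (hΓ : matDeriv (fun v : GrCoord m => metricCoeff e v.1) w u =
      metricCoeff e w.1 * Γ + Γᵀ * metricCoeff e w.1) :
    matDeriv (projCoeff e σ) w u + (Γ * projCoeff e σ w - projCoeff e σ w * Γ) =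
      projDeriv σ w.2 (metricCoeff e w.1)
        (matDeriv (fun v : GrCoord m => frameMat σ v.2) w u + Γ * frameMat σ w.2) := by
  have hg := posDef_metricCoeff he hw
  have hdP := differentiableAt_projCoeff σ he hw
  have hdg := differentiableAt_metricCoeff_fst he hw
  have hdF : ∀ i a, DifferentiableAt ℝ (fun v : GrCoord m => frameMat σ v.2 i a) w := fun i a =>
    (hasFDerivAt_frameMat σ w i a).choose_spec.1.differentiableAt
  have hnear : ∀ᶠ v in 𝓝 w, v ∈ grDomain e := (isOpen_grDomain e).mem_nhds hw
  have hPw := projCoeff_eq_frameProj σ he hw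
  have h1 := matDeriv_congr (hnear.mono fun v hv => by
    show projCoeff e σ v * frameMat σ v.2 = frameMat σ v.2
    rw [projCoeff_eq_frameProj σ he hv, frameProj_mul σ _ (posDef_metricCoeff he hv)]) u
  have h2 := matDeriv_congr (hnear.mono fun v hv => by
    show projCoeff e σ v * projCoeff e σ v = projCoeff e σ v
    rw [projCoeff_eq_frameProj σ he hv, frameProj_mul_self σ _ (posDef_metricCoeff he hv)]) u
  have h3 := matDeriv_congr (hnear.mono fun v hv => by
    show metricCoeff e v.1 * projCoeff e σ v = (projCoeff e σ v)ᵀ * metricCoeff e v.1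
    rw [projCoeff_eq_frameProj σ he hv, metric_mul_frameProj σ _ (posDef_metricCoeff he hv)]) u
  rw [matDeriv_mul hdP hdF, hPw] at h1
  rw [matDeriv_mul hdP hdP, hPw] at h2
  rw [matDeriv_mul hdg hdP, matDeriv_mul (N := fun v => (projCoeff e σ v)ᵀ) (fun i j => hdP j i) hdg, hPw] at h3
  rw [hPw]
  exact covariant_eq_projDeriv σ w.2 hg h1 h2 h3 hΓ

/-- The change of the frame that corresponds to a coordinate direction of the Grassmann bundle. -/
def frameVariation (e : OpenPartialHomeomorph M (Coord m)) (w : GrCoord m) :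
    Fin m ⊕ (Fin (m - 2) × Fin 2) → Matrix (Fin m) (Fin 2) ℝ :=
  Sum.elim (fun i => (Matrix.of fun k j => christoffel e k i j w.1) * frameMat σ w.2)
    (fun q => coordUnit σ q)

theorem partialD_metricCoeff (he : e ∈ atlas (Coord m) M) {x : Coord m} (hx : x ∈ e.target)
    (i j l : Fin m) : partialD i (fun y => metricCoeff e y j l) x =
      ∑ k, christoffel e k i j x * metricCoeff e x k l +
        ∑ k, christoffel e k i l x * metricCoeff e x j k := by
  have h := connForm_compat he hx (EuclideanSpace.single i 1) (EuclideanSpace.single j 1)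
    (EuclideanSpace.single l 1)
  rw [fderiv_apply₂ (differentiableAt_metricForm he hx)] at h
  simp only [metricForm, connForm, bilin_single] at h
  rw [partialD, h, bilin_apply, bilin_apply, Finset.sum_comm (γ := Fin m)]
  congr 1
  · rw [Finset.sum_eq_single l (fun a _ ha => by simp [ha]) (by simp)]
    simp
  · rw [Finset.sum_eq_single j (fun a _ ha => by simp [ha]) (by simp)]
    simp

theorem covProj_eq_projDeriv (he : e ∈ atlas (Coord m) M) {w : GrCoord m} (hw : w ∈ grDomain e)
    (a : Fin m ⊕ (Fin (m - 2) × Fin 2)) :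
    covProj e σ w a = projDeriv σ w.2 (metricCoeff e w.1) (frameVariation σ e w a) := by
  have hgd : ∀ j l (u : GrCoord m), fderiv ℝ (fun v : GrCoord m => metricCoeff e v.1 j l) w u =
      fderiv ℝ (fun y => metricCoeff e y j l) w.1 u.1 := fun j l u => by
    have hd := (((contDiffOn_metricCoeff he j l).contDiffAt
      (e.open_target.mem_nhds hw)).differentiableAt (by simp)).hasFDerivAt
    have := (HasFDerivAt.comp w (g := fun y => metricCoeff e y j l) hd hasFDerivAt_fst).fderiv
    rw [show (fun v : GrCoord m => metricCoeff e v.1 j l) =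
      (fun y => metricCoeff e y j l) ∘ Prod.fst from rfl, this]
    rfl
  rcases a with i | q
  · have h := covProj_eq_projDeriv_aux σ he hw (grBasis (Sum.inl i))
      (Γ := Matrix.of fun k j => christoffel e k i j w.1) ?_
    · have hF : matDeriv (fun v : GrCoord m => frameMat σ v.2) w (grBasis (Sum.inl i)) = 0 := by
        ext k a
        obtain ⟨L, h1, h2, -⟩ := hasFDerivAt_frameMat σ w k a
        rw [matDeriv, Matrix.of_apply, h1.fderiv]
        exact h2 _
      rw [hF, zero_add] at h
      exact h
    · ext j l
      rw [matDeriv, Matrix.of_apply, hgd]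
      have := partialD_metricCoeff he hw i j l
      rw [partialD] at this
      refine this.trans ?_
      rw [Matrix.add_apply, Matrix.mul_apply, Matrix.mul_apply, add_comm]
      simp only [Matrix.of_apply, transpose_apply, mul_comm]
  · have h := covProj_eq_projDeriv_aux σ he hw (grBasis (Sum.inr q)) (Γ := 0) ?_
    · have hF : matDeriv (fun v : GrCoord m => frameMat σ v.2) w (grBasis (Sum.inr q)) =
          coordUnit σ q := by
        ext k a
        obtain ⟨L, h1, -, h2⟩ := hasFDerivAt_frameMat σ w k a
        rw [matDeriv, Matrix.of_apply, h1.fderiv]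
        exact h2 _
      rw [hF] at h
      rw [Matrix.zero_mul, Matrix.zero_mul, Matrix.mul_zero, sub_zero, add_zero, add_zero] at h
      exact h
    · ext j l
      rw [matDeriv, Matrix.of_apply, hgd]
      simp [grBasis]

/-- The volume density of the Grassmann bundle is the product of the volume density of the base and
of the volume density `det g · frameDensity` of the fibre. -/
theorem sqrt_det_grGram (he : e ∈ atlas (Coord m) M) {w : GrCoord m} (hw : w ∈ grDomain e) :
    ENNReal.ofReal √(grGram e σ w).det = ENNReal.ofReal √(metricCoeff e w.1).det *
      (ENNReal.ofReal (metricCoeff e w.1).det * frameDensity σ (metricCoeff e w.1) w.2) := by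
  have hg := posDef_metricCoeff he hw
  have hH := (posDef_frameMat σ hg w.2).det_pos
  have h1 : grGram e σ w = Matrix.fromBlocks (metricCoeff e w.1) 0 0 0 +
      Matrix.of fun a b => tangentForm σ w.2 (metricCoeff e w.1) (frameVariation σ e w a)
        (frameVariation σ e w b) := by
    rw [grGram]
    congr 2
    funext a b
    rw [covProj_eq_projDeriv σ he hw, covProj_eq_projDeriv σ he hw,
      half_trace_projDeriv_mul σ w.2 hg]
  rw [h1, det_bundleGram σ w.2 hg (fun q => rfl), frameDensity,
    ← ENNReal.ofReal_mul hg.det_pos.le, ← ENNReal.ofReal_mul (Real.sqrt_nonneg _),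
    Real.sqrt_mul hg.det_pos.le, Real.sqrt_div' _ (by positivity), Real.sqrt_sq hg.det_pos.le,
    div_eq_mul_inv]
  congr 4
  rw [Real.sqrt_eq_iff_mul_self_eq (by positivity) (by positivity), ← mul_pow,
    Real.mul_self_sqrt hH.le]
  rfl

end GrGram

/-! ### Gluing of measures -/

section Glue

variable {ι X : Type*} [MeasurableSpace X] {μ : ι → Measure X} {U : ι → Set X}

/-- Measures on patches that agree on the overlaps glue: their supremum can be computed from any
countable partition subordinate to the patches. -/
theorem iSup_eq_sum_restrict (hU : ∀ i, μ i (U i)ᶜ = 0) (hUm : ∀ i, MeasurableSet (U i))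
    (hc : ∀ i j S, MeasurableSet S → S ⊆ U i ∩ U j → μ i S = μ j S) {D : ℕ → Set X} {c : ℕ → ι}
    (hDm : ∀ n, MeasurableSet (D n)) (hDd : Pairwise (Function.onFun Disjoint D))
    (hDU : ∀ n, D n ⊆ U (c n)) (hD : ⋃ n, D n = Set.univ) :
    ⨆ i, μ i = Measure.sum fun n => (μ (c n)).restrict (D n) := by
  have hsplit : ∀ (ν : Measure X) S, MeasurableSet S → ν S = ∑' n, ν (S ∩ D n) := fun ν S hS => by
    rw [← measure_iUnion (fun i j h => (hDd h).mono Set.inter_subset_right Set.inter_subset_right)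
      fun n => hS.inter (hDm n), ← Set.inter_iUnion, hD, Set.inter_univ]
  have hsum : ∀ S, MeasurableSet S →
      Measure.sum (fun n => (μ (c n)).restrict (D n)) S = ∑' n, μ (c n) (S ∩ D n) := fun S hS => by
    rw [Measure.sum_apply _ hS]
    exact tsum_congr fun n => Measure.restrict_apply hS
  refine le_antisymm (iSup_le fun i => Measure.le_iff.2 fun S hS => ?_)
    (Measure.le_iff.2 fun S hS => ?_)
  · rw [hsplit _ S hS, hsum S hS]
    refine ENNReal.tsum_le_tsum fun n => ?_
    have h1 : μ i (S ∩ D n) = μ i (S ∩ D n ∩ U i) := by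
      refine (measure_inter_add_sdiff _ (hUm i)).symm.trans ?_
      rw [measure_mono_null (s := (S ∩ D n) \ U i) (fun x hx => hx.2) (hU i), add_zero]
    rw [h1, hc i (c n) _ ((hS.inter (hDm n)).inter (hUm i)) fun x hx => ⟨hx.2, hDU n hx.1.2⟩]
    exact measure_mono Set.inter_subset_left
  · rw [hsum S hS, hsplit _ S hS]
    exact ENNReal.tsum_le_tsum fun n => le_iSup μ (c n) _

theorem iSup_apply_of_subset (hU : ∀ i, μ i (U i)ᶜ = 0) (hUm : ∀ i, MeasurableSet (U i))
    (hc : ∀ i j S, MeasurableSet S → S ⊆ U i ∩ U j → μ i S = μ j S) {D : ℕ → Set X} {c : ℕ → ι}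
    (hDm : ∀ n, MeasurableSet (D n)) (hDd : Pairwise (Function.onFun Disjoint D))
    (hDU : ∀ n, D n ⊆ U (c n)) (hD : ⋃ n, D n = Set.univ) {i : ι} {S : Set X}
    (hS : MeasurableSet S) (hSU : S ⊆ U i) : (⨆ i, μ i) S = μ i S := by
  rw [iSup_eq_sum_restrict hU hUm hc hDm hDd hDU hD, Measure.sum_apply _ hS]
  simp_rw [Measure.restrict_apply hS]
  rw [tsum_congr fun n => hc (c n) i (S ∩ D n) (hS.inter (hDm n)) fun x hx =>
      ⟨hDU n hx.2, hSU hx.1⟩,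
    ← measure_iUnion (fun i j h => (hDd h).mono Set.inter_subset_right Set.inter_subset_right)
      fun n => hS.inter (hDm n), ← Set.inter_iUnion, hD, Set.inter_univ]

variable {W κ : Type*} [MeasureSpace W] [Fintype κ] [DecidableEq κ]

/-- The volume measure of a single coordinate patch. -/
def patchVolume (U : Set W) (φ : U → X) (G : W → Matrix κ κ ℝ) : Measure X :=
  Measure.map φ (Measure.comap Subtype.val
    (volume.withDensity fun w => ENNReal.ofReal √(G w).det))

theorem lintegral_patchVolume {U : Set W} (hU : MeasurableSet U) {φ : U → X} (hφ : Measurable φ)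
    {G : W → Matrix κ κ ℝ}
    (hG : AEMeasurable (fun w => ENNReal.ofReal √(G w).det) (volume.restrict U)) {F : X → ENNReal}
    (hF : Measurable F) {F' : W → ENNReal} (hF' : ∀ w : U, F (φ w) = F' w) :
    ∫⁻ x, F x ∂patchVolume U φ G = ∫⁻ w in U, ENNReal.ofReal √(G w).det * F' w := by
  rw [patchVolume, lintegral_map hF hφ]
  simp_rw [hF']
  rw [lintegral_subtype_comap hU, restrict_withDensity hU,
    lintegral_withDensity_eq_lintegral_mul_non_measurable₀ _ hG
      (Eventually.of_forall fun _ => ENNReal.ofReal_lt_top)]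
  rfl

end Glue

/-! ### The volume measure of the manifold -/

section ChartVolume

set_option linter.unusedSectionVars false

variable {m : ℕ} {M : Type*} [TopologicalSpace M] [ChartedSpace (Coord m) M]

theorem continuous_symm_target (e : OpenPartialHomeomorph M (Coord m)) :
    Continuous fun x : e.target => e.symm x.1 :=
  continuousOn_iff_continuous_domRestrict.1 e.continuousOn_symm

theorem exists_compact_cover (m : ℕ) (M : Type*) [TopologicalSpace M] [ChartedSpace (Coord m) M]
    [CompactSpace M] : ∃ (t : Finset M) (K : M → Set M),
      (∀ p, IsCompact (K p) ∧ K p ⊆ (chartAt (Coord m) p).source) ∧ ⋃ p ∈ t, K p = Set.univ := by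
  have := ChartedSpace.locallyCompactSpace (Coord m) M
  have h : ∀ p : M, ∃ s ∈ 𝓝 p, s ⊆ (chartAt (Coord m) p).source ∧ IsCompact s := fun p =>
    local_compact_nhds (chart_source_mem_nhds _ p)
  choose K hK using h
  obtain ⟨t, ht⟩ := CompactSpace.elim_nhds_subcover K fun p => (hK p).1
  exact ⟨t, K, fun p => ⟨(hK p).2.2, (hK p).2.1⟩, ht⟩

variable [MeasurableSpace M] [BorelSpace M]

theorem exists_chart_partition (m : ℕ) (M : Type*) [TopologicalSpace M] [ChartedSpace (Coord m) M]
    [MeasurableSpace M] [BorelSpace M] [CompactSpace M] [Nonempty M] :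
    ∃ (c : ℕ → atlas (Coord m) M) (D : ℕ → Set M), (∀ n, MeasurableSet (D n)) ∧
      Pairwise (Function.onFun Disjoint D) ∧ (∀ n, D n ⊆ (c n).1.source) ∧
      ⋃ n, D n = Set.univ := by
  obtain ⟨t, K, hK, ht⟩ := exists_compact_cover m M
  obtain ⟨p⟩ := ‹Nonempty M›
  have hne : Nonempty t := by
    have : p ∈ ⋃ p ∈ t, K p := ht ▸ Set.mem_univ p
    simp only [Set.mem_iUnion] at this
    obtain ⟨q, hq, -⟩ := this
    exact ⟨⟨q, hq⟩⟩
  obtain ⟨f, hf⟩ := exists_surjective_nat t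
  let e : ℕ → atlas (Coord m) M := fun n => ⟨chartAt (Coord m) (f n).1, chart_mem_atlas _ _⟩
  refine ⟨e, disjointed fun n => (e n).1.source,
    MeasurableSet.disjointed fun n => (e n).1.open_source.measurableSet, disjoint_disjointed _,
    fun n => disjointed_le (fun n => (e n).1.source) n, ?_⟩
  rw [iUnion_disjointed, Set.eq_univ_iff_forall]
  intro x
  have : x ∈ ⋃ p ∈ t, K p := ht ▸ Set.mem_univ x
  simp only [Set.mem_iUnion] at this
  obtain ⟨q, hq, hx⟩ := this
  obtain ⟨n, hn⟩ := hf ⟨q, hq⟩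
  refine Set.mem_iUnion.2 ⟨n, ?_⟩
  show x ∈ (chartAt (Coord m) (f n).1).source
  rw [hn]
  exact (hK q).2 hx

theorem measurableSet_target_inter (e : OpenPartialHomeomorph M (Coord m)) {S : Set M}
    (hS : MeasurableSet S) : MeasurableSet (e.target ∩ e.symm ⁻¹' S) := by
  have h := MeasurableSet.subtype_image e.open_target.measurableSet
    ((continuous_symm_target e).measurable hS)
  rwa [show Subtype.val '' ((fun x : e.target => e.symm x.1) ⁻¹' S) = e.target ∩ e.symm ⁻¹' S from
    Subtype.image_preimage_val e.target (e.symm ⁻¹' S)] at h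

/-- A function on `M` is measurable if it is measurable in all charts. -/
theorem measurable_of_charts [CompactSpace M] [Nonempty M] {β : Type*} [MeasurableSpace β]
    {f : M → β} (hf : ∀ e ∈ atlas (Coord m) M, Measurable fun x : e.target => f (e.symm x.1)) :
    Measurable f := by
  intro S hS
  obtain ⟨c, D, -, -, hDU, hD⟩ := exists_chart_partition m M
  have h1 : f ⁻¹' S = ⋃ n, Subtype.val '' {x : (c n).1.source | f x ∈ S} := by
    ext x
    refine ⟨fun hx => ?_, fun h => ?_⟩
    · obtain ⟨n, hn⟩ := Set.mem_iUnion.1 (hD ▸ Set.mem_univ x : x ∈ ⋃ n, D n)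
      exact Set.mem_iUnion.2 ⟨n, ⟨x, hDU n hn⟩, hx, rfl⟩
    · obtain ⟨n, y, hy, rfl⟩ := Set.mem_iUnion.1 h
      exact hy
  rw [h1]
  refine MeasurableSet.iUnion fun n => ?_
  refine MeasurableSet.subtype_image (c n).1.open_source.measurableSet ?_
  have h2 := (hf _ (c n).2).comp (c n).1.toHomeomorphSourceTarget.continuous.measurable
  have h3 : (fun x : (c n).1.source => f x) = (fun x : (c n).1.target => f ((c n).1.symm x.1)) ∘
      (c n).1.toHomeomorphSourceTarget := by
    funext x
    exact congrArg f ((c n).1.left_inv x.2).symm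
  show MeasurableSet ((fun x : (c n).1.source => f x) ⁻¹' S)
  rw [h3]
  exact h2 hS

variable [IsManifold (𝓡 m) ∞ M] {e e' : OpenPartialHomeomorph M (Coord m)}
  [RiemannianBundle (fun x : M => TangentSpace (𝓡 m) x)]

/-- The volume measure of the domain of a single chart. -/
def chartVolume (e : OpenPartialHomeomorph M (Coord m)) : Measure M :=
  patchVolume e.target (fun x => e.symm x.1) (metricCoeff e)

variable [IsContMDiffRiemannianBundle (𝓡 m) ∞ (Coord m) (fun x : M => TangentSpace (𝓡 m) x)]

theorem continuousOn_det_metricCoeff (he : e ∈ atlas (Coord m) M) :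
    ContinuousOn (fun x => (metricCoeff e x).det) e.target :=
  (contDiffOn_det fun i j => contDiffOn_metricCoeff he i j).continuousOn

theorem aemeasurable_sqrt_det_metricCoeff (he : e ∈ atlas (Coord m) M) :
    AEMeasurable (fun x => ENNReal.ofReal √(metricCoeff e x).det) (volume.restrict e.target) :=
  (Real.continuous_sqrt.comp_continuousOn (continuousOn_det_metricCoeff he)).aemeasurable
    e.open_target.measurableSet |>.ennreal_ofReal

theorem lintegral_chartVolume (he : e ∈ atlas (Coord m) M) {F : M → ENNReal} (hF : Measurable F) :
    ∫⁻ p, F p ∂chartVolume e =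
      ∫⁻ x in e.target, ENNReal.ofReal √(metricCoeff e x).det * F (e.symm x) :=
  lintegral_patchVolume e.open_target.measurableSet (continuous_symm_target e).measurable
    (aemeasurable_sqrt_det_metricCoeff he) hF fun _ => rfl

theorem det_metricCoeff_trans (he : e ∈ atlas (Coord m) M) (he' : e' ∈ atlas (Coord m) M)
    {x : Coord m} (hx : x ∈ (trans e e').source) : (metricCoeff e x).det =
      (fderiv ℝ (trans e e') x).det ^ 2 * (metricCoeff e' (trans e e' x)).det := by
  set L := fderiv ℝ (trans e e') x with hL
  let T : Matrix (Fin m) (Fin m) ℝ := Matrix.of fun i j => L (EuclideanSpace.single j 1) i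
  have h1 : metricCoeff e x = T.transpose * metricCoeff e' (trans e e' x) * T := by
    ext i j
    have h := metricForm_trans he he' hx (EuclideanSpace.single i 1) (EuclideanSpace.single j 1)
    rw [metricForm, bilin_single, metricForm, bilin_apply] at h
    rw [h]
    simp only [Matrix.mul_apply, Matrix.transpose_apply, T, Matrix.of_apply, Finset.sum_mul,
      smul_eq_mul]
    rw [Finset.sum_comm]
    exact Finset.sum_congr rfl fun _ _ => Finset.sum_congr rfl fun _ _ => by ring
  have h2 : L.det = T.det := by
    have : L.det = LinearMap.det (L : Coord m →ₗ[ℝ] Coord m) := rfl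
    rw [this, ← LinearMap.det_toMatrix (EuclideanSpace.basisFun (Fin m) ℝ).toBasis]
    congr 1
  rw [h1, h2, Matrix.det_mul, Matrix.det_mul, Matrix.det_transpose]
  ring

/-- The volume measures of two charts agree on the overlap of their domains. -/
theorem lintegral_chartVolume_eq (he : e ∈ atlas (Coord m) M) (he' : e' ∈ atlas (Coord m) M)
    {F : M → ENNReal} (hF : Measurable F) (hFe : ∀ p, p ∉ e.source ∩ e'.source → F p = 0) :
    ∫⁻ p, F p ∂chartVolume e = ∫⁻ p, F p ∂chartVolume e' := by
  have hT : ∀ {e e' : OpenPartialHomeomorph M (Coord m)}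
      (_ : ∀ p, p ∉ e.source ∩ e'.source → F p = 0),
      ∫⁻ x in e.target, ENNReal.ofReal √(metricCoeff e x).det * F (e.symm x) =
      ∫⁻ x in (trans e e').source, ENNReal.ofReal √(metricCoeff e x).det * F (e.symm x) := by
    intro e e' h
    rw [← lintegral_indicator e.open_target.measurableSet,
      ← lintegral_indicator (trans e e').open_source.measurableSet]
    refine lintegral_congr fun x => ?_
    by_cases hx : x ∈ (trans e e').source
    · rw [Set.indicator_of_mem hx, Set.indicator_of_mem (trans_source e e' ▸ hx).1]
    · rw [Set.indicator_of_notMem hx]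
      by_cases hx' : x ∈ e.target
      · rw [Set.indicator_of_mem hx', h, mul_zero]
        exact fun hp => hx (trans_source e e' ▸ ⟨hx', hp.2⟩)
      · rw [Set.indicator_of_notMem hx']
  rw [lintegral_chartVolume he hF, lintegral_chartVolume he' hF, hT hFe,
    hT (e' := e) (e := e') fun p hp => hFe p fun h => hp h.symm]
  have himg : (trans e' e).source = trans e e' '' (trans e e').source := by
    rw [OpenPartialHomeomorph.image_source_eq_target]
    rfl
  rw [himg, lintegral_image_eq_lintegral_abs_det_fderiv_mul volume
    (trans e e').open_source.measurableSet (f' := fderiv ℝ (trans e e'))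
    (fun x hx => ?_) (trans e e').injOn]
  · refine setLIntegral_congr_fun (trans e e').open_source.measurableSet fun x hx => ?_
    have hx' := hx
    rw [trans_source] at hx'
    have h3 : e'.symm (trans e e' x) = e.symm x := e'.left_inv hx'.2
    rw [det_metricCoeff_trans he he' hx, Real.sqrt_mul (sq_nonneg _), Real.sqrt_sq_eq_abs,
      ENNReal.ofReal_mul (abs_nonneg _), h3, mul_assoc]
  · exact (((contDiffOn_trans he he').contDiffAt
      ((trans e e').open_source.mem_nhds hx)).differentiableAt (by simp)).hasFDerivAt.hasFDerivWithinAt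

/-- The volume of a chart is carried by the domain of the chart. -/
theorem chartVolume_compl (he : e ∈ atlas (Coord m) M) : chartVolume e e.sourceᶜ = 0 := by
  have h := lintegral_chartVolume he (F := e.sourceᶜ.indicator 1)
    (measurable_one.indicator e.open_source.measurableSet.compl)
  rw [lintegral_indicator_one e.open_source.measurableSet.compl] at h
  rw [h, setLIntegral_congr_fun e.open_target.measurableSet (g := fun _ => 0)]
  · simp
  · intro x hx
    simp [e.map_target hx]

theorem chartVolume_apply_eq (he : e ∈ atlas (Coord m) M) (he' : e' ∈ atlas (Coord m) M)
    {S : Set M} (hS : MeasurableSet S) (hSe : S ⊆ e.source ∩ e'.source) :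
    chartVolume e S = chartVolume e' S := by
  rw [← lintegral_indicator_one hS, ← lintegral_indicator_one hS]
  exact lintegral_chartVolume_eq he he' (measurable_one.indicator hS) fun p hp =>
    Set.indicator_of_notMem (fun h => hp (hSe h)) _

variable [CompactSpace M] [Nonempty M]

theorem volM_eq_sum {c : ℕ → atlas (Coord m) M} {D : ℕ → Set M}
    (hDm : ∀ n, MeasurableSet (D n)) (hDd : Pairwise (Function.onFun Disjoint D))
    (hDU : ∀ n, D n ⊆ (c n).1.source) (hD : ⋃ n, D n = Set.univ) :
    volM m M = Measure.sum fun n => (chartVolume (c n).1).restrict (D n) :=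
  iSup_eq_sum_restrict (U := fun e : atlas (Coord m) M => e.1.source)
    (fun e => chartVolume_compl e.2) (fun e => e.1.open_source.measurableSet)
    (fun e e' _ hS h => chartVolume_apply_eq e.2 e'.2 hS h) hDm hDd hDU hD

theorem volM_apply (he : e ∈ atlas (Coord m) M) {S : Set M} (hS : MeasurableSet S)
    (hSe : S ⊆ e.source) : volM m M S = chartVolume e S := by
  obtain ⟨c, D, hDm, hDd, hDU, hD⟩ := exists_chart_partition m M
  exact iSup_apply_of_subset (U := fun e : atlas (Coord m) M => e.1.source) (i := ⟨e, he⟩)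
    (fun e => chartVolume_compl e.2) (fun e => e.1.open_source.measurableSet)
    (fun e e' _ hS h => chartVolume_apply_eq e.2 e'.2 hS h) hDm hDd hDU hD hS hSe

theorem chartVolume_eq_lintegral (he : e ∈ atlas (Coord m) M) {S : Set M} (hS : MeasurableSet S) :
    chartVolume e S = ∫⁻ x in e.target ∩ e.symm ⁻¹' S, ENNReal.ofReal √(metricCoeff e x).det := by
  rw [← lintegral_indicator_one hS, lintegral_chartVolume he (measurable_one.indicator hS),
    ← lintegral_indicator e.open_target.measurableSet, ← lintegral_indicator
      (measurableSet_target_inter e hS)]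
  refine lintegral_congr fun x => ?_
  by_cases hx : x ∈ e.target <;> by_cases hx' : e.symm x ∈ S <;> simp [hx, hx']

theorem volM_lt_top [T2Space M] : volM m M Set.univ < ⊤ := by
  obtain ⟨t, K, hK, ht⟩ := exists_compact_cover m M
  rw [← ht]
  refine measure_biUnion_lt_top t.finite_toSet fun p _ => ?_
  have he := chart_mem_atlas (Coord m) p
  set e := chartAt (Coord m) p
  have hKm := (hK p).1.isClosed.measurableSet
  rw [volM_apply he hKm (hK p).2, chartVolume_eq_lintegral he hKm]
  have h1 : e.target ∩ e.symm ⁻¹' K p = e '' K p := by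
    rw [e.image_eq_target_inter_inv_preimage (hK p).2]
  have hc : IsCompact (e '' K p) := (hK p).1.image_of_continuousOn (e.continuousOn.mono (hK p).2)
  rw [h1]
  obtain ⟨C, hC⟩ := hc.bddAbove_image (f := fun x => √(metricCoeff e x).det)
    ((Real.continuous_sqrt.comp_continuousOn (continuousOn_det_metricCoeff he)).mono
      (h1 ▸ Set.inter_subset_left))
  refine lt_of_le_of_lt (setLIntegral_mono measurable_const fun x hx =>
    ENNReal.ofReal_le_ofReal (hC ⟨x, hx, rfl⟩)) ?_
  rw [setLIntegral_const]
  exact ENNReal.mul_lt_top ENNReal.ofReal_lt_top hc.measure_lt_top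

theorem volM_pos : 0 < volM m M Set.univ := by
  obtain ⟨p⟩ := ‹Nonempty M›
  have he := chart_mem_atlas (Coord m) p
  set e := chartAt (Coord m) p
  refine lt_of_lt_of_le ?_ (measure_mono (Set.subset_univ e.source))
  rw [volM_apply he e.open_source.measurableSet subset_rfl,
    chartVolume_eq_lintegral he e.open_source.measurableSet]
  have h1 : e.target ∩ e.symm ⁻¹' e.source = e.target :=
    Set.inter_eq_left.2 fun x hx => e.map_target hx
  rw [h1, pos_iff_ne_zero]
  intro h
  rw [setLIntegral_eq_zero_iff' e.open_target.measurableSet (aemeasurable_sqrt_det_metricCoeff he)] at h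
  have h2 : volume e.target = 0 := by
    refine measure_mono_null (fun x hx => ?_) h
    simp only [Set.mem_compl_iff, Set.mem_ofPred_eq, not_forall]
    exact ⟨hx, by simpa using (posDef_metricCoeff he hx).det_pos⟩
  exact (e.open_target.measure_pos volume ⟨e p, e.map_source (mem_chart_source _ p)⟩).ne' h2

end ChartVolume

/-! ### The volume measure of the Grassmann bundle -/

section GrVolume

set_option linter.unusedSectionVars false

variable {m : ℕ} {M : Type*} [TopologicalSpace M] [ChartedSpace (Coord m) M]
  [IsManifold (𝓡 m) ∞ M] {e e' : OpenPartialHomeomorph M (Coord m)}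

theorem measurable_grParam (i : atlas (Coord m) M × (Fin 2 ⊕ Fin (m - 2) ≃ Fin m)) :
    Measurable (grParam i) :=
  measurable_iff_le_map.2 (iInf_le _ i)

/-- The projection of the Grassmann bundle. -/
def grProj (P : Gr2TM m M) : M := P.1

theorem measurable_grProj [MeasurableSpace M] [BorelSpace M] :
    Measurable (grProj : Gr2TM m M → M) := by
  intro S hS
  refine MeasurableSpace.measurableSet_iInf.2 fun i => ?_
  exact ((continuous_symm_target i.1.1).comp
    (f := fun w : grDomain i.1.1 => (⟨w.1.1, w.2⟩ : i.1.1.target)) (by fun_prop)).measurable hS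

theorem measurable_of_grParam {β : Type*} [MeasurableSpace β] {f : Gr2TM m M → β}
    (h : ∀ i : atlas (Coord m) M × (Fin 2 ⊕ Fin (m - 2) ≃ Fin m),
      Measurable fun w : grDomain i.1.1 => f (grParam i w)) : Measurable f := fun _ hS =>
  MeasurableSpace.measurableSet_iInf.2 fun i => h i hS

variable [RiemannianBundle (fun x : M => TangentSpace (𝓡 m) x)]

/-- An orthonormal basis of a tangent space. -/
def tangentBasis (q : M) : OrthonormalBasis (Fin m) ℝ (TangentSpace (𝓡 m) q) :=
  (stdOrthonormalBasis ℝ (TangentSpace (𝓡 m) q)).reindex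
    (finCongr (finrank_euclideanSpace_fin (𝕜 := ℝ) (n := m)))

open Classical in
/-- A function of planes as a function of pairs of vectors, extended by zero to linearly dependent
vectors. -/
def planeFun (F : Gr2TM m M → ENNReal) (q : M) (X Y : TangentSpace (𝓡 m) q) : ENNReal :=
  if h : Module.finrank ℝ (Submodule.span ℝ {X, Y}) = 2 then F ⟨q, Submodule.span ℝ {X, Y}, h⟩
  else 0

/-- The average of `F` over the planes in `T_q M`, realized as the mean value over the planes
spanned by two independent standard Gaussian vectors. -/
def grAverage (F : Gr2TM m M → ENNReal) (q : M) : ENNReal :=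
  ∫⁻ Z, planeFun F q (vec (tangentBasis q) (col Z 0)) (vec (tangentBasis q) (col Z 1))
    ∂stdGauss (Fin m × Fin 2)

theorem grAverage_eq_lintegral (hm : 2 ≤ m) {F : Gr2TM m M → ENNReal} {q : M}
    {G : TangentSpace (𝓡 m) q → TangentSpace (𝓡 m) q → ENNReal}
    (hG : ∀ (S : Gr2 (TangentSpace (𝓡 m) q)) X Y, S.1 = Submodule.span ℝ {X, Y} →
      F ⟨q, S⟩ = G X Y) :
    grAverage F q = ∫⁻ Z, G (vec (tangentBasis q) (col Z 0)) (vec (tangentBasis q) (col Z 1))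
      ∂stdGauss (Fin m × Fin 2) := by
  have σ : Fin 2 ⊕ Fin (m - 2) ≃ Fin m := finSumFinEquiv.trans (finCongr (by omega))
  refine lintegral_congr_ae ?_
  filter_upwards [ae_stdGauss_det_topBlock σ] with Z hZ
  have h := (finrank_span_frameVec σ (tangentBasis q).orthonormal.linearIndependent hZ).2
  rw [range_fin_two] at h
  have h' : Module.finrank ℝ (Submodule.span ℝ {vec (tangentBasis q) (col Z 0),
      vec (tangentBasis q) (col Z 1)}) = 2 := h
  rw [planeFun, dif_pos h']
  exact hG _ _ _ rfl

theorem grAverage_one (hm : 2 ≤ m) (q : M) : grAverage (m := m) (fun _ => 1) q = 1 := by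
  rw [grAverage_eq_lintegral hm (G := fun _ _ => 1) fun _ _ _ _ => rfl]
  simp

theorem grAverage_indicator (F : Gr2TM m M → ENNReal) (S : Set M) (q : M) :
    grAverage ((grProj ⁻¹' S).indicator F) q = S.indicator (grAverage F) q := by
  by_cases hq : q ∈ S
  · rw [Set.indicator_of_mem hq]
    unfold grAverage
    refine lintegral_congr fun Z => ?_
    rw [planeFun, planeFun]
    split_ifs with h
    · exact Set.indicator_of_mem (s := grProj ⁻¹' S) hq _
    · rfl
  · rw [Set.indicator_of_notMem hq]
    unfold grAverage
    rw [lintegral_eq_zero_of_ae_eq_zero]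
    refine Eventually.of_forall fun Z => ?_
    simp only [planeFun, Pi.zero_apply]
    split_ifs with h
    · exact Set.indicator_of_notMem (s := grProj ⁻¹' S) hq _
    · rfl

/-- The fibre average in graph coordinates over an arbitrary chart. -/
theorem grAverage_symm (he : e ∈ atlas (Coord m) M) (σ : Fin 2 ⊕ Fin (m - 2) ≃ Fin m)
    {F : Gr2TM m M → ENNReal} (hF : Measurable F) {x : Coord m} (hx : x ∈ e.target) :
    grAverage F (e.symm x) = planeConst (Fin m) (m - 2) *
      (ENNReal.ofReal (metricCoeff e x).det * ∫⁻ A, F (grParam (⟨e, he⟩, σ) ⟨(x, A), hx⟩) *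
        frameDensity σ (metricCoeff e x) A) := by
  have hE := linearIndependent_coordVec he (e.map_target hx)
  have hφ : Measurable fun A : Fin (m - 2) × Fin 2 → ℝ =>
      F (grParam (⟨e, he⟩, σ) ⟨(x, A), hx⟩) :=
    hF.comp ((measurable_grParam _).comp (measurable_prodMk_left.subtype_mk))
  refine lintegral_vec_eq_graphCoord σ (tangentBasis (e.symm x)) hE hφ fun Z hZ => ?_
  obtain ⟨h1, h2⟩ := finrank_span_frameVec σ hE hZ
  have h3 : Submodule.span ℝ {∑ i, Z (i, 0) • coordVec e (e.symm x) i,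
      ∑ i, Z (i, 1) • coordVec e (e.symm x) i} =
      Submodule.span ℝ (Set.range (frameVec (coordVec e (e.symm x)) Z)) := by
    rw [range_fin_two]; rfl
  rw [planeFun, dif_pos (h3 ▸ h2)]
  congr 1
  refine congrArg (Sigma.mk (β := fun p : M => Gr2 (TangentSpace (𝓡 m) p)) (e.symm x))
    (Subtype.ext ?_)
  refine (h3.trans h1).trans ?_
  show _ = graphPlane e σ (x, graphCoord σ Z)
  rw [graphPlane]
  congr 2
  funext a
  exact (graphFrame_eq σ e (x, graphCoord σ Z) a).symm

variable [IsContMDiffRiemannianBundle (𝓡 m) ∞ (Coord m) (fun x : M => TangentSpace (𝓡 m) x)]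

theorem continuousOn_frameGram_det (he : e ∈ atlas (Coord m) M)
    (σ : Fin 2 ⊕ Fin (m - 2) ≃ Fin m) : ContinuousOn (fun w : GrCoord m =>
      ((frameMat σ w.2).transpose * metricCoeff e w.1 * frameMat σ w.2).det) (grDomain e) := by
  have hF : ∀ i a, ContinuousOn (fun w : GrCoord m => frameMat σ w.2 i a) (grDomain e) :=
    fun i a => ((continuous_frameMat_elem σ i a).comp continuous_snd).continuousOn
  have hg : ∀ i j, ContinuousOn (fun w : GrCoord m => metricCoeff e w.1 i j) (grDomain e) :=
    fun i j => (contDiffOn_metricCoeff he i j).continuousOn.comp continuousOn_fst fun _ h => h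
  simp only [Matrix.det_fin_two, Matrix.mul_apply, Matrix.transpose_apply]
  fun_prop

theorem continuousOn_sqrt_inv_frameGram (he : e ∈ atlas (Coord m) M)
    (σ : Fin 2 ⊕ Fin (m - 2) ≃ Fin m) : ContinuousOn (fun w : GrCoord m =>
      (√((frameMat σ w.2).transpose * metricCoeff e w.1 * frameMat σ w.2).det ^ (m - 2 + 2))⁻¹)
      (grDomain e) := by
  refine ContinuousOn.inv₀ ((Real.continuous_sqrt.comp_continuousOn
    (continuousOn_frameGram_det he σ)).pow _) fun w hw => ?_
  exact pow_ne_zero _ (Real.sqrt_ne_zero'.2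
    (posDef_frameMat σ (posDef_metricCoeff he hw) w.2).det_pos)

theorem aemeasurable_frameDensity (he : e ∈ atlas (Coord m) M) (σ : Fin 2 ⊕ Fin (m - 2) ≃ Fin m) :
    AEMeasurable (fun w : GrCoord m => frameDensity σ (metricCoeff e w.1) w.2)
      (volume.restrict (grDomain e)) :=
  ((continuousOn_sqrt_inv_frameGram he σ).aemeasurable
    (isOpen_grDomain e).measurableSet).ennreal_ofReal

theorem measurable_frameDensity (he : e ∈ atlas (Coord m) M) (σ : Fin 2 ⊕ Fin (m - 2) ≃ Fin m) :
    Measurable fun p : e.target × (Fin (m - 2) × Fin 2 → ℝ) =>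
      frameDensity σ (metricCoeff e p.1.1) p.2 := by
  have h := (continuousOn_sqrt_inv_frameGram he σ).comp_continuous
    (f := fun p : e.target × (Fin (m - 2) × Fin 2 → ℝ) => ((p.1.1, p.2) : GrCoord m))
    (by fun_prop) fun p => p.1.2
  exact h.measurable.ennreal_ofReal

variable [MeasurableSpace M] [BorelSpace M]

theorem measurable_grAverage [CompactSpace M] [Nonempty M] (hm : 2 ≤ m) {F : Gr2TM m M → ENNReal}
    (hF : Measurable F) : Measurable (grAverage F) := by
  have σ : Fin 2 ⊕ Fin (m - 2) ≃ Fin m := finSumFinEquiv.trans (finCongr (by omega))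
  refine measurable_of_charts (m := m) fun e he => ?_
  simp_rw [fun x : e.target => grAverage_symm he σ hF x.2]
  refine Measurable.const_mul (Measurable.mul ?_ (Measurable.lintegral_prod_right' (f :=
    fun p : e.target × (Fin (m - 2) × Fin 2 → ℝ) => F (grParam (⟨e, he⟩, σ) ⟨(p.1.1, p.2), p.1.2⟩) *
      frameDensity σ (metricCoeff e p.1.1) p.2) (Measurable.mul ?_ ?_))) _
  · exact (continuousOn_iff_continuous_domRestrict.1
      (continuousOn_det_metricCoeff he)).measurable.ennreal_ofReal
  · refine hF.comp ((measurable_grParam _).comp (Measurable.subtype_mk ?_))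
    exact (measurable_subtype_coe.comp measurable_fst).prodMk measurable_snd
  · exact measurable_frameDensity he σ

/-- The volume measure of the domain of a single chart of the Grassmann bundle. -/
def grPatch (i : atlas (Coord m) M × (Fin 2 ⊕ Fin (m - 2) ≃ Fin m)) : Measure (Gr2TM m M) :=
  patchVolume (grDomain i.1.1) (grParam i) (grGram i.1.1 i.2)

/-- Integration over a chart domain of the Grassmann bundle amounts to integration of the averages
over the fibres. -/
theorem lintegral_grPatch (i : atlas (Coord m) M × (Fin 2 ⊕ Fin (m - 2) ≃ Fin m))
    {F : Gr2TM m M → ENNReal} (hF : Measurable F) (hav : Measurable (grAverage F)) :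
    planeConst (Fin m) (m - 2) * ∫⁻ P, F P ∂grPatch i =
      ∫⁻ q, grAverage F q ∂chartVolume i.1.1 := by
  classical
  obtain ⟨⟨e, he⟩, σ⟩ := i
  let F' : GrCoord m → ENNReal := fun w =>
    if h : w ∈ grDomain e then F (grParam (⟨e, he⟩, σ) ⟨w, h⟩) else 0
  have hDm := (isOpen_grDomain e).measurableSet
  have hF'm : Measurable F' :=
    Measurable.dite (hF.comp (measurable_grParam (⟨e, he⟩, σ))) measurable_const hDm
  have hdet1 : AEMeasurable (fun w : GrCoord m => ENNReal.ofReal √(metricCoeff e w.1).det)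
      (volume.restrict (grDomain e)) :=
    ((Real.continuous_sqrt.comp_continuousOn (continuousOn_det_metricCoeff he)).comp continuousOn_fst
      fun _ h => h).aemeasurable hDm |>.ennreal_ofReal
  have hdet2 : AEMeasurable (fun w : GrCoord m => ENNReal.ofReal (metricCoeff e w.1).det)
      (volume.restrict (grDomain e)) :=
    ((continuousOn_det_metricCoeff he).comp continuousOn_fst
      fun _ h => h).aemeasurable hDm |>.ennreal_ofReal
  have hρ := hdet1.mul (hdet2.mul (aemeasurable_frameDensity he σ))
  have hG : AEMeasurable (fun w => ENNReal.ofReal √(grGram e σ w).det)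
      (volume.restrict (grDomain e)) := by
    refine hρ.congr ?_
    filter_upwards [ae_restrict_mem hDm] with w hw
    exact (sqrt_det_grGram σ he hw).symm
  have h1 : ∫⁻ P, F P ∂grPatch (⟨e, he⟩, σ) = _ :=
    lintegral_patchVolume hDm (measurable_grParam (⟨e, he⟩, σ)) hG hF (F' := F')
      fun w => by simp only [F', dif_pos w.2]
  have h2 : (volume : Measure (GrCoord m)).restrict (grDomain e) =
      ((volume : Measure (Coord m)).restrict e.target).prod volume := by
    have : grDomain e = e.target ×ˢ (Set.univ : Set (Fin (m - 2) × Fin 2 → ℝ)) := by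
      ext w; simp [grDomain]
    rw [this, Measure.volume_eq_prod, ← Measure.prod_restrict, Measure.restrict_univ]
  have h3 : ∫⁻ w in grDomain e, ENNReal.ofReal √(grGram e σ w).det * F' w =
      ∫⁻ w in grDomain e, ENNReal.ofReal √(metricCoeff e w.1).det *
        (ENNReal.ofReal (metricCoeff e w.1).det * frameDensity σ (metricCoeff e w.1) w.2) * F' w :=
    setLIntegral_congr_fun hDm fun w hw => by rw [sqrt_det_grGram σ he hw]
  have hint := hρ.mul hF'm.aemeasurable
  rw [h2] at hint
  have hprod := lintegral_prod _ hint
  simp only [Pi.mul_apply] at hprod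
  rw [h1, h3, h2, hprod, lintegral_chartVolume he hav,
    ← lintegral_const_mul' _ _ (planeConst_ne_top σ)]
  refine setLIntegral_congr_fun e.open_target.measurableSet fun x hx => ?_
  rw [grAverage_symm he σ hF hx]
  have h4 : ∀ A, F' (x, A) = F (grParam (⟨e, he⟩, σ) ⟨(x, A), hx⟩) := fun A =>
    dif_pos (c := (x, A) ∈ grDomain e) hx
  have h5 : ∀ A, ENNReal.ofReal √(metricCoeff e x).det *
        (ENNReal.ofReal (metricCoeff e x).det * frameDensity σ (metricCoeff e x) A) * F' (x, A) =
      ENNReal.ofReal √(metricCoeff e x).det * ENNReal.ofReal (metricCoeff e x).det *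
        (F (grParam (⟨e, he⟩, σ) ⟨(x, A), hx⟩) * frameDensity σ (metricCoeff e x) A) := fun A => by
    rw [h4]; ring
  simp only [h5]
  rw [lintegral_const_mul' _ _ (ENNReal.mul_ne_top ENNReal.ofReal_ne_top ENNReal.ofReal_ne_top)]
  ring

theorem volGr_eq_iSup : volGr m M =
    ⨆ i : atlas (Coord m) M × (Fin 2 ⊕ Fin (m - 2) ≃ Fin m), grPatch i := rfl

variable [CompactSpace M] [Nonempty M]

/-- Integration over the Grassmann bundle amounts, up to a constant factor, to integration over `M`
of the averages over the fibres. -/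
theorem lintegral_volGr (hm : 2 ≤ m) {F : Gr2TM m M → ENNReal} (hF : Measurable F) :
    planeConst (Fin m) (m - 2) * ∫⁻ P, F P ∂volGr m M = ∫⁻ q, grAverage F q ∂volM m M := by
  have σ : Fin 2 ⊕ Fin (m - 2) ≃ Fin m := finSumFinEquiv.trans (finCongr (by omega))
  have hpatch := fun (i : atlas (Coord m) M × (Fin 2 ⊕ Fin (m - 2) ≃ Fin m))
    {F : Gr2TM m M → ENNReal} (hF : Measurable F) =>
    lintegral_grPatch i hF (measurable_grAverage hm hF)
  have hcancel : ∀ {a b : ENNReal}, planeConst (Fin m) (m - 2) * a = planeConst (Fin m) (m - 2) * b →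
      a = b := fun h =>
    (ENNReal.mul_right_inj (planeConst_ne_zero σ) (planeConst_ne_top σ)).1 h
  have hpr := measurable_grProj (m := m) (M := M)
  -- The measures of the patches are determined by the fibre averages and by the volumes of the
  -- charts of `M`, so that they inherit the compatibility from the latter.
  have hset : ∀ (i : atlas (Coord m) M × (Fin 2 ⊕ Fin (m - 2) ≃ Fin m)) {S : Set (Gr2TM m M)}
      (hS : MeasurableSet S) {T : Set M} (hST : S ⊆ grProj ⁻¹' T),
      planeConst (Fin m) (m - 2) * grPatch i S =
        ∫⁻ q, T.indicator (grAverage (S.indicator 1)) q ∂chartVolume i.1.1 := by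
    intro i S hS T hST
    rw [← lintegral_indicator_one hS, hpatch i (measurable_one.indicator hS)]
    refine lintegral_congr fun q => ?_
    rw [← grAverage_indicator, Set.indicator_indicator, Set.inter_eq_right.2 hST]
  obtain ⟨c, D, hDm, hDd, hDU, hD⟩ := exists_chart_partition m M
  have hvol : volGr m M = Measure.sum fun n =>
      (grPatch (c n, σ)).restrict (grProj ⁻¹' D n) := by
    rw [volGr_eq_iSup]
    refine iSup_eq_sum_restrict (c := fun n => (c n, σ)) (U := fun i : atlas (Coord m) M ×
      (Fin 2 ⊕ Fin (m - 2) ≃ Fin m) => grProj ⁻¹' i.1.1.source)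
      (fun i => ?_) (fun i => hpr i.1.1.open_source.measurableSet) (fun i j S hS hSU => ?_)
      (fun n => hpr (hDm n)) (fun a b h => (hDd h).preimage _)
      (fun n => Set.preimage_mono (hDU n)) ?_
    · have hT := i.1.1.open_source.measurableSet.compl
      refine hcancel ?_
      rw [hset i (hpr i.1.1.open_source.measurableSet).compl (T := i.1.1.sourceᶜ) subset_rfl,
        lintegral_indicator hT, mul_zero]
      exact setLIntegral_measure_zero _ _ (chartVolume_compl i.1.2)
    · refine hcancel ?_
      have hST : S ⊆ grProj ⁻¹' (i.1.1.source ∩ j.1.1.source) := hSU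
      rw [hset i hS hST, hset j hS hST]
      exact lintegral_chartVolume_eq i.1.2 j.1.2
        ((measurable_grAverage hm (measurable_one.indicator hS)).indicator
          (i.1.1.open_source.inter j.1.1.open_source).measurableSet)
        fun p hp => Set.indicator_of_notMem hp _
    · rw [← Set.preimage_iUnion, hD, Set.preimage_univ]
  rw [hvol, volM_eq_sum hDm hDd hDU hD, lintegral_sum_measure, lintegral_sum_measure,
    ← ENNReal.tsum_mul_left]
  refine tsum_congr fun n => ?_
  rw [← lintegral_indicator (hpr (hDm n)), hpatch _ (hF.indicator (hpr (hDm n))),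
    ← lintegral_indicator (hDm n)]
  exact lintegral_congr fun q => grAverage_indicator F (D n) q

theorem volGr_univ (hm : 2 ≤ m) :
    planeConst (Fin m) (m - 2) * volGr m M Set.univ = volM m M Set.univ := by
  have h := lintegral_volGr (M := M) hm (F := fun _ => 1) measurable_const
  simpa [grAverage_one hm] using h

end GrVolume

/-! ### The sectional curvature in coordinates -/

section GramPos

variable {V : Type*} [NormedAddCommGroup V] [InnerProductSpace ℝ V]

theorem area_pos_of_linearIndependent {X Y : V} (h : LinearIndependent ℝ ![X, Y]) :
    0 < (inner ℝ X X * inner ℝ Y Y - inner ℝ X Y ^ 2 : ℝ) := by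
  have h1 := (Matrix.posDef_gram_of_linearIndependent h).det_pos
  rw [Matrix.det_fin_two] at h1
  simp only [Matrix.gram_apply, Matrix.cons_val_zero, Matrix.cons_val_one] at h1
  rwa [real_inner_comm X Y, ← pow_two] at h1

theorem area_eq_zero_of_not_linearIndependent {X Y : V} (h : ¬LinearIndependent ℝ ![X, Y]) :
    (inner ℝ X X * inner ℝ Y Y - inner ℝ X Y ^ 2 : ℝ) = 0 := by
  rw [LinearIndependent.pair_iff] at h
  push Not at h
  obtain ⟨s, t, hst, hne⟩ := h
  have e1 : s * inner ℝ X X + t * inner ℝ X Y = (0 : ℝ) := by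
    have := congrArg (inner ℝ X) hst
    simpa [inner_add_right, inner_smul_right] using this
  have e2 : s * inner ℝ X Y + t * inner ℝ Y Y = (0 : ℝ) := by
    have := congrArg (inner ℝ Y) hst
    simpa [inner_add_right, inner_smul_right, real_inner_comm] using this
  by_cases hs : s = 0
  · refine (mul_eq_zero.1 (?_ : t * _ = 0)).resolve_left (hne hs)
    linear_combination inner ℝ X X * e2 - inner ℝ X Y * e1
  · refine (mul_eq_zero.1 (?_ : s * _ = 0)).resolve_left hs
    linear_combination inner ℝ Y Y * e1 - inner ℝ X Y * e2

theorem linearIndependent_pair_map {W : Type*} [AddCommGroup W] [Module ℝ W]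
    {W' : Type*} [AddCommGroup W'] [Module ℝ W'] (L : W ≃ₗ[ℝ] W') {X Y : W}
    (h : LinearIndependent ℝ ![X, Y]) : LinearIndependent ℝ ![L X, L Y] := by
  rw [LinearIndependent.pair_iff] at h ⊢
  intro s t hst
  refine h s t (L.injective ?_)
  rw [map_add, map_smul, map_smul, map_zero, hst]

end GramPos

section LocalSec

set_option linter.unusedSectionVars false
set_option synthInstance.maxHeartbeats 400000
set_option maxHeartbeats 1000000

variable {m : ℕ} {M : Type*} [TopologicalSpace M] [ChartedSpace (Coord m) M]
  [IsManifold (𝓡 m) ∞ M] {e : OpenPartialHomeomorph M (Coord m)}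
  [RiemannianBundle (fun x : M => TangentSpace (𝓡 m) x)]

/-- The numerator of the sectional curvature in a chart. -/
def chartSecNum (e : OpenPartialHomeomorph M (Coord m)) (p : Coord m × Coord m × Coord m) : ℝ :=
  metricForm e p.1 (localCurv (connForm e) p.1 p.2.2 p.2.1 p.2.1) p.2.2

/-- The denominator of the sectional curvature in a chart. -/
def chartSecDen (e : OpenPartialHomeomorph M (Coord m)) (p : Coord m × Coord m × Coord m) : ℝ :=
  metricForm e p.1 p.2.1 p.2.1 * metricForm e p.1 p.2.2 p.2.2 - metricForm e p.1 p.2.1 p.2.2 ^ 2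

theorem inner_eq_chartSecDen (he : e ∈ atlas (Coord m) M) {q : M} (hq : q ∈ e.source)
    (X Y : TangentSpace (𝓡 m) q) : inner ℝ X X * inner ℝ Y Y - inner ℝ X Y ^ 2 =
      chartSecDen e (e q, chartD e q X, chartD e q Y) := by
  simp only [chartSecDen, metricForm_chartD he hq]

variable [IsContMDiffRiemannianBundle (𝓡 m) ∞ (Coord m) (fun x : M => TangentSpace (𝓡 m) x)]

theorem sectional_curv_eq (he : e ∈ atlas (Coord m) M) {q : M} (hq : q ∈ e.source)
    (X Y : TangentSpace (𝓡 m) q) : sectional (curv m q) X Y =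
      chartSecNum e (e q, chartD e q X, chartD e q Y) /
        chartSecDen e (e q, chartD e q X, chartD e q Y) := by
  rw [sectional, inner_eq_chartSecDen he hq, ← metricForm_chartD he hq, chartD_curv he hq]
  rfl

theorem continuousOn_chartSecNum (he : e ∈ atlas (Coord m) M) :
    ContinuousOn (chartSecNum e) {p | p.1 ∈ e.target} := by
  have h0 : ContinuousOn (fun p : Coord m × Coord m × Coord m => p.1) {p | p.1 ∈ e.target} :=
    continuousOn_fst
  have hΓ := (contDiffOn_connForm he).continuousOn.comp h0 fun _ h => h
  have hD := ((contDiffOn_connForm he).fderiv_of_isOpen e.open_target (m := ∞)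
    (by simp)).continuousOn.comp h0 fun _ h => h
  have hg := (contDiffOn_metricForm he).continuousOn.comp h0 fun _ h => h
  have hu : ContinuousOn (fun p : Coord m × Coord m × Coord m => p.2.1) {p | p.1 ∈ e.target} :=
    (continuous_fst.comp continuous_snd).continuousOn
  have hv : ContinuousOn (fun p : Coord m × Coord m × Coord m => p.2.2) {p | p.1 ∈ e.target} :=
    (continuous_snd.comp continuous_snd).continuousOn
  have h1 := ((hD.clm_apply hv).clm_apply hu).clm_apply hu
  have h2 := ((hD.clm_apply hu).clm_apply hv).clm_apply hu
  have h3 := (hΓ.clm_apply hv).clm_apply ((hΓ.clm_apply hu).clm_apply hu)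
  have h4 := (hΓ.clm_apply hu).clm_apply ((hΓ.clm_apply hv).clm_apply hu)
  exact (hg.clm_apply (((h1.sub h2).add h3).sub h4)).clm_apply hv

theorem continuousOn_chartSecDen (he : e ∈ atlas (Coord m) M) :
    ContinuousOn (chartSecDen e) {p | p.1 ∈ e.target} := by
  have h0 : ContinuousOn (fun p : Coord m × Coord m × Coord m => p.1) {p | p.1 ∈ e.target} :=
    continuousOn_fst
  have hg := (contDiffOn_metricForm he).continuousOn.comp h0 fun _ h => h
  have hu : ContinuousOn (fun p : Coord m × Coord m × Coord m => p.2.1) {p | p.1 ∈ e.target} :=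
    (continuous_fst.comp continuous_snd).continuousOn
  have hv : ContinuousOn (fun p : Coord m × Coord m × Coord m => p.2.2) {p | p.1 ∈ e.target} :=
    (continuous_snd.comp continuous_snd).continuousOn
  exact (((hg.clm_apply hu).clm_apply hu).mul ((hg.clm_apply hv).clm_apply hv)).sub
    (((hg.clm_apply hu).clm_apply hv).pow 2)

theorem chartSecDen_pos (he : e ∈ atlas (Coord m) M) {x u v : Coord m} (hx : x ∈ e.target)
    (h : LinearIndependent ℝ ![u, v]) : 0 < chartSecDen e (x, u, v) := by
  have hq := e.map_target hx
  let L := chartEquiv he hq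
  have h1 : LinearIndependent ℝ ![L.symm u, L.symm v] :=
    linearIndependent_pair_map L.symm.toLinearEquiv h
  have h2 := area_pos_of_linearIndependent h1
  rw [inner_eq_chartSecDen he hq, e.right_inv hx, ← chartEquiv_apply he hq,
    ← chartEquiv_apply he hq, L.apply_symm_apply, L.apply_symm_apply] at h2
  exact h2

/-- The sectional curvature is bounded over compact subsets of chart domains. -/
theorem exists_bound_sectional (he : e ∈ atlas (Coord m) M) {K : Set M} (hK : IsCompact K)
    (hKe : K ⊆ e.source) :
    ∃ C : ℝ, ∀ q ∈ K, ∀ X Y : TangentSpace (𝓡 m) q, |sectional (curv m q) X Y| ≤ C := by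
  -- every plane has a basis whose coordinates are orthonormal in the euclidean coordinate space,
  -- and these coordinate pairs form a compact set
  let S : Set (Coord m × Coord m) := {p | ‖p.1‖ = 1 ∧ ‖p.2‖ = 1 ∧ inner ℝ p.1 p.2 = 0}
  have hS : IsCompact S := by
    refine ((isCompact_sphere (0 : Coord m) 1).prod (isCompact_sphere (0 : Coord m) 1)).of_isClosed_subset
      ?_ fun p hp => ⟨by simpa using hp.1, by simpa using hp.2.1⟩
    exact (isClosed_eq (by fun_prop) continuous_const).inter
      ((isClosed_eq (by fun_prop) continuous_const).inter (isClosed_eq (by fun_prop) continuous_const))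
  have hSli : ∀ p ∈ S, LinearIndependent ℝ ![p.1, p.2] := fun p hp => by
    have : Orthonormal ℝ ![p.1, p.2] := by
      rw [orthonormal_iff_ite]
      intro i j
      fin_cases i <;> fin_cases j <;>
        simp [hp.1, hp.2.1, hp.2.2, real_inner_comm]
    exact this.linearIndependent
  have hc : IsCompact ((e '' K) ×ˢ S) := (hK.image_of_continuousOn (e.continuousOn.mono hKe)).prod hS
  have hsub : (e '' K) ×ˢ S ⊆ {p | p.1 ∈ e.target} := by
    rintro p ⟨⟨q, hq, h⟩, -⟩
    show p.1 ∈ e.target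
    rw [← h]
    exact e.map_source (hKe hq)
  have hcont := ((continuousOn_chartSecNum he).mono hsub).div ((continuousOn_chartSecDen he).mono hsub)
    fun p hp => (chartSecDen_pos he (hsub hp) (hSli p.2 hp.2)).ne'
  obtain ⟨C, hC⟩ := hc.exists_bound_of_continuousOn hcont
  refine ⟨max C 0, fun q hq X Y => ?_⟩
  by_cases hXY : LinearIndependent ℝ ![X, Y]
  · have hqs := hKe hq
    let L := chartEquiv he hqs
    let P : Submodule ℝ (Coord m) := Submodule.span ℝ (Set.range ![L X, L Y])
    have hLXY : LinearIndependent ℝ ![L X, L Y] :=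
      linearIndependent_pair_map L.toLinearEquiv hXY
    have hP : Module.finrank ℝ P = 2 := by
      rw [finrank_span_eq_card hLXY, Fintype.card_fin]
    let b : OrthonormalBasis (Fin 2) ℝ P := (stdOrthonormalBasis ℝ P).reindex (finCongr hP)
    have hb : Submodule.span ℝ (Set.range fun i => (b i : Coord m)) = P := by
      have h1 := congrArg (Submodule.map P.subtype) b.toBasis.span_eq
      rw [Submodule.map_span, ← Set.range_comp, Submodule.map_subtype_top] at h1
      simpa [Function.comp_def] using h1
    have hmap : ∀ {f : Fin 2 → Coord m}, Submodule.span ℝ (Set.range fun i => L.symm (f i)) =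
        Submodule.map L.symm.toLinearEquiv.toLinearMap (Submodule.span ℝ (Set.range f)) := by
      intro f
      rw [Submodule.map_span, ← Set.range_comp]
      rfl
    have hspan : Submodule.span ℝ (Set.range ![X, Y]) =
        Submodule.span ℝ (Set.range fun i => L.symm (b i : Coord m)) := by
      rw [hmap, hb, ← hmap]
      congr 2
      funext i
      fin_cases i
      · exact (L.symm_apply_apply X).symm
      · exact (L.symm_apply_apply Y).symm
    have h2 : Module.finrank ℝ (Submodule.span ℝ (Set.range ![X, Y])) = 2 := by
      rw [finrank_span_eq_card hXY, Fintype.card_fin]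
    have h3 := sectional_eq_of_span_eq (curv_mem_Kr q) hspan h2
    have h4 : sectional (curv m q) X Y =
        sectional (curv m q) (L.symm (b 0 : Coord m)) (L.symm (b 1 : Coord m)) := h3
    have h5 : ∀ u, chartD e q (L.symm u) = u := fun u => L.apply_symm_apply u
    rw [h4, sectional_curv_eq he hqs, h5, h5]
    refine le_trans ?_ (le_max_left _ _)
    refine hC (e q, b 0, b 1) ⟨⟨q, hq, rfl⟩, ?_, ?_, ?_⟩
    · exact b.orthonormal.1 0
    · exact b.orthonormal.1 1
    · exact b.orthonormal.2 (by decide : (0 : Fin 2) ≠ 1)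
  · rw [sectional, area_eq_zero_of_not_linearIndependent hXY, div_zero, abs_zero]
    exact le_max_right _ _

theorem exists_bound_sectional_pow (m : ℕ) (M : Type*) [TopologicalSpace M]
    [ChartedSpace (Coord m) M] [IsManifold (𝓡 m) ∞ M] [CompactSpace M]
    [RiemannianBundle (fun x : M => TangentSpace (𝓡 m) x)]
    [IsContMDiffRiemannianBundle (𝓡 m) ∞ (Coord m) (fun x : M => TangentSpace (𝓡 m) x)] (k : ℕ) :
    ∃ C : ℝ, ∀ (q : M) (X Y : TangentSpace (𝓡 m) q), |sectional (curv m q) X Y ^ k| ≤ C := by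
  obtain ⟨t, K, hK, ht⟩ := exists_compact_cover m M
  choose C hC using fun p : M =>
    exists_bound_sectional (chart_mem_atlas (Coord m) p) (hK p).1 (hK p).2
  refine ⟨(∑ p ∈ t, |C p|) ^ k, fun q X Y => ?_⟩
  have hq : q ∈ ⋃ p ∈ t, K p := ht ▸ Set.mem_univ q
  simp only [Set.mem_iUnion] at hq
  obtain ⟨p, hp, hqp⟩ := hq
  rw [abs_pow]
  refine pow_le_pow_left₀ (abs_nonneg _) ?_ k
  exact ((hC p q hqp X Y).trans (le_abs_self _)).trans
    (Finset.single_le_sum (f := fun p => |C p|) (fun _ _ => abs_nonneg _) hp)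

theorem secM_grParam (i : atlas (Coord m) M × (Fin 2 ⊕ Fin (m - 2) ≃ Fin m))
    (w : grDomain i.1.1) : secM (grParam i w) =
      chartSecNum i.1.1 (w.1.1, frameVec (fun j => EuclideanSpace.single j 1)
          (unMat (frameMat i.2 w.1.2)) 0, frameVec (fun j => EuclideanSpace.single j 1)
          (unMat (frameMat i.2 w.1.2)) 1) /
        chartSecDen i.1.1 (w.1.1, frameVec (fun j => EuclideanSpace.single j 1)
          (unMat (frameMat i.2 w.1.2)) 0, frameVec (fun j => EuclideanSpace.single j 1)
          (unMat (frameMat i.2 w.1.2)) 1) := by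
  obtain ⟨⟨e, he⟩, σ⟩ := i
  have hq := e.map_target w.2
  have h1 : ∀ a, chartD e (e.symm w.1.1) (graphFrame e σ w.1 a) =
      frameVec (fun j => EuclideanSpace.single j 1) (unMat (frameMat σ w.1.2)) a := fun a => by
    rw [graphFrame_eq, frameVec, frameVec, map_sum]
    refine Finset.sum_congr rfl fun j _ => ?_
    rw [map_smul, chartD_coordVec he hq]
  have h2 : secM (grParam (⟨e, he⟩, σ) w) =
      sectional (curv m (e.symm w.1.1)) (graphFrame e σ w.1 0) (graphFrame e σ w.1 1) :=
    sec_eq (curv_mem_Kr _) _ (congrArg (Submodule.span ℝ) (range_fin_two (graphFrame e σ w.1)))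
  rw [h2, sectional_curv_eq he hq, h1, h1, e.right_inv w.2]

theorem measurable_secM : Measurable (secM : Gr2TM m M → ℝ) := by
  refine measurable_of_grParam fun i => ?_
  simp_rw [secM_grParam]
  have hf : ∀ a, Continuous fun w : grDomain i.1.1 =>
      (frameVec (fun j => EuclideanSpace.single j 1) (unMat (frameMat i.2 w.1.2)) a : Coord m) := by
    intro a
    unfold frameVec
    refine continuous_finsetSum _ fun j _ => ?_
    have h : Continuous fun w : grDomain i.1.1 => frameMat i.2 w.1.2 j a :=
      (continuous_frameMat_elem i.2 j a).comp (by fun_prop)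
    exact h.smul (continuous_const (y := (EuclideanSpace.single j 1 : Coord m)))
  have hp : Continuous fun w : grDomain i.1.1 => (w.1.1,
      (frameVec (fun j => EuclideanSpace.single j 1) (unMat (frameMat i.2 w.1.2)) 0 : Coord m),
      (frameVec (fun j => EuclideanSpace.single j 1) (unMat (frameMat i.2 w.1.2)) 1 : Coord m)) :=
    Continuous.prodMk (by fun_prop) ((hf 0).prodMk (hf 1))
  exact ((continuousOn_chartSecNum i.1.2).comp_continuous hp fun w => w.2).measurable.div
    ((continuousOn_chartSecDen i.1.2).comp_continuous hp fun w => w.2).measurable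

end LocalSec

/-! ### The moments of the sectional curvature -/

section Moments

set_option linter.unusedSectionVars false

variable {m : ℕ} {M : Type*} [TopologicalSpace M] [ChartedSpace (Coord m) M]
  [IsManifold (𝓡 m) ∞ M] [RiemannianBundle (fun x : M => TangentSpace (𝓡 m) x)]
  [IsContMDiffRiemannianBundle (𝓡 m) ∞ (Coord m) (fun x : M => TangentSpace (𝓡 m) x)]

theorem finrank_tangentSpace (q : M) : Module.finrank ℝ (TangentSpace (𝓡 m) q) = m :=
  finrank_euclideanSpace_fin (𝕜 := ℝ) (n := m)

/-- The average over the planes in `T_q M` of the powers of the sectional curvature. -/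
theorem grAverage_secM_pow (hm : 2 ≤ m) {k : ℕ} {C : ℝ}
    (hC : ∀ (q : M) (X Y : TangentSpace (𝓡 m) q), |sectional (curv m q) X Y ^ k| ≤ C) (q : M) :
    grAverage (fun P : Gr2TM m M => ENNReal.ofReal (secM P ^ k + C)) q =
      ENNReal.ofReal (PsiM m k q + C) := by
  rw [grAverage_eq_lintegral hm
    (G := fun X Y => ENNReal.ofReal (sectional (curv m q) X Y ^ k + C))]
  · exact (lintegral_sectional_pow (tangentBasis q) (curv_mem_Kr q) (by simpa using hm) (hC q)).1
  · intro S X Y h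
    simp only [secM, sec_eq (curv_mem_Kr q) S h]

theorem abs_PsiM_le (hm : 2 ≤ m) {k : ℕ} {C : ℝ}
    (hC : ∀ (q : M) (X Y : TangentSpace (𝓡 m) q), |sectional (curv m q) X Y ^ k| ≤ C) (q : M) :
    |PsiM m k q| ≤ C :=
  abs_Psi_le (curv_mem_Kr (m := m) q) (hm.trans_eq (finrank_tangentSpace (m := m) q).symm) (hC q)

theorem abs_secM_pow_le {k : ℕ} {C : ℝ}
    (hC : ∀ (q : M) (X Y : TangentSpace (𝓡 m) q), |sectional (curv m q) X Y ^ k| ≤ C)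
    (P : Gr2TM m M) : |secM P ^ k| ≤ C := hC P.1 _ _

variable [MeasurableSpace M] [BorelSpace M] [CompactSpace M] [Nonempty M]

/-- `Ψ_k` of the curvature is measurable, being a fibre average up to a constant. -/
theorem measurable_PsiM (hm : 2 ≤ m) (k : ℕ) : Measurable fun q : M => PsiM m k q := by
  obtain ⟨C, hC⟩ := exists_bound_sectional_pow m M k
  have h := (measurable_grAverage hm (F := fun P : Gr2TM m M => ENNReal.ofReal (secM P ^ k + C))
    ((measurable_secM.pow_const k).add_const C).ennreal_ofReal).ennreal_toReal.sub_const C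
  convert h using 2 with q
  rw [grAverage_secM_pow hm hC, ENNReal.toReal_ofReal, add_sub_cancel_right]
  linarith [neg_le_of_abs_le (abs_PsiM_le hm hC q)]

variable [T2Space M]

theorem volGr_pos_lt_top (hm : 2 ≤ m) :
    0 < volGr m M Set.univ ∧ volGr m M Set.univ < ⊤ := by
  have σ : Fin 2 ⊕ Fin (m - 2) ≃ Fin m := finSumFinEquiv.trans (finCongr (by omega))
  have h := volGr_univ (M := M) hm
  constructor
  · rw [pos_iff_ne_zero]
    intro h0
    rw [h0, mul_zero] at h
    exact volM_pos.ne h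
  · rw [lt_top_iff_ne_top]
    intro h0
    rw [h0, ENNReal.mul_top (planeConst_ne_zero σ)] at h
    exact volM_lt_top.ne h.symm

theorem integrable_secM_pow (hm : 2 ≤ m) (k : ℕ) :
    Integrable (fun P : Gr2TM m M => secM P ^ k) (volGr m M) := by
  obtain ⟨C, hC⟩ := exists_bound_sectional_pow m M k
  have : IsFiniteMeasure (volGr m M) := ⟨(volGr_pos_lt_top hm).2⟩
  exact Integrable.of_bound (measurable_secM.pow_const k).aestronglyMeasurable C
    (Eventually.of_forall fun P => abs_secM_pow_le hC P)

theorem integrable_PsiM (hm : 2 ≤ m) (k : ℕ) :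
    Integrable (fun q : M => PsiM m k q) (volM m M) := by
  obtain ⟨C, hC⟩ := exists_bound_sectional_pow m M k
  have : IsFiniteMeasure (volM m M) := ⟨volM_lt_top⟩
  exact Integrable.of_bound (measurable_PsiM hm k).aestronglyMeasurable C
    (Eventually.of_forall fun q => abs_PsiM_le hm hC q)

theorem planeConst_mul_integral (hm : 2 ≤ m) (k : ℕ) :
    (planeConst (Fin m) (m - 2)).toReal * ∫ P : Gr2TM m M, secM P ^ k ∂volGr m M =
      ∫ q : M, PsiM m k q ∂volM m M := by
  obtain ⟨C, hC⟩ := exists_bound_sectional_pow m M k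
  have hfG : IsFiniteMeasure (volGr m M) := ⟨(volGr_pos_lt_top hm).2⟩
  have hfM : IsFiniteMeasure (volM m M) := ⟨volM_lt_top⟩
  have h := congrArg ENNReal.toReal (lintegral_volGr (M := M) hm
    (F := fun P => ENNReal.ofReal (secM P ^ k + C))
    ((measurable_secM.pow_const k).add_const C).ennreal_ofReal)
  simp_rw [grAverage_secM_pow hm hC] at h
  rw [ENNReal.toReal_mul, ← integral_eq_lintegral_of_nonneg_ae
      (Eventually.of_forall fun P => by
        show 0 ≤ secM P ^ k + C
        linarith [neg_le_of_abs_le (abs_secM_pow_le hC P)])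
      ((measurable_secM.pow_const k).add_const C).aestronglyMeasurable,
    ← integral_eq_lintegral_of_nonneg_ae
      (Eventually.of_forall fun q => by
        show 0 ≤ PsiM m k q + C
        linarith [neg_le_of_abs_le (abs_PsiM_le hm hC q)])
      ((measurable_PsiM hm k).add_const C).aestronglyMeasurable,
    integral_add (integrable_secM_pow hm k) (integrable_const C),
    integral_add (integrable_PsiM hm k) (integrable_const C), integral_const, integral_const] at h
  have hv := congrArg ENNReal.toReal (volGr_univ (M := M) hm)
  rw [ENNReal.toReal_mul] at hv
  simp only [Measure.real, smul_eq_mul] at h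
  linear_combination h - C * hv

theorem mean_secM_pow (hm : 2 ≤ m) (k : ℕ) :
    1 / (volGr m M Set.univ).toReal * ∫ P : Gr2TM m M, secM P ^ k ∂volGr m M =
      1 / (volM m M Set.univ).toReal * ∫ q : M, PsiM m k q ∂volM m M := by
  have hv := congrArg ENNReal.toReal (volGr_univ (M := M) hm)
  rw [ENNReal.toReal_mul] at hv
  have h1 := (ENNReal.toReal_pos (volGr_pos_lt_top (M := M) hm).1.ne' (volGr_pos_lt_top hm).2.ne)
  have h2 := (ENNReal.toReal_pos (volM_pos (m := m) (M := M)).ne' volM_lt_top.ne)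
  have h3 : (planeConst (Fin m) (m - 2)).toReal ≠ 0 := fun h0 => by
    rw [h0, zero_mul] at hv
    exact h2.ne hv
  rw [← planeConst_mul_integral hm k, ← hv]
  field_simp

end Moments

end

end SecMoments

theorem corollary2p6 (m : ℕ) (hm : 2 ≤ m) (k : ℕ) :
    -- `Ψ_k^V` is a homogeneous polynomial of degree `k` on `Kr V`, and it is not zero
    (∀ (V : Type*) [NormedAddCommGroup V] [InnerProductSpace ℝ V] [FiniteDimensional ℝ V],
      Module.finrank ℝ V = m →
        SecMoments.IsHomogeneousPoly k
          (fun R : SecMoments.Kr V => SecMoments.Psi k (R : V →ₗ[ℝ] V →ₗ[ℝ] V →ₗ[ℝ] V)) ∧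
        ∃ R ∈ SecMoments.Kr V, SecMoments.Psi k R ≠ 0) ∧
    -- `Ψ_k` is natural under isometries, in particular `O(V, g)`-invariant
    (∀ (V W : Type*) [NormedAddCommGroup V] [InnerProductSpace ℝ V] [FiniteDimensional ℝ V]
        [NormedAddCommGroup W] [InnerProductSpace ℝ W] [FiniteDimensional ℝ W],
      Module.finrank ℝ V = m → ∀ (φ : V ≃ₗᵢ[ℝ] W), ∀ R ∈ SecMoments.Kr V,
        SecMoments.transport φ R ∈ SecMoments.Kr W ∧
        SecMoments.Psi k (SecMoments.transport φ R) = SecMoments.Psi k R) ∧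
    -- the moments of the sectional curvature
    (∀ (M : Type*) [TopologicalSpace M] [T2Space M] [CompactSpace M] [Nonempty M]
        [MeasurableSpace M] [BorelSpace M]
        [ChartedSpace (SecMoments.Coord m) M] [IsManifold (𝓡 m) ∞ M]
        [Bundle.RiemannianBundle (fun x : M => TangentSpace (𝓡 m) x)]
        [IsContMDiffRiemannianBundle (𝓡 m) ∞ (SecMoments.Coord m)
          (fun x : M => TangentSpace (𝓡 m) x)],
      (∀ p : M, SecMoments.curv m p ∈ SecMoments.Kr (TangentSpace (𝓡 m) p)) ∧
      (0 < SecMoments.volM m M Set.univ ∧ SecMoments.volM m M Set.univ < ⊤) ∧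
      (0 < SecMoments.volGr m M Set.univ ∧ SecMoments.volGr m M Set.univ < ⊤) ∧
      MeasureTheory.Integrable (fun P : SecMoments.Gr2TM m M => SecMoments.secM P ^ k) (SecMoments.volGr m M) ∧
      MeasureTheory.Integrable (fun p : M => SecMoments.PsiM m k p)
        (SecMoments.volM m M) ∧
      1 / (SecMoments.volGr m M Set.univ).toReal *
          ∫ P : SecMoments.Gr2TM m M, SecMoments.secM P ^ k ∂(SecMoments.volGr m M) =
        1 / (SecMoments.volM m M Set.univ).toReal *
          ∫ p : M, SecMoments.PsiM m k p ∂(SecMoments.volM m M)) := by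
  refine ⟨fun V _ _ _ hV => ⟨SecMoments.isHomogeneousPoly_Psi k, SecMoments.constCurv V,
    SecMoments.constCurv_mem_Kr, ?_⟩, fun V W _ _ _ _ _ _ _ φ R hR =>
    ⟨SecMoments.transport_mem_Kr φ hR, SecMoments.Psi_transport φ hR k⟩, ?_⟩
  · rw [SecMoments.Psi_constCurv (hV.symm ▸ hm) k]
    exact one_ne_zero
  · intro M _ _ _ _ _ _ _ _ _ _
    exact ⟨SecMoments.curv_mem_Kr, ⟨SecMoments.volM_pos, SecMoments.volM_lt_top⟩,
      SecMoments.volGr_pos_lt_top hm, SecMoments.integrable_secM_pow hm k,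
      SecMoments.integrable_PsiM hm k, SecMoments.mean_secM_pow hm k⟩
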